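/- For an integer $n\ge 2$ and a matrix $B=(b^j_k)\in\mathbb{Z}^{n\times n}$ put $$\mathcal{U}_B=\Big\{z\in\mathbb{C}^n:\ \prod_{k=1}^n|z_k|^{b^j_k}<1\ \text{ for } 1\le j\le n\Big\},$$ where the $j$-th inequality includes the requirement that $z_k\ne 0$ whenever $b^j_k<0$. If $\mathcal{U}_B$ is bounded and connected, it is called a monomial polyhedron. For such $B$ let $\Delta=|\det B|\,B^{-1}$ (which is $\operatorname{adj}B$ when $\det B>0$), let $A$ be the integer matrix whose $j$-th column is the $j$-th column of $\Delta$ divided by the greatest common divisor of its entries, let $s_j$ be the sum of the entries of the $j$-th column of $A$, and put $$p_*=\max_{1\le j\le n}\frac{2s_j}{s_j+1},\qquad q_*=\frac{p_*}{p_*-1}.$$ For an open set $\Omega\subset\mathbb{C}^n$ let $P_\Omega$ be the Bergman projection, the orthogonal projection of $L^2(\Omega)$ (with respect to Lebesgue measure, denoted $|\cdot|$) onto its closed subspace of square-integrable holomorphic functions. We say that $P_\Omega$ is * bounded in $L^p$, $1\le p\le\infty$, if there is $C>0$ with $\|P_\Omega f\|_{L^p}\le C\|f\|_{L^p}$ for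 all $f\in L^2(\Omega)\cap L^p(\Omega)$; * of restricted weak type $(p,p)$, $1\le p<\infty$, if there is $C>0$ with $|\{z\in\Omega:|P_\Omega 1_E(z)|>y\}|\le \frac{C^p}{y^p}|E|$ for all measurable $E\subset\Omega$ of finite measure and all $y>0$; * of weak type $(p,p)$, $1\le p<\infty$, if there is $C>0$ with $|\{z\in\Omega:|P_\Omega f(z)|>y\}|\le \left(\frac{C}{y}\|f\|_{L^p}\right)^p$ for all $f\in L^2(\Omega)\cap L^p(\Omega)$ and all $y>0$. **Theorem.** There are monomial polyhedra $\mathcal{U}_B$ such that, for $1\le p\le\infty$, the Bergman projection $P_{\mathcal{U}_B}$ is bounded in $L^p$ if and only if $p_*<p<q_*$, and such that $P_{\mathcal{U}_B}$ is not of restricted weak type $(p_*,p_*)$ and not of weak type $(q_*,q_*)$. An example is the domain $$\{z\in\mathbb{C}^3:\ |z_1z_3|<|z_2|<|z_1|<1\}.$$ It is a monomial polyhedron $\mathcal{U}_B$ for a matrix $B\in\mathbb{Z}^{3\times 3}$ with $p_*=\frac43$ and $q_*=4$; its Bergman projection is bounded in $L^p$, $1\le p\le\infty$, if and only if $\frac43<p<4$,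 it is not of restricted weak type $(\frac43,\frac43)$, and it is not of weak type $(4,4)$. -/

import Mathlib

open MeasureTheory Filter Topology
open scoped ENNReal

/-- Lebesgue measure on `ℂⁿ` is invariant under `v ↦ z + e^{iθ} v`. -/
theorem lintegral_circle_rotate {n : ℕ} (F : (Fin n → ℂ) → ℝ≥0∞) (hF : Measurable F)
    (z : Fin n → ℂ) (θ : ℝ) :
    ∫⁻ v, F (z + circleMap 0 1 θ • v) = ∫⁻ v, F v := by
  have h1 : MeasurePreserving (fun v : Fin n → ℂ => circleMap 0 1 θ • v) volume volume := by
    refine volume_preserving_pi (f := fun _ x => circleMap 0 1 θ * x) fun _ => ?_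
    have := (rotation (Circle.exp θ)).measurePreserving
    convert! this using 1
    ext x
    simp [circleMap, rotation_apply, Circle.coe_exp]
  have h2 := (measurePreserving_add_left volume z).comp h1
  exact h2.lintegral_comp hF

/-- Mean value inequality for holomorphic functions on a polydisc. -/
theorem enorm_mul_volume_ball_le {n : ℕ} {g : (Fin n → ℂ) → ℂ} {z : Fin n → ℂ} {r : ℝ}
    (hg : DifferentiableOn ℂ g (Metric.ball z r)) :
    ‖g z‖ₑ * volume (Metric.ball (0 : Fin n → ℂ) r) ≤ ∫⁻ v in Metric.ball z r, ‖g v‖ₑ := by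
  set F : (Fin n → ℂ) → ℝ≥0∞ := (Metric.ball z r).indicator fun v => ‖g v‖ₑ with hFdef
  have hF : Measurable F := by
    classical
    have : ContinuousOn (fun v => ‖g v‖ₑ) (Metric.ball z r) :=
      continuous_enorm.comp_continuousOn hg.continuousOn
    have h0 := (this.measurable_piecewise (g := fun _ => (0 : ℝ≥0∞)) continuousOn_const
      Metric.isOpen_ball.measurableSet)
    convert! h0 using 1
  have key : ∀ v ∈ Metric.ball (0 : Fin n → ℂ) r,
      ‖g z‖ₑ ≤ ENNReal.ofReal (2 * Real.pi)⁻¹ *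
        ∫⁻ θ in Set.Ioc 0 (2 * Real.pi), F (z + circleMap 0 1 θ • v) := by
    intro v hv
    have hmem : ∀ ζ : ℂ, ‖ζ‖ ≤ 1 → z + ζ • v ∈ Metric.ball z r := by
      intro ζ hζ
      simp only [Metric.mem_ball, dist_self_add_left, norm_smul, dist_zero_right] at hv ⊢
      nlinarith [norm_nonneg v]
    have hd : DifferentiableOn ℂ (fun ζ : ℂ => g (z + ζ • v)) (Metric.closedBall 0 1) := by
      refine hg.comp (by fun_prop) fun ζ hζ => hmem ζ (by simpa using hζ)
    have hdc : DiffContOnCl ℂ (fun ζ : ℂ => g (z + ζ • v)) (Metric.ball 0 |(1 : ℝ)|) := by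
      refine DifferentiableOn.diffContOnCl ?_
      rw [abs_one, closure_ball _ one_ne_zero]
      exact hd
    have havg := hdc.circleAverage
    simp only [zero_smul, add_zero] at havg
    rw [← havg, Real.circleAverage_def, enorm_smul,
      intervalIntegral.integral_of_le Real.two_pi_pos.le]
    have h1 : ‖(2 * Real.pi)⁻¹‖ₑ = ENNReal.ofReal (2 * Real.pi)⁻¹ :=
      Real.enorm_of_nonneg (by positivity)
    rw [h1]
    gcongr
    refine (enorm_integral_le_lintegral_enorm _).trans (le_of_eq ?_)
    congr 1 with θ
    rw [hFdef, Set.indicator_of_mem (hmem _ (by simp))]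
  calc ‖g z‖ₑ * volume (Metric.ball (0 : Fin n → ℂ) r)
      = ∫⁻ _ in Metric.ball (0 : Fin n → ℂ) r, ‖g z‖ₑ := by simp
    _ ≤ ∫⁻ v in Metric.ball (0 : Fin n → ℂ) r, ENNReal.ofReal (2 * Real.pi)⁻¹ *
        ∫⁻ θ in Set.Ioc 0 (2 * Real.pi), F (z + circleMap 0 1 θ • v) :=
        setLIntegral_mono' Metric.isOpen_ball.measurableSet key
    _ ≤ ∫⁻ v, ENNReal.ofReal (2 * Real.pi)⁻¹ *
        ∫⁻ θ in Set.Ioc 0 (2 * Real.pi), F (z + circleMap 0 1 θ • v) := setLIntegral_le_lintegral _ _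
    _ = ENNReal.ofReal (2 * Real.pi)⁻¹ *
        ∫⁻ v, ∫⁻ θ in Set.Ioc 0 (2 * Real.pi), F (z + circleMap 0 1 θ • v) :=
        lintegral_const_mul' _ _ ENNReal.ofReal_ne_top
    _ = ENNReal.ofReal (2 * Real.pi)⁻¹ *
        ∫⁻ θ in Set.Ioc 0 (2 * Real.pi), ∫⁻ v, F (z + circleMap 0 1 θ • v) := by
        congr 1
        refine lintegral_lintegral_swap (Measurable.aemeasurable ?_)
        refine hF.comp ?_
        have hc : Continuous (Function.uncurry fun (v : Fin n → ℂ) (θ : ℝ) =>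
            z + circleMap 0 1 θ • v) := by
          have : Continuous fun p : (Fin n → ℂ) × ℝ => circleMap 0 1 p.2 :=
            (continuous_circleMap 0 1).comp continuous_snd
          exact continuous_const.add (this.smul continuous_fst)
        exact hc.measurable
    _ = ∫⁻ v in Metric.ball z r, ‖g v‖ₑ := by
        simp_rw [lintegral_circle_rotate F hF z]
        rw [setLIntegral_const, Real.volume_Ioc, mul_comm, mul_assoc, ← ENNReal.ofReal_mul
          (by linarith [Real.two_pi_pos]), sub_zero, mul_inv_cancel₀ Real.two_pi_pos.ne']
        rw [ENNReal.ofReal_one, mul_one, hFdef, lintegral_indicator Metric.isOpen_ball.measurableSet]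

/-- The Bergman space `A²(Ω)`: the classes in `L²(Ω)` (Lebesgue measure) which have a representative
that is holomorphic on `Ω`. -/
def bergmanSpace {n : ℕ} (Ω : TopologicalSpace.Opens (Fin n → ℂ)) :
    Submodule ℂ (Lp ℂ 2 (volume.restrict (Ω : Set (Fin n → ℂ)))) where
  carrier := {f | ∃ g : (Fin n → ℂ) → ℂ, DifferentiableOn ℂ g Ω ∧
    f =ᵐ[volume.restrict (Ω : Set (Fin n → ℂ))] g}
  zero_mem' := ⟨0, differentiableOn_const 0, Lp.coeFn_zero ℂ 2 _⟩
  add_mem' := by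
    rintro f₁ f₂ ⟨g₁, hg₁, h₁⟩ ⟨g₂, hg₂, h₂⟩
    exact ⟨g₁ + g₂, hg₁.add hg₂, (Lp.coeFn_add f₁ f₂).trans (h₁.add h₂)⟩
  smul_mem' := by
    rintro c f ⟨g, hg, h⟩
    exact ⟨c • g, hg.const_smul c, (Lp.coeFn_smul c f).trans (h.const_smul c)⟩

/-- Interior estimate: point values of square integrable holomorphic functions are controlled by the
`L²` norm, uniformly over centres of balls of a fixed radius contained in `Ω`. -/
theorem exists_norm_le_mul_norm_Lp {n : ℕ} (Ω : TopologicalSpace.Opens (Fin n → ℂ)) {r : ℝ}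
    (hr : 0 < r) : ∃ C : ℝ, 0 ≤ C ∧ ∀ (f : Lp ℂ 2 (volume.restrict (Ω : Set (Fin n → ℂ))))
      (g : (Fin n → ℂ) → ℂ), DifferentiableOn ℂ g Ω →
      f =ᵐ[volume.restrict (Ω : Set (Fin n → ℂ))] g → ∀ z, Metric.ball z r ⊆ Ω →
      ‖g z‖ ≤ C * ‖f‖ := by
  set V : ℝ≥0∞ := volume (Metric.ball (0 : Fin n → ℂ) r) with hV
  have hV0 : V ≠ 0 := (Metric.measure_ball_pos volume _ hr).ne'
  have hVt : V ≠ ∞ := measure_ball_lt_top.ne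
  refine ⟨(V ^ (1 / 2 : ℝ) / V).toReal, ENNReal.toReal_nonneg, ?_⟩
  intro f g hg hfg z hz
  have hfgz : f =ᵐ[volume.restrict (Metric.ball z r)] g := ae_restrict_of_ae_restrict_of_subset hz hfg
  have hmz : AEStronglyMeasurable f (volume.restrict (Metric.ball z r)) :=
    (Lp.aestronglyMeasurable f).mono_measure (Measure.restrict_mono_set _ hz)
  have h1 := enorm_mul_volume_ball_le (hg.mono hz)
  have h2 : ∫⁻ v in Metric.ball z r, ‖g v‖ₑ = eLpNorm f 1 (volume.restrict (Metric.ball z r)) := by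
    rw [eLpNorm_one_eq_lintegral_enorm]
    exact lintegral_congr_ae (hfgz.mono fun x hx => by simp [hx])
  have h3 : eLpNorm f 1 (volume.restrict (Metric.ball z r)) ≤
      eLpNorm f 2 (volume.restrict (Ω : Set (Fin n → ℂ))) * V ^ (1 / 2 : ℝ) := by
    refine (eLpNorm_le_eLpNorm_mul_rpow_measure_univ (q := 2) (by norm_num) hmz).trans ?_
    have hvol : volume (Metric.ball z r) = V := Measure.addHaar_ball_center _ _ _
    rw [Measure.restrict_apply_univ, hvol]
    have : (1 / (1 : ℝ≥0∞).toReal - 1 / (2 : ℝ≥0∞).toReal) = (1 / 2 : ℝ) := by norm_num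
    rw [this]
    gcongr
  have h4 : ‖g z‖ₑ ≤ V ^ (1 / 2 : ℝ) / V * ‖f‖ₑ := by
    rw [h2] at h1
    have h5 := (ENNReal.le_div_iff_mul_le (Or.inl hV0) (Or.inl hVt)).2 (h1.trans h3)
    refine h5.trans (le_of_eq ?_)
    rw [Lp.enorm_def, mul_comm, ENNReal.mul_div_right_comm]
  have hCt : V ^ (1 / 2 : ℝ) / V ≠ ∞ :=
    ENNReal.div_ne_top (ENNReal.rpow_ne_top_of_nonneg (by norm_num) hVt) hV0
  have h6 := ENNReal.toReal_mono (ENNReal.mul_ne_top hCt enorm_ne_top) h4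
  simpa [ENNReal.toReal_mul] using h6

/-- The Bergman space is a closed subspace of `L²(Ω)`. -/
theorem isClosed_bergmanSpace {n : ℕ} (Ω : TopologicalSpace.Opens (Fin n → ℂ)) :
    IsClosed (bergmanSpace Ω : Set (Lp ℂ 2 (volume.restrict (Ω : Set (Fin n → ℂ))))) := by
  refine IsSeqClosed.isClosed ?_
  intro f f₀ hf hlim
  choose g hg hfg using hf
  -- interior estimates for differences
  have hest : ∀ r : ℝ, 0 < r → ∃ C : ℝ, 0 ≤ C ∧ ∀ i j z, Metric.ball z r ⊆ (Ω : Set (Fin n → ℂ)) →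
      ‖g i z - g j z‖ ≤ C * dist (f i) (f j) := by
    intro r hr
    obtain ⟨C, hC, h⟩ := exists_norm_le_mul_norm_Lp Ω hr
    refine ⟨C, hC, fun i j z hz => ?_⟩
    rw [dist_eq_norm]
    exact h (f i - f j) (g i - g j) ((hg i).sub (hg j))
      ((Lp.coeFn_sub _ _).trans ((hfg i).sub (hfg j))) z hz
  have hcau := hlim.cauchySeq
  have hpt : ∀ z ∈ Ω, ∃ w, Tendsto (fun k => g k z) atTop (𝓝 w) := by
    intro z hz
    obtain ⟨r, hr, hrz⟩ := Metric.isOpen_iff.1 Ω.isOpen z hz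
    obtain ⟨C, hC, h⟩ := hest r hr
    refine cauchySeq_tendsto_of_complete (Metric.cauchySeq_iff'.2 fun ε hε => ?_)
    obtain ⟨N, hN⟩ := Metric.cauchySeq_iff'.1 hcau (ε / (C + 1)) (by positivity)
    refine ⟨N, fun k hk => ?_⟩
    rw [dist_eq_norm]
    have h1 := h k N z hrz
    have h2 := hN k hk
    rw [lt_div_iff₀ (by positivity)] at h2
    nlinarith [dist_nonneg (x := f k) (y := f N)]
  choose! G hG using hpt
  refine ⟨G, fun z hz => ?_, ?_⟩
  · obtain ⟨r, hr, hrz⟩ := Metric.isOpen_iff.1 Ω.isOpen z hz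
    obtain ⟨C, hC, h⟩ := hest (r / 3) (by positivity)
    have hsub : Metric.ball z (r / 3) ⊆ (Ω : Set (Fin n → ℂ)) :=
      (Metric.ball_subset_ball (by linarith)).trans hrz
    have hval : ∀ i j, ∀ y ∈ Metric.ball z (2 * r / 3), ‖g i y - g j y‖ ≤ C * dist (f i) (f j) := by
      intro i j y hy
      refine h i j y ((Metric.ball_subset_ball' ?_).trans hrz)
      have := Metric.mem_ball.1 hy
      linarith
    have hder : ∀ i j, ∀ y ∈ Metric.ball z (r / 3), ‖fderiv ℂ (g i) y - fderiv ℂ (g j) y‖ ≤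
        (2 * (C * dist (f i) (f j))) / (r / 3) := by
      intro i j y hy
      have hyb : Metric.ball y (r / 3) ⊆ Metric.ball z (2 * r / 3) := by
        refine Metric.ball_subset_ball' ?_
        have := Metric.mem_ball.1 hy
        linarith
      have hyΩ : Metric.ball y (r / 3) ⊆ (Ω : Set (Fin n → ℂ)) :=
        hyb.trans ((Metric.ball_subset_ball (by linarith)).trans hrz)
      have hdat : ∀ k, DifferentiableAt ℂ (g k) y := fun k =>
        (hg k).differentiableAt (Ω.isOpen.mem_nhds (hsub hy))
      rw [← fderiv_sub (hdat i) (hdat j)]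
      refine Complex.norm_fderiv_le_div_of_mapsTo_ball
        (((hg i).sub (hg j)).mono hyΩ) ?_ (by positivity)
      intro x hx
      rw [mem_closedBall_iff_norm]
      refine (norm_sub_le _ _).trans ?_
      have e1 := hval i j x (hyb hx)
      have e2 := hval i j y (hyb (Metric.mem_ball_self (by positivity)))
      simp only [Pi.sub_apply]
      linarith
    have hUC : UniformCauchySeqOn (fun k y => fderiv ℂ (g k) y) atTop (Metric.ball z (r / 3)) := by
      rw [Metric.uniformCauchySeqOn_iff]
      intro ε hε
      obtain ⟨N, hN⟩ := Metric.cauchySeq_iff.1 hcau (ε * (r / 3) / (2 * (C + 1))) (by positivity)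
      refine ⟨N, fun i hi j hj y hy => ?_⟩
      rw [dist_eq_norm]
      refine (hder i j y hy).trans_lt ?_
      have h2 := hN i hi j hj
      rw [lt_div_iff₀ (by positivity)] at h2
      rw [div_lt_iff₀ (by positivity)]
      nlinarith [dist_nonneg (x := f i) (y := f j)]
    have hex : ∀ y ∈ Metric.ball z (r / 3), ∃ L, Tendsto (fun k => fderiv ℂ (g k) y) atTop (𝓝 L) :=
      fun y hy => cauchySeq_tendsto_of_complete (hUC.cauchySeq hy)
    choose! L hL using hex
    have hU := hUC.tendstoUniformlyOn_of_tendsto hL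
    exact (hasFDerivAt_of_tendstoUniformlyOn Metric.isOpen_ball hU
      (fun k y hy => ((hg k).differentiableAt (Ω.isOpen.mem_nhds (hsub hy))).hasFDerivAt)
      (fun y hy => hG y (hsub hy))
      (Metric.mem_ball_self (by positivity))).differentiableAt.differentiableWithinAt
  · obtain ⟨ns, hns, hae⟩ := (tendstoInMeasure_of_tendsto_Lp hlim).exists_seq_tendsto_ae
    filter_upwards [hae, ae_all_iff.2 hfg, ae_restrict_mem Ω.isOpen.measurableSet] with z h1 h2 h3
    refine tendsto_nhds_unique h1 ?_
    simp_rw [h2]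
    exact (hG z h3).comp hns.tendsto_atTop

/-- The orthogonal projection onto the Bergman space exists. -/
instance bergmanSpace_hasOrthogonalProjection {n : ℕ} (Ω : TopologicalSpace.Opens (Fin n → ℂ)) :
    (bergmanSpace Ω).HasOrthogonalProjection :=
  haveI : CompleteSpace (bergmanSpace Ω) := (isClosed_bergmanSpace Ω).completeSpace_coe
  inferInstance

/-- The Bergman projection `P_Ω`: the orthogonal projection of `L²(Ω)` onto `A²(Ω)`. -/
noncomputable def bergmanProjection {n : ℕ} (Ω : TopologicalSpace.Opens (Fin n → ℂ)) :
    Lp ℂ 2 (volume.restrict (Ω : Set (Fin n → ℂ))) →L[ℂ]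
      Lp ℂ 2 (volume.restrict (Ω : Set (Fin n → ℂ))) :=
  (bergmanSpace Ω).starProjection

section OperatorTypes

variable {M : Type*} [MeasurableSpace M] {μ : Measure M}

/-- `T` is of restricted weak type `(p, p)`: there is `C > 0` such that
`μ {|T 1_E| > y} ≤ (C ^ p / y ^ p) μ(E)` for all measurable `E` of finite measure and all `y > 0`. -/
def IsRestrictedWeakType (T : Lp ℂ 2 μ →L[ℂ] Lp ℂ 2 μ) (p : ℝ) : Prop :=
  ∃ C : ℝ, 0 < C ∧ ∀ (E : Set M) (hE : MeasurableSet E) (hμE : μ E ≠ ∞) (y : ℝ), 0 < y →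
    μ {x | y < ‖T (indicatorConstLp 2 hE hμE (1 : ℂ)) x‖} ≤ ENNReal.ofReal (C ^ p / y ^ p) * μ E

/-- `T`, defined on `L²`, is of weak type `(p, p)`: it is bounded from `L^p` to `L^{p,∞}`, i.e. there
is `C > 0` with `μ {|T f| > y} ≤ ((C / y) ‖f‖_p) ^ p` for all `f` in `L² ∩ L^p` and all `y > 0`.
(If `μ` is finite and `p ≥ 2`, then `L² ∩ L^p = L^p`.) -/
def IsWeakType (T : Lp ℂ 2 μ →L[ℂ] Lp ℂ 2 μ) (p : ℝ) : Prop :=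
  ∃ C : ℝ, 0 < C ∧ ∀ f : Lp ℂ 2 μ, MemLp f (ENNReal.ofReal p) μ → ∀ y : ℝ, 0 < y →
    μ {x | y < ‖T f x‖} ≤ (ENNReal.ofReal (C / y) * eLpNorm f (ENNReal.ofReal p) μ) ^ p

/-- `T`, defined on `L²`, is bounded in `L^p` (strong type `(p, p)`): there is `C > 0` with
`‖T f‖_p ≤ C ‖f‖_p` for all `f` in `L² ∩ L^p`. -/
def IsStrongType (T : Lp ℂ 2 μ →L[ℂ] Lp ℂ 2 μ) (p : ℝ≥0∞) : Prop :=
  ∃ C : ℝ, 0 < C ∧ ∀ f : Lp ℂ 2 μ, MemLp f p μ →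
    eLpNorm (T f) p μ ≤ ENNReal.ofReal C * eLpNorm f p μ

end OperatorTypes

section MonomialPolyhedra

variable {n : ℕ}

/-- The set `U_B = {z ∈ ℂⁿ : ∏ₖ |zₖ| ^ (B j k) < 1 for all j}`. The inequality for `j` presupposes that
the product is defined, i.e. that `zₖ ≠ 0` whenever the exponent `B j k` is negative; the convention
`0 ^ 0 = 1` is in force. -/
def monomialSet (B : Matrix (Fin n) (Fin n) ℤ) : Set (Fin n → ℂ) :=
  {z | ∀ j, (∀ k, B j k < 0 → z k ≠ 0) ∧ ∏ k, ‖z k‖ ^ B j k < 1}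

theorem isOpen_monomialSet (B : Matrix (Fin n) (Fin n) ℤ) : IsOpen (monomialSet B) := by
  have h : monomialSet B = ⋂ j, ({z : Fin n → ℂ | ∀ k, B j k < 0 → z k ≠ 0} ∩
      (fun z : Fin n → ℂ => ∏ k, ‖z k‖ ^ B j k) ⁻¹' Set.Iio 1) := by
    ext z
    simp [monomialSet]
  rw [h]
  refine isOpen_iInter_of_finite fun j => ContinuousOn.isOpen_inter_preimage ?_ ?_ isOpen_Iio
  · refine continuousOn_finsetProd _ fun k _ => ContinuousOn.zpow₀ (by fun_prop) _ fun z hz => ?_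
    rcases lt_or_ge (B j k) 0 with hk | hk
    · exact Or.inl (norm_ne_zero_iff.2 (hz k hk))
    · exact Or.inr hk
  · simp only [Set.ofPred_forall]
    refine isOpen_iInter_of_finite fun k => isOpen_iInter_of_finite fun _ => ?_
    exact isOpen_ne_fun (continuous_apply k) continuous_const

/-- `U_B` as an open subset of `ℂⁿ`. -/
def monomialOpens (B : Matrix (Fin n) (Fin n) ℤ) : TopologicalSpace.Opens (Fin n → ℂ) :=
  ⟨monomialSet B, isOpen_monomialSet B⟩

/-- `U_B` is a monomial polyhedron: it is a bounded domain in `ℂⁿ`, with `n ≥ 2`. -/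
def IsMonomialPolyhedron (B : Matrix (Fin n) (Fin n) ℤ) : Prop :=
  2 ≤ n ∧ Bornology.IsBounded (monomialSet B) ∧ IsConnected (monomialSet B)

/-- The matrix `Δ = adj B`, with the sign that makes `Δ = |det B| B⁻¹`. (If `det B > 0`, this is
`adj B`; the case `det B < 0` is reduced to it by interchanging two rows of `B`, which changes
neither `U_B` nor the set of columns of `Δ`.) -/
def monomialDelta (B : Matrix (Fin n) (Fin n) ℤ) : Matrix (Fin n) (Fin n) ℤ :=
  B.det.sign • B.adjugate

/-- The matrix `A`, whose `j`-th column is the `j`-th column of `Δ` divided by the greatest common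
divisor of its entries. -/
def monomialA (B : Matrix (Fin n) (Fin n) ℤ) : Matrix (Fin n) (Fin n) ℤ :=
  Matrix.of fun i j => monomialDelta B i j / Finset.univ.gcd fun k => monomialDelta B k j

/-- `p_* = max_j 2 (1 a_j) / (1 a_j + 1)`, where `1 a_j` is the sum of the `j`-th column of `A`. -/
noncomputable def pStar (B : Matrix (Fin n) (Fin n) ℤ) : ℝ :=
  ⨆ j, 2 * ((∑ i, monomialA B i j : ℤ) : ℝ) / (((∑ i, monomialA B i j : ℤ) : ℝ) + 1)

/-- `q_*`, the Hölder conjugate `p_* / (p_* - 1)` of `p_*`. -/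
noncomputable def qStar (B : Matrix (Fin n) (Fin n) ℤ) : ℝ :=
  (pStar B).conjExponent

end MonomialPolyhedra

/-! Write D for the unit disc and D* for the punctured disc. The monomial map `wedgeMap`, (a, b, c)
↦ (a, ab, bc), is a biholomorphism of D* × D* × D onto the domain, with Jacobian determinant ab.
Lebesgue measure turns into |a|²|b|² da db dc (`map_wedgeMap`), and f ↦ ab · (f ∘ `wedgeMap`)
carries square integrable holomorphic functions to such functions on the source, where square
integrability makes the punctures invisible to the reproducing formula. Hence the projection is an
integral operator whose kernel is the product of three disc kernels divided by w₁w₂ · conj(u₁u₂)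
(`bergmanProjection_wedge_ae`).

Boundedness inside the interval is Schur's test for the modulus of this kernel, with the product
weight |u|^(-a) (1 - |u|²)^(-b) in the first two variables and (1 - |u|²)^(-b) in the third. The
singularity at 0 demands 1 ≤ ap < 3 and 1 ≤ aq < 3 for conjugate p, q, and such an a exists exactly
when 4/3 < p < 4 (`exists_lintegral_sourceKernel_le`).

A single bounded function settles everything else: P(conj z₂) = 1/(4 z₂)
(`bergmanProjection_conjCoord`). The part of the domain where |z₂| < ε has volume at least a
constant times ε⁴ log(1/ε) (`le_volume_sectorPart`). The logarithm comes from a tie: z₂ = ab, and a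
and b carry the same weight, just as two columns of A share the maximal sum 2. So 1/z₂ is not in
weak L⁴, which excludes weak type (4, 4) and all p ≥ 4. For the lower endpoint one dualizes: P is
self-adjoint, so ⟨P 1_E, conj z₂⟩ is the integral of 1/(4 z₂) over E. If E keeps z₂ in a sector of
size ε, there is no cancellation and ‖P 1_E‖₁ is at least |E|/(8ε). Restricted weak type (4/3, 4/3),
or boundedness for some p ≤ 4/3, would bound this norm by a constant times |E|^(3/4), hence |E| by a
constant times ε⁴. -/

/-! ### The matrix B and its exponents. -/

/-- The matrix of the domain `{|z₁ z₃| < |z₂| < |z₁| < 1}`. -/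
def wedgeMatrix : Matrix (Fin 3) (Fin 3) ℤ := !![1, -1, 1; -1, 1, 0; 1, 0, 0]

/-- The domain `{|z₁ z₃| < |z₂| < |z₁| < 1}`. -/
def wedge : Set (Fin 3 → ℂ) := {z | ‖z 0 * z 2‖ < ‖z 1‖ ∧ ‖z 1‖ < ‖z 0‖ ∧ ‖z 0‖ < 1}

theorem monomialSet_wedgeMatrix : monomialSet wedgeMatrix = wedge := by
  ext z
  simp only [monomialSet, wedge, wedgeMatrix, Set.mem_ofPred_eq, Fin.forall_fin_succ,
    Fin.prod_univ_three]
  simp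
  constructor
  · rintro ⟨⟨h1, h2⟩, ⟨h0, h3⟩, h4⟩
    have p1 : 0 < ‖z 1‖ := norm_pos_iff.2 h1
    have p0 : 0 < ‖z 0‖ := norm_pos_iff.2 h0
    refine ⟨?_, ?_, h4⟩
    · field_simp at h2
      exact h2
    · field_simp at h3
      exact h3
  · rintro ⟨h1, h2, h3⟩
    have p1 : 0 < ‖z 1‖ := lt_of_le_of_lt (by positivity) h1
    have p0 : 0 < ‖z 0‖ := p1.trans h2
    refine ⟨⟨norm_pos_iff.1 p1, ?_⟩, ⟨norm_pos_iff.1 p0, ?_⟩, h3⟩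
    · field_simp
      exact h1
    · field_simp
      exact h2

/-- The determinant is -1, so the sign in `monomialDelta` matters: it makes all entries nonnegative.
The column sums are 1, 2, 2, and the repeated maximum is what spoils the endpoints. -/
theorem monomialA_wedgeMatrix :
    monomialA wedgeMatrix = !![0, 0, 1; 0, 1, 1; 1, 1, 0] := by
  have hdet : wedgeMatrix.det = -1 := by decide
  have hadj : wedgeMatrix.adjugate = !![0, 0, -1; 0, -1, -1; -1, -1, 0] := by
    rw [Matrix.adjugate_fin_three]
    decide
  have hΔ : monomialDelta wedgeMatrix = !![0, 0, 1; 0, 1, 1; 1, 1, 0] := by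
    rw [monomialDelta, hdet, hadj]
    decide
  have hgcd : ∀ j, (Finset.univ.gcd fun k => monomialDelta wedgeMatrix k j) = 1 := by
    rw [hΔ]
    decide
  ext i j
  rw [monomialA, Matrix.of_apply, hgcd, Int.ediv_one, hΔ]

theorem pStar_wedgeMatrix : pStar wedgeMatrix = 4 / 3 := by
  rw [pStar, monomialA_wedgeMatrix]
  apply le_antisymm
  · refine ciSup_le fun j => ?_
    fin_cases j <;> simp [Fin.sum_univ_three] <;> norm_num
  -- Index 1 is the column (0, 1, 1), one of the two with sum 2.
  · refine le_ciSup_of_le (Set.finite_range _).bddAbove 1 ?_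
    simp [Fin.sum_univ_three]
    norm_num

theorem qStar_wedgeMatrix : qStar wedgeMatrix = 4 := by
  rw [qStar, pStar_wedgeMatrix, Real.conjExponent]
  norm_num

/-! ### Monomial coordinates on the domain. -/

/-- The punctured unit disc. -/
def puncturedDisc : Set ℂ := Metric.ball 0 1 \ {0}

theorem mem_puncturedDisc {w : ℂ} : w ∈ puncturedDisc ↔ ‖w‖ < 1 ∧ w ≠ 0 := by
  simp [puncturedDisc]

theorem isOpen_puncturedDisc : IsOpen puncturedDisc :=
  Metric.isOpen_ball.sdiff isClosed_singleton

/-- The monomial parametrization of `wedge`. -/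
def wedgeMap (w : ℂ × ℂ × ℂ) : Fin 3 → ℂ := ![w.1, w.1 * w.2.1, w.2.1 * w.2.2]

/-- The inverse of `wedgeMap`. -/
noncomputable def wedgeInv (z : Fin 3 → ℂ) : ℂ × ℂ × ℂ := (z 0, z 1 / z 0, z 0 * z 2 / z 1)

/-- The product of two punctured discs and a disc. -/
def wedgeSource : Set (ℂ × ℂ × ℂ) := puncturedDisc ×ˢ puncturedDisc ×ˢ Metric.ball (0 : ℂ) 1

@[simp] theorem wedgeMap_zero (w : ℂ × ℂ × ℂ) : wedgeMap w 0 = w.1 := rfl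

@[simp] theorem wedgeMap_one (w : ℂ × ℂ × ℂ) : wedgeMap w 1 = w.1 * w.2.1 := rfl

@[simp] theorem wedgeMap_two (w : ℂ × ℂ × ℂ) : wedgeMap w 2 = w.2.1 * w.2.2 := rfl

theorem wedgeMap_mem_iff (w : ℂ × ℂ × ℂ) : wedgeMap w ∈ wedge ↔ w ∈ wedgeSource := by
  obtain ⟨a, b, c⟩ := w
  simp only [wedge, wedgeSource, Set.mem_ofPred_eq, wedgeMap_zero, wedgeMap_one, wedgeMap_two,
    Set.mem_prod, mem_puncturedDisc, norm_mul, mem_ball_zero_iff]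
  constructor
  · rintro ⟨h1, h2, h3⟩
    have pab : 0 < ‖a‖ * ‖b‖ := lt_of_le_of_lt (by positivity) h1
    have pa : 0 < ‖a‖ := pos_of_mul_pos_left pab (norm_nonneg _)
    have pb : 0 < ‖b‖ := pos_of_mul_pos_right pab (norm_nonneg _)
    refine ⟨⟨h3, norm_pos_iff.1 pa⟩, ⟨by nlinarith, norm_pos_iff.1 pb⟩, ?_⟩
    by_contra! h
    nlinarith
  · rintro ⟨⟨h1, h2⟩, ⟨h3, h4⟩, h5⟩
    have pa : 0 < ‖a‖ := norm_pos_iff.2 h2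
    have pb : 0 < ‖b‖ := norm_pos_iff.2 h4
    refine ⟨?_, by nlinarith, h1⟩
    have : 0 < ‖a‖ * ‖b‖ := by positivity
    nlinarith

theorem wedgeInv_wedgeMap {w : ℂ × ℂ × ℂ} (hw : w ∈ wedgeSource) : wedgeInv (wedgeMap w) = w := by
  obtain ⟨a, b, c⟩ := w
  obtain ⟨h1, h2, -⟩ := hw
  have ha : a ≠ 0 := (mem_puncturedDisc.1 h1).2
  have hb : b ≠ 0 := (mem_puncturedDisc.1 h2).2
  simp only [wedgeInv, wedgeMap_zero, wedgeMap_one, wedgeMap_two]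
  congr 2 <;> field_simp

theorem ne_zero_of_mem_wedge {z : Fin 3 → ℂ} (hz : z ∈ wedge) : z 0 ≠ 0 ∧ z 1 ≠ 0 := by
  have p1 : 0 < ‖z 1‖ := lt_of_le_of_lt (by positivity) hz.1
  exact ⟨norm_pos_iff.1 (p1.trans hz.2.1), norm_pos_iff.1 p1⟩

theorem wedgeMap_wedgeInv {z : Fin 3 → ℂ} (hz : z ∈ wedge) : wedgeMap (wedgeInv z) = z := by
  obtain ⟨h0, h1⟩ := ne_zero_of_mem_wedge hz
  ext i
  fin_cases i <;> simp [wedgeInv, wedgeMap] <;> field_simp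

theorem wedgeInv_mem {z : Fin 3 → ℂ} (hz : z ∈ wedge) : wedgeInv z ∈ wedgeSource := by
  rw [← wedgeMap_mem_iff, wedgeMap_wedgeInv hz]
  exact hz

theorem continuous_wedgeMap : Continuous wedgeMap := by
  refine continuous_pi fun i => ?_
  fin_cases i <;> simp [wedgeMap] <;> fun_prop

theorem image_wedgeMap : wedgeMap '' wedgeSource = wedge := by
  ext z
  constructor
  · rintro ⟨w, hw, rfl⟩
    exact (wedgeMap_mem_iff w).2 hw
  · exact fun hz => ⟨wedgeInv z, wedgeInv_mem hz, wedgeMap_wedgeInv hz⟩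

/-- The exponential maps the left half plane, which is convex, onto the punctured disc. -/
theorem isConnected_puncturedDisc : IsConnected puncturedDisc := by
  have h : Complex.exp '' {z | z.re < 0} = puncturedDisc := by
    ext w
    rw [mem_puncturedDisc]
    constructor
    · rintro ⟨z, hz, rfl⟩
      rw [Complex.norm_exp]
      exact ⟨Real.exp_lt_one_iff.2 hz, Complex.exp_ne_zero z⟩
    · rintro ⟨h1, h2⟩
      refine ⟨Complex.log w, ?_, Complex.exp_log h2⟩
      rw [Set.mem_ofPred_eq, Complex.log_re]
      exact Real.log_neg (norm_pos_iff.2 h2) h1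
  rw [← h]
  refine IsConnected.image ⟨⟨-1, by simp⟩, ?_⟩ _ Complex.continuous_exp.continuousOn
  exact (convex_halfSpace_re_lt 0).isPreconnected

theorem isMonomialPolyhedron_wedgeMatrix : IsMonomialPolyhedron wedgeMatrix := by
  refine ⟨by norm_num, ?_, ?_⟩
  · rw [monomialSet_wedgeMatrix]
    refine (Metric.isBounded_ball (x := (0 : Fin 3 → ℂ)) (r := 1)).subset ?_
    intro z hz
    rw [← wedgeMap_wedgeInv hz]
    obtain ⟨h1, h2, h3⟩ := wedgeInv_mem hz
    rw [mem_puncturedDisc] at h1 h2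
    rw [mem_ball_zero_iff] at h3
    rw [mem_ball_zero_iff, pi_norm_lt_iff one_pos]
    intro i
    fin_cases i
    · exact h1.1
    · simpa using mul_lt_one_of_nonneg_of_lt_one_left (norm_nonneg _) h1.1 h2.1.le
    · simpa using mul_lt_one_of_nonneg_of_lt_one_left (norm_nonneg _) h2.1 h3.le
  · rw [monomialSet_wedgeMatrix, ← image_wedgeMap]
    refine IsConnected.image ?_ _ continuous_wedgeMap.continuousOn
    refine isConnected_puncturedDisc.prod (isConnected_puncturedDisc.prod ?_)
    exact (convex_ball (0 : ℂ) 1).isConnected ⟨0, by simp⟩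

theorem isOpen_wedge : IsOpen wedge := by
  rw [← monomialSet_wedgeMatrix]
  exact isOpen_monomialSet _

theorem measurable_wedgeInv : Measurable wedgeInv := by
  unfold wedgeInv
  fun_prop

/-! ### Lebesgue measure in monomial coordinates. -/

/-- Multiplication by c has real determinant |c|². Since `wedgeMap` is triangular and each
coordinate is a multiple of a new variable, this and Tonelli's theorem are the whole change of
variables. -/
theorem lintegral_comp_mul_left_complex {c : ℂ} (hc : c ≠ 0) (f : ℂ → ℝ≥0∞) :
    ∫⁻ z, f z = ‖c‖ₑ ^ 2 * ∫⁻ w, f (c * w) := by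
  have hdet : LinearMap.det ((LinearMap.mul ℂ ℂ c).restrictScalars ℝ) = ‖c‖ ^ 2 := by
    rw [LinearMap.det_restrictScalars, LinearMap.det_ring, Algebra.norm_complex_apply]
    simp [Complex.normSq_eq_norm_sq]
  have hdet0 : LinearMap.det ((LinearMap.mul ℂ ℂ c).restrictScalars ℝ) ≠ 0 := by
    rw [hdet]
    positivity
  have h := Measure.map_linearMap_addHaar_eq_smul_addHaar (volume : Measure ℂ) hdet0
  have hm : Measure.map (fun w => c * w) (volume : Measure ℂ) = (‖c‖ₑ ^ 2)⁻¹ • volume := by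
    convert! h using 2
    rw [hdet, abs_of_nonneg (by positivity), ENNReal.ofReal_inv_of_pos (by positivity),
      ENNReal.ofReal_pow (norm_nonneg _), ofReal_norm]
  have hemb : MeasurableEmbedding (fun w : ℂ => c * w) :=
    (Homeomorph.mulLeft₀ c hc).measurableEmbedding
  rw [← hemb.lintegral_map, hm, lintegral_smul_measure, smul_eq_mul, ← mul_assoc,
    ENNReal.mul_inv_cancel (by simpa using hc) (by simp), one_mul]

/-- Tonelli's theorem for `ℂ³`. -/
theorem lintegral_fin_three (F : (Fin 3 → ℂ) → ℝ≥0∞) (hF : Measurable F) :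
    ∫⁻ z, F z = ∫⁻ a, ∫⁻ b, ∫⁻ c, F ![a, b, c] := by
  have h1 := (volume_preserving_piFinSuccAbove (fun _ : Fin 3 => ℂ) 0).symm
  have h2 := (volume_preserving_piFinTwo (fun _ : Fin 2 => ℂ)).symm
  rw [← h1.lintegral_comp_emb (MeasurableEquiv.measurableEmbedding _), Measure.volume_eq_prod,
    lintegral_prod _ (by fun_prop)]
  congr 1 with a
  rw [← h2.lintegral_comp_emb (MeasurableEquiv.measurableEmbedding _), Measure.volume_eq_prod,
    lintegral_prod]
  · congr 1 with b
    congr 1 with c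
    congr 1
    ext i
    fin_cases i <;> rfl
  · exact ((hF.comp (MeasurableEquiv.measurable _)).comp
      (measurable_prodMk_left.comp (MeasurableEquiv.measurable _))).aemeasurable

/-- Lebesgue measure on the unit disc. -/
noncomputable def discMeasure : Measure ℂ := volume.restrict (Metric.ball 0 1)

/-- The measure `|u|² du` on the unit disc. -/
noncomputable def discMeasureSq : Measure ℂ := discMeasure.withDensity fun u => ‖u‖ₑ ^ 2

/-- The measure on `wedgeSource` which corresponds to Lebesgue measure on `wedge`. -/
noncomputable def sourceMeasure : Measure (ℂ × ℂ × ℂ) :=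
  discMeasureSq.prod (discMeasureSq.prod discMeasure)

instance : IsFiniteMeasure discMeasure :=
  ⟨by simp [discMeasure, Complex.volume_ball]⟩

theorem discMeasure_ae : ∀ᵐ u ∂discMeasure, u ∈ puncturedDisc := by
  rw [discMeasure, ae_restrict_iff' Metric.isOpen_ball.measurableSet]
  filter_upwards [compl_mem_ae_iff.2 (measure_singleton (0 : ℂ))] with u hu hu1
  exact ⟨hu1, hu⟩

theorem discMeasure_eq_restrict_puncturedDisc :
    discMeasure = volume.restrict puncturedDisc := by
  refine Measure.restrict_congr_set ?_
  rw [puncturedDisc]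
  exact (sdiff_null_ae_eq_self (measure_singleton _)).symm

instance : IsFiniteMeasure discMeasureSq := by
  refine isFiniteMeasure_withDensity (ne_top_of_le_ne_top (measure_ne_top discMeasure Set.univ) ?_)
  calc ∫⁻ u, ‖u‖ₑ ^ 2 ∂discMeasure ≤ ∫⁻ _, 1 ∂discMeasure := by
        refine lintegral_mono_ae ?_
        filter_upwards [discMeasure_ae] with u hu
        have : ‖u‖ₑ ≤ 1 := by
          rw [← ofReal_norm, ENNReal.ofReal_le_one]
          exact (mem_puncturedDisc.1 hu).1.le
        exact pow_le_one₀ (by positivity) this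
    _ = discMeasure Set.univ := by simp

theorem discMeasureSq_absolutelyContinuous : discMeasureSq ≪ discMeasure :=
  withDensity_absolutelyContinuous _ _

theorem discMeasureSq_ae : ∀ᵐ u ∂discMeasureSq, u ∈ puncturedDisc :=
  discMeasureSq_absolutelyContinuous.ae_le discMeasure_ae

instance : IsFiniteMeasure sourceMeasure := by
  unfold sourceMeasure
  infer_instance

theorem lintegral_discMeasureSq (f : ℂ → ℝ≥0∞) :
    ∫⁻ u, f u ∂discMeasureSq = ∫⁻ u, ‖u‖ₑ ^ 2 * f u ∂discMeasure := by
  rw [discMeasureSq, lintegral_withDensity_eq_lintegral_mul_non_measurable]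
  · simp
  · fun_prop
  · exact ae_of_all _ fun u => by simp

theorem lintegral_sourceMeasure (F : ℂ × ℂ × ℂ → ℝ≥0∞) (hF : Measurable F) :
    ∫⁻ w, F w ∂sourceMeasure = ∫⁻ a, ‖a‖ₑ ^ 2 * ∫⁻ b, ‖b‖ₑ ^ 2 * ∫⁻ c, F (a, b, c)
      ∂discMeasure ∂discMeasure ∂discMeasure := by
  rw [sourceMeasure, lintegral_prod _ hF.aemeasurable, lintegral_discMeasureSq]
  congr 1 with a
  rw [lintegral_prod _ (by fun_prop), lintegral_discMeasureSq]

theorem measurableSet_wedge : MeasurableSet wedge := isOpen_wedge.measurableSet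

/-- Change of variables: Lebesgue measure on `wedge` in the coordinates given by `wedgeMap`. -/
theorem map_wedgeMap : sourceMeasure.map wedgeMap = volume.restrict wedge := by
  refine Measure.ext_of_lintegral _ fun f hf => ?_
  have hpd := isOpen_puncturedDisc.measurableSet
  have hbm := (Metric.isOpen_ball (x := (0 : ℂ)) (ε := 1)).measurableSet
  rw [lintegral_map hf continuous_wedgeMap.measurable,
    lintegral_sourceMeasure _ (by exact hf.comp continuous_wedgeMap.measurable),
    ← lintegral_indicator measurableSet_wedge,
    lintegral_fin_three _ (hf.indicator measurableSet_wedge),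
    discMeasure_eq_restrict_puncturedDisc, ← lintegral_indicator hpd]
  refine lintegral_congr_ae ?_
  filter_upwards [compl_mem_ae_iff.2 (measure_singleton (0 : ℂ))] with a ha
  have ha : a ≠ 0 := ha
  -- Substituting z₂ = ab produces the factor |a|²; below, for fixed b, z₃ = bc produces |b|².
  rw [lintegral_comp_mul_left_complex ha]
  by_cases haD : a ∈ puncturedDisc
  · rw [Set.indicator_of_mem haD, ← lintegral_indicator hpd]
    congr 1
    refine lintegral_congr_ae ?_
    filter_upwards [compl_mem_ae_iff.2 (measure_singleton (0 : ℂ))] with b hb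
    have hb : b ≠ 0 := hb
    rw [lintegral_comp_mul_left_complex hb]
    by_cases hbD : b ∈ puncturedDisc
    · rw [Set.indicator_of_mem hbD, ← discMeasure_eq_restrict_puncturedDisc, discMeasure,
        ← lintegral_indicator hbm]
      congr 1
      congr 1 with c
      change _ = wedge.indicator f (wedgeMap (a, b, c))
      by_cases hc : c ∈ Metric.ball (0 : ℂ) 1
      · rw [Set.indicator_of_mem hc, Set.indicator_of_mem]
        exact (wedgeMap_mem_iff _).2 ⟨haD, hbD, hc⟩
      · rw [Set.indicator_of_notMem hc, Set.indicator_of_notMem]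
        exact fun h => hc ((wedgeMap_mem_iff _).1 h).2.2
    · rw [Set.indicator_of_notMem hbD]
      symm
      rw [mul_eq_zero]
      right
      rw [lintegral_eq_zero_of_ae_eq_zero]
      refine ae_of_all _ fun c => Set.indicator_of_notMem ?_ _
      exact fun h => hbD ((wedgeMap_mem_iff (a, b, c)).1 h).2.1
  · rw [Set.indicator_of_notMem haD]
    symm
    rw [mul_eq_zero]
    right
    rw [lintegral_eq_zero_of_ae_eq_zero]
    filter_upwards [compl_mem_ae_iff.2 (measure_singleton (0 : ℂ))] with b hb
    have hb : b ≠ 0 := hb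
    rw [lintegral_comp_mul_left_complex hb, Pi.zero_apply, mul_eq_zero]
    right
    rw [lintegral_eq_zero_of_ae_eq_zero]
    refine ae_of_all _ fun c => Set.indicator_of_notMem ?_ _
    exact fun h => haD ((wedgeMap_mem_iff (a, b, c)).1 h).1

theorem sourceMeasure_ae : ∀ᵐ w ∂sourceMeasure, w ∈ wedgeSource := by
  have h1 := (Measure.quasiMeasurePreserving_fst (ν := discMeasureSq.prod discMeasure)).ae
    discMeasureSq_ae
  have h2 := (Measure.quasiMeasurePreserving_fst (ν := discMeasure)).ae discMeasureSq_ae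
  have h3 := (Measure.quasiMeasurePreserving_snd (μ := discMeasureSq)).ae discMeasure_ae
  have h4 := (Measure.quasiMeasurePreserving_snd (μ := discMeasureSq)).ae (h2.and h3)
  filter_upwards [h1, h4] with w hw1 hw2
  exact ⟨hw1, hw2.1, hw2.2.1⟩

theorem measurePreserving_wedgeMap :
    MeasurePreserving wedgeMap sourceMeasure (volume.restrict wedge) :=
  ⟨continuous_wedgeMap.measurable, map_wedgeMap⟩

/-- `wedgeInv` pushes the image measure of `wedgeMap` back, because it is a left inverse almost
everywhere. -/
theorem measurePreserving_wedgeInv :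
    MeasurePreserving wedgeInv (volume.restrict wedge) sourceMeasure := by
  refine ⟨measurable_wedgeInv, ?_⟩
  rw [← map_wedgeMap, Measure.map_map measurable_wedgeInv continuous_wedgeMap.measurable]
  conv_rhs => rw [← Measure.map_id (μ := sourceMeasure)]
  refine Measure.map_congr ?_
  filter_upwards [sourceMeasure_ae] with w hw
  exact wedgeInv_wedgeMap hw

instance : IsFiniteMeasure (volume.restrict wedge) := by
  rw [← map_wedgeMap]
  infer_instance

/-! ### Polar coordinates on the unit disc. -/

theorem Complex.polarCoord_symm_eq_circleMap (p : ℝ × ℝ) :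
    Complex.polarCoord.symm p = circleMap 0 p.1 p.2 := by
  rw [Complex.polarCoord_symm_apply, circleMap, zero_add, Complex.exp_mul_I, Complex.ofReal_cos,
    Complex.ofReal_sin]

theorem measurable_uncurry_circleMap : Measurable fun p : ℝ × ℝ => circleMap 0 p.1 p.2 := by
  unfold circleMap
  fun_prop

theorem circleMap_mem_ball_iff {r : ℝ} (hr : 0 < r) (θ : ℝ) :
    circleMap 0 r θ ∈ Metric.ball (0 : ℂ) 1 ↔ r ∈ Set.Ioo 0 1 := by
  simp [abs_of_pos hr, hr]

/-- Integration over the unit disc in polar coordinates, lower integral version. -/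
theorem lintegral_discMeasure_polar {f : ℂ → ℝ≥0∞} (hf : Measurable f) :
    ∫⁻ u, f u ∂discMeasure = ∫⁻ r in Set.Ioo (0 : ℝ) 1, ENNReal.ofReal r *
      ∫⁻ θ in Set.Ioo (-Real.pi) Real.pi, f (circleMap 0 r θ) := by
  have hg := hf.indicator (Metric.isOpen_ball (x := (0 : ℂ)) (ε := 1)).measurableSet
  have hm := measurable_uncurry_circleMap
  rw [discMeasure, ← lintegral_indicator Metric.isOpen_ball.measurableSet,
    ← Complex.lintegral_comp_polarCoord_symm, polarCoord_target, Measure.volume_eq_prod,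
    setLIntegral_prod]
  · have h1 : Set.Ioo (0 : ℝ) 1 ⊆ Set.Ioi 0 := fun r hr => hr.1
    rw [← Set.inter_eq_self_of_subset_left h1, Set.inter_comm,
      ← Measure.restrict_restrict_of_subset (s := Set.Ioi (0 : ℝ) ∩ Set.Ioo 0 1)
        Set.inter_subset_left, Set.inter_eq_self_of_subset_right h1,
      ← lintegral_indicator measurableSet_Ioo]
    refine setLIntegral_congr_fun measurableSet_Ioi fun r hr => ?_
    simp only [Complex.polarCoord_symm_eq_circleMap, smul_eq_mul]
    by_cases hr1 : r ∈ Set.Ioo (0 : ℝ) 1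
    · rw [Set.indicator_of_mem hr1, ← lintegral_const_mul' _ _ ENNReal.ofReal_ne_top]
      congr 1 with θ
      rw [Set.indicator_of_mem ((circleMap_mem_ball_iff hr θ).2 hr1)]
    · rw [Set.indicator_of_notMem hr1]
      refine lintegral_eq_zero_of_ae_eq_zero (ae_of_all _ fun θ => ?_)
      dsimp only
      rw [Set.indicator_of_notMem (mt (circleMap_mem_ball_iff hr θ).1 hr1), mul_zero]
      rfl
  · simp only [Complex.polarCoord_symm_eq_circleMap, smul_eq_mul]
    exact (Measurable.mul (by fun_prop) (hg.comp hm)).aemeasurable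

/-- Integration over the unit disc in polar coordinates. -/
theorem integral_discMeasure_polar {f : ℂ → ℂ} (hf : Measurable f)
    (hi : Integrable f discMeasure) :
    ∫ u, f u ∂discMeasure = ∫ r in (0 : ℝ)..1, (2 * Real.pi * r) • Real.circleAverage f 0 r := by
  have hg := hf.indicator (Metric.isOpen_ball (x := (0 : ℂ)) (ε := 1)).measurableSet
  have hm := measurable_uncurry_circleMap
  have hint : IntegrableOn (fun p : ℝ × ℝ => p.1 • (Metric.ball (0 : ℂ) 1).indicator f
      (Complex.polarCoord.symm p)) (Set.Ioi 0 ×ˢ Set.Ioo (-Real.pi) Real.pi) := by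
    simp only [Complex.polarCoord_symm_eq_circleMap]
    refine ⟨(Measurable.smul measurable_fst (hg.comp hm)).aestronglyMeasurable, ?_⟩
    have h := Complex.lintegral_comp_polarCoord_symm
      fun u => ‖(Metric.ball (0 : ℂ) 1).indicator f u‖ₑ
    rw [polarCoord_target] at h
    have h2 : ∫⁻ u, ‖(Metric.ball (0 : ℂ) 1).indicator f u‖ₑ = ∫⁻ u, ‖f u‖ₑ ∂discMeasure := by
      simp only [enorm_indicator_eq_indicator_enorm]
      rw [lintegral_indicator Metric.isOpen_ball.measurableSet, discMeasure]
    rw [HasFiniteIntegral]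
    refine lt_of_eq_of_lt ?_ (h2 ▸ hi.2 : ∫⁻ u, ‖(Metric.ball (0 : ℂ) 1).indicator f u‖ₑ < ∞)
    rw [← h]
    refine setLIntegral_congr_fun (measurableSet_Ioi.prod measurableSet_Ioo) fun p hp => ?_
    simp only [Complex.polarCoord_symm_eq_circleMap, enorm_smul, smul_eq_mul]
    rw [Real.enorm_of_nonneg (le_of_lt hp.1)]
  rw [discMeasure, ← integral_indicator Metric.isOpen_ball.measurableSet,
    ← Complex.integral_comp_polarCoord_symm, polarCoord_target, Measure.volume_eq_prod,
    setIntegral_prod _ hint]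
  simp only [Complex.polarCoord_symm_eq_circleMap]
  rw [intervalIntegral.integral_of_le zero_le_one, integral_Ioc_eq_integral_Ioo]
  have h1 : Set.Ioi (0 : ℝ) ∩ Set.Ioo 0 1 = Set.Ioo 0 1 :=
    Set.inter_eq_self_of_subset_right fun r hr => hr.1
  rw [← h1, ← setIntegral_indicator measurableSet_Ioo]
  refine setIntegral_congr_fun measurableSet_Ioi fun r hr => ?_
  by_cases hr1 : r ∈ Set.Ioo (0 : ℝ) 1
  · simp only [Set.indicator_of_mem hr1]
    have h3 : ∀ θ, (Metric.ball (0 : ℂ) 1).indicator f (circleMap 0 r θ) = f (circleMap 0 r θ) :=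
      fun θ => Set.indicator_of_mem ((circleMap_mem_ball_iff hr θ).2 hr1) _
    simp only [h3]
    -- Polar coordinates use the angles (-π, π), circle averages use [0, 2π]; periodicity identifies
    -- the two.
    have hper : Function.Periodic (fun θ => f (circleMap 0 r θ)) (2 * Real.pi) :=
      fun θ => by simp only [periodic_circleMap 0 r θ]
    have h4 := hper.intervalIntegral_add_eq (-Real.pi) 0
    rw [zero_add, show -Real.pi + 2 * Real.pi = Real.pi by ring] at h4
    rw [integral_smul, Real.circleAverage_def, ← h4,
      intervalIntegral.integral_of_le (by linarith [Real.pi_pos]), integral_Ioc_eq_integral_Ioo,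
      smul_smul]
    congr 1
    field_simp
  · simp only [Set.indicator_of_notMem hr1]
    have h3 : ∀ θ, (Metric.ball (0 : ℂ) 1).indicator f (circleMap 0 r θ) = 0 :=
      fun θ => Set.indicator_of_notMem (mt (circleMap_mem_ball_iff hr θ).1 hr1) _
    simp [h3]

/-! ### The Bergman kernel of the disc on circles. -/

/-- The Bergman kernel of the unit disc. -/
noncomputable def discKernel (w u : ℂ) : ℂ := (Real.pi * (1 - w * (starRingEnd ℂ) u) ^ 2)⁻¹

theorem one_sub_mul_conj_ne_zero {w u : ℂ} (hw : ‖w‖ < 1) (hu : ‖u‖ ≤ 1) :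
    1 - w * (starRingEnd ℂ) u ≠ 0 := by
  intro h
  have h1 : ‖w * (starRingEnd ℂ) u‖ = 1 := by rw [← sub_eq_zero.1 h, norm_one]
  rw [norm_mul, RCLike.norm_conj] at h1
  nlinarith [norm_nonneg w, norm_nonneg u]

/-- On the circle of radius r, conj u = r²/u. This makes expressions in conj u meromorphic in u, so
that Cauchy's formulas apply at the point w r². -/
theorem one_sub_mul_conj_of_mem_sphere {r : ℝ} {u : ℂ} (w : ℂ) (hu : u ∈ Metric.sphere (0 : ℂ) r)
    (hr : 0 < r) : 1 - w * (starRingEnd ℂ) u = (u - w * r ^ 2) / u := by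
  rw [mem_sphere_zero_iff_norm] at hu
  have hu0 : u ≠ 0 := norm_pos_iff.1 (hu ▸ hr)
  have h : u * (starRingEnd ℂ) u = r ^ 2 := by rw [Complex.mul_conj, Complex.normSq_eq_norm_sq, hu]; simp
  rw [eq_div_iff hu0, ← h]
  ring

theorem mul_sq_mem_ball {w : ℂ} {r : ℝ} (hw : ‖w‖ < 1) (hr : 0 < r) (hr1 : r < 1) :
    w * (r : ℂ) ^ 2 ∈ Metric.ball (0 : ℂ) r := by
  rw [mem_ball_zero_iff, norm_mul, norm_pow, Complex.norm_real, Real.norm_of_nonneg hr.le]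
  nlinarith [norm_nonneg w, mul_pos hr hr]

/-- On |u| = r the kernel is u² / (π (u - w r²)²), so the average is Cauchy's formula for the
derivative of u F(u). Only u F(u) has to be holomorphic, which leaves room for a puncture at 0. -/
theorem circleAverage_discKernel_mul {F : ℂ → ℂ}
    (hF : DifferentiableOn ℂ (fun u => u * F u) (Metric.ball 0 1))
    {w : ℂ} (hw : ‖w‖ < 1) {r : ℝ} (hr : 0 < r) (hr1 : r < 1) :
    Real.circleAverage (fun u => discKernel w u * F u) 0 r =
      (Real.pi : ℂ)⁻¹ * deriv (fun u => u * F u) (w * r ^ 2) := by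
  have h := Complex.two_pi_I_inv_smul_circleIntegral_sub_sq_inv_smul_of_differentiable
    Metric.isOpen_ball (Metric.closedBall_subset_ball hr1) hF (mul_sq_mem_ball hw hr hr1)
  rw [Real.circleAverage_eq_circleIntegral hr.ne', ← h, smul_eq_mul, smul_eq_mul, mul_left_comm]
  congr 1
  rw [← circleIntegral.integral_const_mul]
  refine circleIntegral.integral_congr hr.le fun u hu => ?_
  have hun : ‖u‖ = r := mem_sphere_zero_iff_norm.1 hu
  have hu0 : u ≠ 0 := norm_pos_iff.1 (hun ▸ hr)
  have hne : u - w * r ^ 2 ≠ 0 := by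
    have := one_sub_mul_conj_ne_zero hw (hun.trans_le hr1.le)
    rw [one_sub_mul_conj_of_mem_sphere w hu hr] at this
    exact (div_ne_zero_iff.1 this).1
  have hpi : (Real.pi : ℂ) ≠ 0 := by exact_mod_cast Real.pi_ne_zero
  simp only [discKernel, one_sub_mul_conj_of_mem_sphere w hu hr, sub_zero, smul_eq_mul]
  field_simp

/-- The Poisson integral of the constant function `1`. -/
theorem circleAverage_norm_one_sub_sq_inv {w : ℂ} (hw : ‖w‖ < 1) {r : ℝ} (hr : 0 < r)
    (hr1 : r < 1) :
    Real.circleAverage (fun u => (‖1 - w * (starRingEnd ℂ) u‖ ^ 2)⁻¹) 0 r =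
      (1 - ‖w‖ ^ 2 * r ^ 2)⁻¹ := by
  have hne : ∀ u : ℂ, ‖u‖ ≤ r → 1 - (starRingEnd ℂ) w * u ≠ 0 := by
    intro u hu
    have h1 := one_sub_mul_conj_ne_zero (u := u) hw (by linarith)
    rw [← map_ne_zero (starRingEnd ℂ)] at h1
    simpa using h1
  have hd : DifferentiableOn ℂ (fun u => (1 - (starRingEnd ℂ) w * u)⁻¹) (Metric.closedBall 0 r) :=
    DifferentiableOn.inv (by fun_prop) fun u hu => hne u (by simpa using hu)
  have h := (DifferentiableOn.diffContOnCl
    (hd.mono (closure_ball (0 : ℂ) hr.ne').le)).circleIntegral_sub_inv_smul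
      (mul_sq_mem_ball hw hr hr1)
  have hc : Real.circleAverage (fun u => (((‖1 - w * (starRingEnd ℂ) u‖ ^ 2)⁻¹ : ℝ) : ℂ)) 0 r =
      (((1 - ‖w‖ ^ 2 * r ^ 2)⁻¹ : ℝ) : ℂ) := by
    rw [Real.circleAverage_eq_circleIntegral hr.ne']
    -- On the circle |1 - w conj u|² = ((u - w r²)/u) (1 - conj(w) u). What remains is Cauchy's
    -- formula for 1/(1 - conj(w) u) at w r².
    have hcong : (∮ u in C(0, r), (u - 0)⁻¹ • (((‖1 - w * (starRingEnd ℂ) u‖ ^ 2)⁻¹ : ℝ) : ℂ)) =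
        ∮ u in C(0, r), (u - w * r ^ 2)⁻¹ • (1 - (starRingEnd ℂ) w * u)⁻¹ := by
      refine circleIntegral.integral_congr hr.le fun u hu => ?_
      have hun : ‖u‖ = r := mem_sphere_zero_iff_norm.1 hu
      have hu0 : u ≠ 0 := norm_pos_iff.1 (hun ▸ hr)
      have e1 : (((‖1 - w * (starRingEnd ℂ) u‖ ^ 2 : ℝ)) : ℂ) =
          (u - w * r ^ 2) / u * (1 - (starRingEnd ℂ) w * u) := by
        rw [← one_sub_mul_conj_of_mem_sphere w hu hr, ← Complex.normSq_eq_norm_sq,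
          ← Complex.mul_conj]
        simp
      have hne1 := hne u hun.le
      have hne2 : u - w * r ^ 2 ≠ 0 := by
        have := one_sub_mul_conj_ne_zero hw (hun.trans_le hr1.le)
        rw [one_sub_mul_conj_of_mem_sphere w hu hr] at this
        exact (div_ne_zero_iff.1 this).1
      simp only [Complex.ofReal_inv, e1, sub_zero, smul_eq_mul]
      field_simp
    rw [hcong, h, smul_smul, inv_mul_cancel₀ Complex.two_pi_I_ne_zero, one_smul]
    push_cast
    congr 2
    rw [← Complex.ofReal_pow ‖w‖, ← Complex.normSq_eq_norm_sq, ← Complex.mul_conj]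
    ring
  have := hc
  rw [Real.circleAverage_def, intervalIntegral.integral_ofReal, Complex.real_smul,
    ← Complex.ofReal_mul] at this
  rw [Real.circleAverage_def, smul_eq_mul]
  exact_mod_cast this

/-! ### Square integrable holomorphic functions on the punctured disc. -/

/-- Mean value inequality for holomorphic functions on a disc. -/
theorem enorm_mul_volume_ball_le_one_variable {g : ℂ → ℂ} {z : ℂ} {r : ℝ}
    (hg : DifferentiableOn ℂ g (Metric.ball z r)) (hr : 0 < r) :
    ‖g z‖ₑ * volume (Metric.ball (0 : ℂ) r) ≤ ∫⁻ v in Metric.ball z r, ‖g v‖ₑ := by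
  have hmp := volume_preserving_funUnique (Fin 1) ℂ
  have hemb := (MeasurableEquiv.funUnique (Fin 1) ℂ).measurableEmbedding
  have hball : ∀ c : ℂ, MeasurableEquiv.funUnique (Fin 1) ℂ ⁻¹' Metric.ball c r =
      Metric.ball (fun _ : Fin 1 => c) r := by
    intro c
    ext v
    simp only [Set.mem_preimage, Metric.mem_ball, dist_pi_lt_iff hr]
    simp [MeasurableEquiv.funUnique]
  have h := enorm_mul_volume_ball_le (n := 1) (g := fun v => g (v 0)) (z := fun _ => z) (r := r) (by
    refine hg.comp (by fun_prop) fun v hv => ?_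
    rw [← hball] at hv
    exact hv)
  rw [← hmp.setLIntegral_comp_preimage_emb hemb, hball, ← hmp.measure_preimage_emb hemb, hball]
  exact h

/-- The mean value inequality for F² on the disc of radius |z|/2 about z bounds |z F(z)|² by a
multiple of the integral of |F|² over |u| < 2|z|. This tends to 0 by absolute continuity of the
integral. -/
theorem continuousAt_mul_self_of_lintegral_sq {F : ℂ → ℂ} (hF : DifferentiableOn ℂ F puncturedDisc)
    (hF2 : ∫⁻ u, ‖F u‖ₑ ^ 2 ∂discMeasure ≠ ∞) : ContinuousAt (fun u => u * F u) 0 := by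
  have hbound : ∀ z : ℂ, z ≠ 0 → ‖z‖ < 1 / 2 → ‖z * F z‖ₑ ^ 2 * NNReal.pi ≤
      4 * ∫⁻ u in Metric.ball 0 (2 * ‖z‖), ‖F u‖ₑ ^ 2 ∂discMeasure := by
    intro z hz hz1
    have hzp : 0 < ‖z‖ := norm_pos_iff.2 hz
    have hsub : Metric.ball z (‖z‖ / 2) ⊆ puncturedDisc := by
      intro u hu
      rw [mem_ball_iff_norm] at hu
      rw [mem_puncturedDisc]
      have h1 := norm_sub_norm_le z u
      have h2 := norm_sub_norm_le u z
      rw [norm_sub_rev] at h1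
      exact ⟨by linarith, norm_pos_iff.1 (by linarith)⟩
    have hsub2 : Metric.ball z (‖z‖ / 2) ⊆ Metric.ball 0 (2 * ‖z‖) := by
      refine Metric.ball_subset_ball' ?_
      rw [dist_zero_right]
      linarith
    have h := enorm_mul_volume_ball_le_one_variable ((hF.mono hsub).pow 2) (half_pos hzp)
    have h2 : ∫⁻ u in Metric.ball z (‖z‖ / 2), ‖(F ^ 2) u‖ₑ ≤
        ∫⁻ u in Metric.ball 0 (2 * ‖z‖), ‖F u‖ₑ ^ 2 ∂discMeasure := by
      rw [discMeasure_eq_restrict_puncturedDisc, Measure.restrict_restrict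
        Metric.isOpen_ball.measurableSet]
      simp only [Pi.pow_apply, enorm_pow]
      exact lintegral_mono_set (Set.subset_inter hsub2 hsub)
    refine le_trans (le_of_eq ?_) (mul_le_mul_right (h.trans h2) 4)
    rw [Complex.volume_ball, enorm_mul, Pi.pow_apply, enorm_pow, ENNReal.ofReal_div_of_pos two_pos,
      ofReal_norm, ENNReal.ofReal_ofNat, div_eq_mul_inv, mul_pow, mul_pow]
    have : (4 : ℝ≥0∞) * 2⁻¹ ^ 2 = 1 := by
      rw [← ENNReal.inv_pow]
      norm_num
      exact ENNReal.mul_inv_cancel (by norm_num) (by norm_num)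
    calc ‖z‖ₑ ^ 2 * ‖F z‖ₑ ^ 2 * NNReal.pi
        = ‖z‖ₑ ^ 2 * ‖F z‖ₑ ^ 2 * NNReal.pi * (4 * 2⁻¹ ^ 2) := by rw [this, mul_one]
      _ = _ := by ring
  have hlim : Tendsto (fun z : ℂ => 4 * ∫⁻ u in Metric.ball 0 (2 * ‖z‖), ‖F u‖ₑ ^ 2 ∂discMeasure)
      (𝓝 0) (𝓝 0) := by
    have h1 : Tendsto (fun z : ℂ => discMeasure (Metric.ball 0 (2 * ‖z‖))) (𝓝 0) (𝓝 0) := by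
      have h2 : Tendsto (fun z : ℂ => ENNReal.ofReal (2 * ‖z‖) ^ 2 * NNReal.pi) (𝓝 0) (𝓝 0) := by
        have : Continuous fun z : ℂ => ENNReal.ofReal (2 * ‖z‖) ^ 2 * (NNReal.pi : ℝ≥0∞) := by
          refine ENNReal.continuous_mul_const ENNReal.coe_ne_top |>.comp ?_
          exact (ENNReal.continuous_pow 2).comp (ENNReal.continuous_ofReal.comp (by fun_prop))
        simpa using this.tendsto 0
      refine tendsto_of_tendsto_of_tendsto_of_le_of_le tendsto_const_nhds h2 (fun _ => zero_le) ?_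
      intro z
      dsimp only
      rw [← Complex.volume_ball 0]
      exact Measure.restrict_apply_le _ _
    have h3 := tendsto_setLIntegral_zero hF2 (l := 𝓝 (0 : ℂ))
      (s := fun z : ℂ => Metric.ball (0 : ℂ) (2 * ‖z‖)) h1
    simpa using ENNReal.Tendsto.const_mul h3 (Or.inr (by norm_num : (4 : ℝ≥0∞) ≠ ∞))
  have hsq : Tendsto (fun z : ℂ => ‖z * F z‖ₑ ^ 2 * NNReal.pi) (𝓝 0) (𝓝 0) := by
    refine tendsto_of_tendsto_of_tendsto_of_le_of_le' tendsto_const_nhds hlim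
      (Eventually.of_forall fun _ => zero_le) ?_
    filter_upwards [Metric.ball_mem_nhds (0 : ℂ) (half_pos one_pos)] with z hz
    rcases eq_or_ne z 0 with rfl | hz0
    · simp
    · exact hbound z hz0 (by simpa using hz)
  have hpi : (NNReal.pi : ℝ≥0∞) ≠ 0 := by simpa using NNReal.pi_ne_zero
  have hsq2 : Tendsto (fun z : ℂ => ‖z * F z‖ₑ ^ 2) (𝓝 0) (𝓝 0) := by
    have := ENNReal.Tendsto.mul_const (b := (NNReal.pi : ℝ≥0∞)⁻¹) hsq
      (Or.inr (ENNReal.inv_ne_top.2 hpi))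
    simp only [mul_assoc, ENNReal.mul_inv_cancel hpi ENNReal.coe_ne_top, mul_one, zero_mul] at this
    exact this
  have hn : Tendsto (fun z : ℂ => ‖z * F z‖ₑ) (𝓝 0) (𝓝 0) := by
    have := ((ENNReal.continuous_rpow_const (y := (1 / 2 : ℝ))).tendsto 0).comp hsq2
    rw [ENNReal.zero_rpow_of_pos (by norm_num)] at this
    refine this.congr fun z => ?_
    rw [Function.comp_apply, ← ENNReal.rpow_natCast, ← ENNReal.rpow_mul]
    norm_num
  rw [ContinuousAt, zero_mul, tendsto_iff_enorm_sub_tendsto_zero]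
  simpa using hn

/-- The singularity of u F(u) at 0 is removable because the function is continuous there. -/
theorem differentiableOn_mul_self {F : ℂ → ℂ} (hF : DifferentiableOn ℂ F puncturedDisc)
    (hF2 : ∫⁻ u, ‖F u‖ₑ ^ 2 ∂discMeasure ≠ ∞) :
    DifferentiableOn ℂ (fun u => u * F u) (Metric.ball 0 1) := by
  rw [← Complex.differentiableOn_compl_singleton_and_continuousAt_iff
    (Metric.ball_mem_nhds (0 : ℂ) one_pos)]
  exact ⟨differentiableOn_id.mul hF, continuousAt_mul_self_of_lintegral_sq hF hF2⟩

theorem measurable_discKernel (w : ℂ) : Measurable (discKernel w) := by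
  unfold discKernel
  fun_prop

theorem norm_discKernel_le {w u : ℂ} (hw : ‖w‖ < 1) (hu : ‖u‖ ≤ 1) :
    ‖discKernel w u‖ ≤ (Real.pi * (1 - ‖w‖) ^ 2)⁻¹ := by
  rw [discKernel, norm_inv, norm_mul, norm_pow, Complex.norm_real,
    Real.norm_of_nonneg Real.pi_pos.le]
  have h1 : 0 < 1 - ‖w‖ := by linarith
  have h2 : 1 - ‖w‖ ≤ ‖1 - w * (starRingEnd ℂ) u‖ := by
    refine le_trans ?_ (norm_sub_norm_le _ _)
    rw [norm_one, norm_mul, RCLike.norm_conj]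
    nlinarith [norm_nonneg w]
  have := Real.pi_pos
  gcongr

theorem discMeasure_ae_norm_lt : ∀ᵐ u ∂discMeasure, ‖u‖ < 1 :=
  discMeasure_ae.mono fun _ hu => (mem_puncturedDisc.1 hu).1

theorem integrable_discKernel_mul {F : ℂ → ℂ} (hF : Integrable F discMeasure) {w : ℂ}
    (hw : ‖w‖ < 1) : Integrable (fun u => discKernel w u * F u) discMeasure := by
  refine hF.bdd_mul (measurable_discKernel w).aestronglyMeasurable
    (c := (Real.pi * (1 - ‖w‖) ^ 2)⁻¹) ?_
  filter_upwards [discMeasure_ae_norm_lt] with u hu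
  exact norm_discKernel_le hw hu.le

theorem aestronglyMeasurable_of_differentiableOn {F : ℂ → ℂ}
    (hF : DifferentiableOn ℂ F puncturedDisc) : AEStronglyMeasurable F discMeasure := by
  rw [discMeasure_eq_restrict_puncturedDisc]
  exact hF.continuousOn.aestronglyMeasurable isOpen_puncturedDisc.measurableSet

theorem memLp_two_of_lintegral_sq {X : Type*} [MeasurableSpace X] {μ : Measure X} {F : X → ℂ}
    (hF : AEStronglyMeasurable F μ) (hF2 : ∫⁻ u, ‖F u‖ₑ ^ 2 ∂μ ≠ ∞) : MemLp F 2 μ := by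
  refine ⟨hF, ?_⟩
  rw [eLpNorm_lt_top_iff_lintegral_rpow_enorm_lt_top (by norm_num) (by norm_num)]
  simpa using hF2.lt_top

/-- Reproducing property of the Bergman kernel for square integrable holomorphic functions on the
punctured disc. -/
theorem integral_discKernel_mul {F : ℂ → ℂ} (hF : DifferentiableOn ℂ F puncturedDisc)
    (hF2 : ∫⁻ u, ‖F u‖ₑ ^ 2 ∂discMeasure ≠ ∞) {w : ℂ} (hw : w ∈ puncturedDisc) :
    ∫ u, discKernel w u * F u ∂discMeasure = F w := by
  obtain ⟨hw1, hw0⟩ := mem_puncturedDisc.1 hw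
  classical
  have hG := differentiableOn_mul_self hF hF2
  set F' : ℂ → ℂ := puncturedDisc.indicator F with hF'
  have hFF' : ∀ u ∈ puncturedDisc, F' u = F u := fun u hu => Set.indicator_of_mem hu _
  have hGG' : ∀ u ∈ Metric.ball (0 : ℂ) 1, u * F' u = u * F u := by
    intro u hu
    rcases eq_or_ne u 0 with rfl | hu0
    · simp
    · rw [hFF' u ⟨hu, hu0⟩]
  have hF'm : Measurable F' := by
    have := hF.continuousOn.measurable_piecewise (g := fun _ => (0 : ℂ)) continuousOn_const
      isOpen_puncturedDisc.measurableSet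
    convert! this using 1
  have hFi : Integrable F discMeasure :=
    (memLp_two_of_lintegral_sq (aestronglyMeasurable_of_differentiableOn hF) hF2).integrable
      (by norm_num)
  have hae : F =ᵐ[discMeasure] F' := discMeasure_ae.mono fun u hu => (hFF' u hu).symm
  have hG' : DifferentiableOn ℂ (fun u => u * F' u) (Metric.ball 0 1) := hG.congr hGG'
  have hint : ∫ u, discKernel w u * F u ∂discMeasure = ∫ u, discKernel w u * F' u ∂discMeasure :=
    integral_congr_ae (hae.mono fun u hu => by simp only [hu])
  rw [hint, integral_discMeasure_polar (by exact (measurable_discKernel w).mul hF'm)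
    (integrable_discKernel_mul (hFi.congr hae) hw1)]
  set G : ℂ → ℂ := fun u => u * F' u with hGdef
  have hmem : ∀ r ∈ Set.uIcc (0 : ℝ) 1, w * (r : ℂ) ^ 2 ∈ Metric.ball (0 : ℂ) 1 := by
    intro r hr
    rw [Set.uIcc_of_le zero_le_one] at hr
    rw [mem_ball_zero_iff, norm_mul, norm_pow, Complex.norm_real, Real.norm_of_nonneg hr.1]
    have : r ^ 2 ≤ 1 := pow_le_one₀ hr.1 hr.2
    nlinarith [norm_nonneg w]
  -- With G(u) = u F'(u), the radial integrand 2r G'(w r²) is the derivative of w⁻¹ G(w r²). The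
  -- fundamental theorem of calculus leaves w⁻¹ (G(w) - G(0)) = F(w).
  have hcongr : ∫ r in (0 : ℝ)..1, (2 * Real.pi * r) •
      Real.circleAverage (fun u => discKernel w u * F' u) 0 r =
      ∫ r in (0 : ℝ)..1, w⁻¹ * (deriv G (w * (r : ℂ) ^ 2) * (w * (2 * r))) := by
    refine intervalIntegral.integral_congr_uIoo fun r hr => ?_
    rw [Set.uIoo_of_le zero_le_one] at hr
    have hpi : (Real.pi : ℂ) ≠ 0 := by exact_mod_cast Real.pi_ne_zero
    simp only [circleAverage_discKernel_mul hG' hw1 hr.1 hr.2, Complex.real_smul]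
    push_cast
    field_simp
    rfl
  have hderiv : ∀ r ∈ Set.uIcc (0 : ℝ) 1, HasDerivAt (fun r : ℝ => w⁻¹ * G (w * (r : ℂ) ^ 2))
      (w⁻¹ * (deriv G (w * (r : ℂ) ^ 2) * (w * (2 * r)))) r := by
    intro r hr
    have h1 : HasDerivAt G (deriv G (w * (r : ℂ) ^ 2)) (w * (r : ℂ) ^ 2) :=
      (hG'.differentiableAt (Metric.isOpen_ball.mem_nhds (hmem r hr))).hasDerivAt
    have h2 : HasDerivAt (fun r : ℝ => w * (r : ℂ) ^ 2) (w * (2 * r)) r := by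
      have := ((Complex.ofRealCLM.hasDerivAt (x := r)).pow 2).const_mul w
      simpa using this
    exact (h1.comp r h2).const_mul _
  have hcont : ContinuousOn (fun r : ℝ => w⁻¹ * (deriv G (w * (r : ℂ) ^ 2) * (w * (2 * r))))
      (Set.uIcc 0 1) := by
    have hd : ContinuousOn (deriv G) (Metric.ball 0 1) :=
      (hG'.deriv Metric.isOpen_ball).continuousOn
    exact continuousOn_const.mul ((hd.comp (by fun_prop) hmem).mul (by fun_prop))
  rw [hcongr, intervalIntegral.integral_eq_sub_of_hasDerivAt hderiv hcont.intervalIntegrable]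
  simp only [hGdef]
  simp [hFF' w hw, hw0]

theorem integral_discKernel {w : ℂ} (hw : w ∈ puncturedDisc) :
    ∫ u, discKernel w u ∂discMeasure = 1 := by
  have := integral_discKernel_mul (F := fun _ => 1) (differentiableOn_const 1) (by simp) hw
  simpa using this

/-- On each circle |u|² is the constant r², whose average against the kernel is r²/π. The value is
thus the integral of 2r³ over [0, 1]. The two factors 1/2 that arise so give the 1/4 in P(conj z₂).
-/
theorem integral_discKernel_mul_norm_sq {w : ℂ} (hw : ‖w‖ < 1) :
    ∫ u, discKernel w u * (‖u‖ ^ 2 : ℝ) ∂discMeasure = 1 / 2 := by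
  have hint : Integrable (fun u : ℂ => ((‖u‖ ^ 2 : ℝ) : ℂ)) discMeasure := by
    refine Integrable.of_bound (by fun_prop) 1 ?_
    filter_upwards [discMeasure_ae_norm_lt] with u hu
    rw [Complex.norm_real, Real.norm_of_nonneg (by positivity)]
    exact pow_le_one₀ (norm_nonneg _) hu.le
  rw [integral_discMeasure_polar (by exact (measurable_discKernel w).mul (by fun_prop))
    (integrable_discKernel_mul hint hw)]
  have hcongr : ∫ r in (0 : ℝ)..1, (2 * Real.pi * r) •
      Real.circleAverage (fun u => discKernel w u * (‖u‖ ^ 2 : ℝ)) 0 r =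
      ∫ r in (0 : ℝ)..1, ((2 * r ^ 3 : ℝ) : ℂ) := by
    refine intervalIntegral.integral_congr_uIoo fun r hr => ?_
    rw [Set.uIoo_of_le zero_le_one] at hr
    have h1 := circleAverage_discKernel_mul (F := fun _ => (r : ℂ) ^ 2) (by fun_prop) hw hr.1 hr.2
    have hpi : (Real.pi : ℂ) ≠ 0 := by exact_mod_cast Real.pi_ne_zero
    have h2 : Real.circleAverage (fun u => discKernel w u * (‖u‖ ^ 2 : ℝ)) 0 r =
        Real.circleAverage (fun u => discKernel w u * (r : ℂ) ^ 2) 0 r := by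
      refine Real.circleAverage_congr_sphere fun u hu => ?_
      rw [abs_of_pos hr.1, mem_sphere_zero_iff_norm] at hu
      simp [hu]
    simp only [h2, h1, Complex.real_smul]
    simp only [deriv_mul_const_field, deriv_id'']
    push_cast
    field_simp
  rw [hcongr, intervalIntegral.integral_ofReal, intervalIntegral.integral_const_mul, integral_pow]
  norm_num

/-! ### Forelli–Rudin estimates. -/

/-- Up to the factor 1/π the modulus of the kernel is |1 - w conj u|⁻², whose circle average is a
Poisson integral of a constant. -/
theorem lintegral_circle_enorm_discKernel {w : ℂ} (hw : ‖w‖ < 1) {r : ℝ} (hr : 0 < r)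
    (hr1 : r < 1) : ∫⁻ θ in Set.Ioo (-Real.pi) Real.pi, ‖discKernel w (circleMap 0 r θ)‖ₑ =
      ENNReal.ofReal (2 * (1 - ‖w‖ ^ 2 * r ^ 2)⁻¹) := by
  have hpi := Real.pi_pos
  have hnorm : ∀ u, ‖discKernel w u‖ =
      Real.pi⁻¹ * (‖1 - w * (starRingEnd ℂ) u‖ ^ 2)⁻¹ := by
    intro u
    rw [discKernel, norm_inv, norm_mul, norm_pow, Complex.norm_real, Real.norm_of_nonneg hpi.le,
      mul_inv]
  have hcont : Continuous fun θ => ‖discKernel w (circleMap 0 r θ)‖ := by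
    simp only [hnorm]
    have hc := continuous_circleMap 0 r
    refine continuous_const.mul (Continuous.inv₀ (by fun_prop) fun θ => ?_)
    have : ‖circleMap 0 r θ‖ ≤ 1 := by simpa [abs_of_pos hr] using hr1.le
    exact pow_ne_zero 2 (norm_ne_zero_iff.2 (one_sub_mul_conj_ne_zero hw this))
  have hint : ∫ θ in Set.Ioo (-Real.pi) Real.pi, ‖discKernel w (circleMap 0 r θ)‖ =
      2 * (1 - ‖w‖ ^ 2 * r ^ 2)⁻¹ := by
    have hper : Function.Periodic (fun θ => ‖discKernel w (circleMap 0 r θ)‖) (2 * Real.pi) :=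
      fun θ => by simp only [periodic_circleMap 0 r θ]
    have h4 := hper.intervalIntegral_add_eq (-Real.pi) 0
    rw [zero_add, show -Real.pi + 2 * Real.pi = Real.pi by ring,
      intervalIntegral.integral_of_le (by linarith), integral_Ioc_eq_integral_Ioo] at h4
    have h5 := circleAverage_norm_one_sub_sq_inv hw hr hr1
    rw [Real.circleAverage_def, smul_eq_mul] at h5
    rw [h4, ← h5]
    simp only [hnorm]
    rw [intervalIntegral.integral_const_mul]
    field_simp
  simp only [← ofReal_norm]
  rw [← hint, ofReal_integral_eq_lintegral_ofReal]
  · exact (hcont.integrableOn_Icc (a := -Real.pi) (b := Real.pi)).mono_set Set.Ioo_subset_Icc_self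
  · exact ae_of_all _ fun θ => norm_nonneg _

theorem lintegral_Ioc_rpow {t : ℝ} (ht : -1 < t) {δ : ℝ} (hδ : 0 < δ) :
    ∫⁻ y in Set.Ioc 0 δ, ENNReal.ofReal (y ^ t) = ENNReal.ofReal (δ ^ (t + 1) / (t + 1)) := by
  rw [← ofReal_integral_eq_lintegral_ofReal, ← intervalIntegral.integral_of_le hδ.le,
    integral_rpow (Or.inl ht), Real.zero_rpow (by linarith), sub_zero]
  · exact (intervalIntegral.intervalIntegrable_rpow' ht).1
  · rw [EventuallyLE, ae_restrict_iff' measurableSet_Ioc]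
    exact ae_of_all _ fun y hy => Real.rpow_nonneg hy.1.le _

theorem lintegral_Ioi_rpow {t : ℝ} (ht : t < -1) {δ : ℝ} (hδ : 0 < δ) :
    ∫⁻ y in Set.Ioi δ, ENNReal.ofReal (y ^ t) = ENNReal.ofReal (-δ ^ (t + 1) / (t + 1)) := by
  rw [← ofReal_integral_eq_lintegral_ofReal, integral_Ioi_rpow_of_lt ht hδ]
  · exact integrableOn_Ioi_rpow_of_lt ht hδ
  · rw [EventuallyLE, ae_restrict_iff' measurableSet_Ioi]
    exact ae_of_all _ fun y hy => Real.rpow_nonneg (hδ.trans hy).le _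

/-- The two singularities are separated at r = 1/2. For smaller r only r^(1-e) is unbounded, and it
is integrable since e < 2. For larger r put y = 1 - r: the range y ≤ δ contributes δ^(-t)/(1-t) and
the range y > δ contributes δ^(-t)/t. -/
theorem exists_lintegral_radial_le {e t : ℝ} (he0 : 0 ≤ e) (he : e < 2) (ht0 : 0 < t)
    (ht : t < 1) : ∃ C : ℝ≥0∞, C ≠ ∞ ∧ ∀ δ : ℝ, 0 < δ → δ ≤ 1 →
      ∫⁻ r in Set.Ioo (0 : ℝ) 1, ENNReal.ofReal (r ^ (1 - e) * (1 - r) ^ (-t) / max (1 - r) δ) ≤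
        C * ENNReal.ofReal (δ ^ (-t)) := by
  refine ⟨ENNReal.ofReal (2 ^ (t + 1)) * ENNReal.ofReal (1 / (2 - e)) +
    ENNReal.ofReal (2 ^ e) * (ENNReal.ofReal (1 / (1 - t)) + ENNReal.ofReal (1 / t)),
    by finiteness, fun δ hδ hδ1 => ?_⟩
  -- g(y) is y^(-t) / max(y, δ) on y > 0, split at y = δ into two pure powers.
  set g : ℝ → ℝ≥0∞ := fun y =>
    (Set.Ioc 0 δ).indicator (fun y => ENNReal.ofReal (y ^ (-t)) * ENNReal.ofReal δ⁻¹) y +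
      (Set.Ioi δ).indicator (fun y => ENNReal.ofReal (y ^ (-t - 1))) y with hg
  have hδt : 1 ≤ δ ^ (-t) := Real.one_le_rpow_of_pos_of_le_one_of_nonpos hδ hδ1 (by linarith)
  have hgint : ∫⁻ y, g y = (ENNReal.ofReal (1 / (1 - t)) + ENNReal.ofReal (1 / t)) *
      ENNReal.ofReal (δ ^ (-t)) := by
    rw [hg, lintegral_add_left (Measurable.indicator (by fun_prop) measurableSet_Ioc),
      lintegral_indicator measurableSet_Ioc, lintegral_indicator measurableSet_Ioi,
      lintegral_mul_const' _ _ ENNReal.ofReal_ne_top, lintegral_Ioc_rpow (by linarith) hδ,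
      lintegral_Ioi_rpow (by linarith) hδ, add_mul, ← ENNReal.ofReal_mul' (by positivity),
      ← ENNReal.ofReal_mul' (by positivity), ← ENNReal.ofReal_mul' (by positivity)]
    congr 2
    · rw [Real.rpow_add hδ, Real.rpow_one, neg_add_eq_sub]
      field_simp
    · rw [sub_add_cancel, neg_div_neg_eq]
      ring
  have hpt : ∀ r ∈ Set.Ioo (0 : ℝ) 1,
      ENNReal.ofReal (r ^ (1 - e) * (1 - r) ^ (-t) / max (1 - r) δ) ≤
        ENNReal.ofReal (2 ^ (t + 1)) * ENNReal.ofReal (r ^ (1 - e)) +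
          ENNReal.ofReal (2 ^ e) * g (1 - r) := by
    rintro r ⟨hr0, hr1⟩
    have h1r : 0 < 1 - r := by linarith
    have hre : 0 < r ^ (1 - e) := Real.rpow_pos_of_pos hr0 _
    have hrt : 0 < (1 - r) ^ (-t) := Real.rpow_pos_of_pos h1r _
    have hmax : 0 < max (1 - r) δ := lt_max_of_lt_left h1r
    rcases le_total r (1 / 2) with h | h
    · refine le_add_right ?_
      rw [← ENNReal.ofReal_mul (by positivity)]
      refine ENNReal.ofReal_le_ofReal ?_
      rw [mul_div_assoc, mul_comm]
      refine mul_le_mul_of_nonneg_right ?_ hre.le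
      calc (1 - r) ^ (-t) / max (1 - r) δ ≤ (1 - r) ^ (-t) / (1 - r) := by
            gcongr
            exact le_max_left _ _
        _ = (1 - r) ^ (-(t + 1)) := by
            rw [neg_add, Real.rpow_add h1r, Real.rpow_neg_one, div_eq_mul_inv]
        _ ≤ (1 / 2) ^ (-(t + 1)) :=
            Real.rpow_le_rpow_of_nonpos (by norm_num) (by linarith) (by linarith)
        _ = 2 ^ (t + 1) := by
            rw [one_div, Real.inv_rpow (by norm_num), Real.rpow_neg (by norm_num), inv_inv]
    · refine le_add_left ?_
      have h2 : r ^ (1 - e) ≤ 2 ^ e := by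
        calc r ^ (1 - e) = r * r ^ (-e) := by
              rw [sub_eq_add_neg, Real.rpow_add hr0, Real.rpow_one]
          _ ≤ 1 * (1 / 2) ^ (-e) := by
              gcongr ?_ * ?_
              exact Real.rpow_le_rpow_of_nonpos (by norm_num) h (by linarith)
          _ = 2 ^ e := by
              rw [one_mul, one_div, Real.inv_rpow (by norm_num), Real.rpow_neg (by norm_num),
                inv_inv]
      have h3 : ENNReal.ofReal ((1 - r) ^ (-t) / max (1 - r) δ) ≤ g (1 - r) := by
        rcases le_or_gt (1 - r) δ with hc | hc
        · refine le_add_right ?_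
          rw [Set.indicator_of_mem (show 1 - r ∈ Set.Ioc 0 δ from ⟨h1r, hc⟩),
            ← ENNReal.ofReal_mul hrt.le, max_eq_right hc, div_eq_mul_inv]
        · refine le_add_left ?_
          rw [Set.indicator_of_mem (show 1 - r ∈ Set.Ioi δ from hc), max_eq_left hc.le,
            sub_eq_add_neg (-t), Real.rpow_add h1r, Real.rpow_neg_one, div_eq_mul_inv]
      rw [mul_div_assoc, ENNReal.ofReal_mul hre.le]
      exact mul_le_mul' (ENNReal.ofReal_le_ofReal h2) h3
  calc _ ≤ ∫⁻ r in Set.Ioo (0 : ℝ) 1,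
        (ENNReal.ofReal (2 ^ (t + 1)) * ENNReal.ofReal (r ^ (1 - e)) +
          ENNReal.ofReal (2 ^ e) * g (1 - r)) := setLIntegral_mono' measurableSet_Ioo hpt
    _ = ENNReal.ofReal (2 ^ (t + 1)) * (∫⁻ r in Set.Ioo (0 : ℝ) 1, ENNReal.ofReal (r ^ (1 - e))) +
        ENNReal.ofReal (2 ^ e) * ∫⁻ r in Set.Ioo (0 : ℝ) 1, g (1 - r) := by
        rw [lintegral_add_left (by fun_prop), lintegral_const_mul' _ _ ENNReal.ofReal_ne_top,
          lintegral_const_mul' _ _ ENNReal.ofReal_ne_top]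
    _ ≤ ENNReal.ofReal (2 ^ (t + 1)) * ENNReal.ofReal (1 / (2 - e)) +
        ENNReal.ofReal (2 ^ e) * ((ENNReal.ofReal (1 / (1 - t)) + ENNReal.ofReal (1 / t)) *
          ENNReal.ofReal (δ ^ (-t))) := by
        refine add_le_add (mul_le_mul_right ?_ _) (mul_le_mul_right ?_ _)
        · refine (lintegral_mono_set Set.Ioo_subset_Ioc_self).trans (le_of_eq ?_)
          rw [lintegral_Ioc_rpow (by linarith) one_pos, Real.one_rpow]
          congr 2
          ring
        · refine (setLIntegral_le_lintegral _ _).trans (le_of_eq ?_)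
          rw [lintegral_sub_left_eq_self, hgint]
    _ ≤ _ := by
        rw [← mul_assoc, add_mul (_ * _)]
        refine add_le_add (le_mul_of_one_le_right' ?_) le_rfl
        simpa using hδt

/-- The Forelli–Rudin estimate on the disc, with a singularity at the origin. -/
theorem exists_lintegral_discKernel_le {e t : ℝ} (he0 : 0 ≤ e) (he : e < 2) (ht0 : 0 < t)
    (ht : t < 1) : ∃ C : ℝ≥0∞, C ≠ ∞ ∧ ∀ w : ℂ, ‖w‖ < 1 →
      ∫⁻ u, ‖discKernel w u‖ₑ * ENNReal.ofReal (‖u‖ ^ (-e) * (1 - ‖u‖ ^ 2) ^ (-t)) ∂discMeasure ≤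
        C * ENNReal.ofReal ((1 - ‖w‖ ^ 2) ^ (-t)) := by
  obtain ⟨C, hC, h⟩ := exists_lintegral_radial_le he0 he ht0 ht
  refine ⟨2 * C, by finiteness, fun w hw => ?_⟩
  have hw2 : ‖w‖ ^ 2 < 1 := pow_lt_one₀ (norm_nonneg _) hw two_ne_zero
  have hm := measurable_discKernel w
  rw [lintegral_discMeasure_polar (by fun_prop), mul_assoc]
  refine le_trans ?_ (mul_le_mul_right (h (1 - ‖w‖ ^ 2) (by linarith)
    (by linarith [sq_nonneg ‖w‖])) 2)
  rw [← lintegral_const_mul' _ _ (by norm_num)]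
  refine setLIntegral_mono' measurableSet_Ioo fun r hr => ?_
  obtain ⟨hr0, hr1⟩ := hr
  have hn : ∀ θ, ‖circleMap 0 r θ‖ = r := fun θ => by simp [abs_of_pos hr0]
  simp only [hn]
  rw [lintegral_mul_const' _ _ ENNReal.ofReal_ne_top, lintegral_circle_enorm_discKernel hw hr0 hr1]
  have hr2 : r ^ 2 < 1 := pow_lt_one₀ hr0.le hr1 two_ne_zero
  have h1 : 0 < 1 - ‖w‖ ^ 2 * r ^ 2 := by nlinarith [sq_nonneg ‖w‖, sq_nonneg r]
  -- After integration in the angle the kernel is 2/(1 - |w|²r²); this lower bound for the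
  -- denominator reduces to the radial estimate with δ = 1 - |w|².
  have h2 : max (1 - r) (1 - ‖w‖ ^ 2) ≤ 1 - ‖w‖ ^ 2 * r ^ 2 := by
    refine max_le ?_ ?_ <;> nlinarith [sq_nonneg ‖w‖, sq_nonneg r]
  have h3 : 0 < max (1 - r) (1 - ‖w‖ ^ 2) := lt_max_of_lt_left (by linarith)
  have h4 : (1 - r ^ 2) ^ (-t) ≤ (1 - r) ^ (-t) :=
    Real.rpow_le_rpow_of_nonpos (by linarith) (by nlinarith) (by linarith)
  have hre : 0 < r ^ (-e) := Real.rpow_pos_of_pos hr0 _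
  have hrt : 0 < (1 - r ^ 2) ^ (-t) := Real.rpow_pos_of_pos (by linarith) _
  have hrt' : 0 < (1 - r) ^ (-t) := Real.rpow_pos_of_pos (by linarith) _
  rw [← ENNReal.ofReal_mul (by positivity), ← ENNReal.ofReal_mul (by positivity),
    ← ENNReal.ofReal_ofNat, ← ENNReal.ofReal_mul (by positivity)]
  refine ENNReal.ofReal_le_ofReal ?_
  rw [sub_eq_add_neg 1 e, Real.rpow_add hr0, Real.rpow_one]
  calc r * (2 * (1 - ‖w‖ ^ 2 * r ^ 2)⁻¹ * (r ^ (-e) * (1 - r ^ 2) ^ (-t)))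
      = 2 * (r * r ^ (-e) * (1 - r ^ 2) ^ (-t) / (1 - ‖w‖ ^ 2 * r ^ 2)) := by ring
    _ ≤ 2 * (r * r ^ (-e) * (1 - r) ^ (-t) / max (1 - r) (1 - ‖w‖ ^ 2)) := by gcongr

/-! ### Schur's test. -/

section Schur

variable {X Y : Type*} [MeasurableSpace X] [MeasurableSpace Y]

/-- `s ^ p` is, up to a constant, a supersolution of the integral operator with kernel `k`. -/
def IsSchurWeight (μ : Measure X) (k : X → X → ℝ≥0∞) (s : X → ℝ≥0∞) (p : ℝ) : Prop :=
  ∃ C : ℝ≥0∞, C ≠ ∞ ∧ ∀ᵐ x ∂μ, ∫⁻ y, k x y * s y ^ p ∂μ ≤ C * s x ^ p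

/-- Kernel and weight both factor, hence so does the integral. This reduces the test in three
variables to the disc. -/
theorem IsSchurWeight.prod {μ : Measure X} {ν : Measure Y} [SFinite μ] [SFinite ν]
    {k : X → X → ℝ≥0∞} {l : Y → Y → ℝ≥0∞} {s : X → ℝ≥0∞} {t : Y → ℝ≥0∞} {p : ℝ}
    (hp : 0 ≤ p) (hk : ∀ x, Measurable (k x)) (hl : ∀ x, Measurable (l x)) (hs : Measurable s)
    (ht : Measurable t) (h1 : IsSchurWeight μ k s p) (h2 : IsSchurWeight ν l t p) :
    IsSchurWeight (μ.prod ν) (fun x y => k x.1 y.1 * l x.2 y.2) (fun x => s x.1 * t x.2) p := by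
  obtain ⟨C, hC, h1⟩ := h1
  obtain ⟨D, hD, h2⟩ := h2
  refine ⟨C * D, ENNReal.mul_ne_top hC hD, ?_⟩
  filter_upwards [Measure.quasiMeasurePreserving_fst.ae h1,
    Measure.quasiMeasurePreserving_snd.ae h2] with x hx1 hx2
  have hkx := hk x.1
  have hlx := hl x.2
  calc ∫⁻ y, k x.1 y.1 * l x.2 y.2 * (s y.1 * t y.2) ^ p ∂μ.prod ν
      = ∫⁻ y, (k x.1 y.1 * s y.1 ^ p) * (l x.2 y.2 * t y.2 ^ p) ∂μ.prod ν := by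
        congr 1 with y
        rw [ENNReal.mul_rpow_of_nonneg _ _ hp]
        ring
    _ = (∫⁻ a, k x.1 a * s a ^ p ∂μ) * ∫⁻ b, l x.2 b * t b ^ p ∂ν :=
        lintegral_prod_mul (f := fun a => k x.1 a * s a ^ p) (g := fun b => l x.2 b * t b ^ p)
          (by fun_prop) (by fun_prop)
    _ ≤ (C * s x.1 ^ p) * (D * t x.2 ^ p) := mul_le_mul' hx1 hx2
    _ = C * D * (s x.1 * t x.2) ^ p := by
        rw [ENNReal.mul_rpow_of_nonneg _ _ hp]
        ring

/-- Schur's test for a symmetric nonnegative kernel. -/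
theorem exists_lintegral_rpow_le_of_isSchurWeight {μ : Measure X} [SFinite μ] {p q : ℝ}
    (hpq : p.HolderConjugate q) {k : X → X → ℝ≥0∞} (hk : Measurable fun z : X × X => k z.1 z.2)
    (hsymm : ∀ x y, k x y = k y x) {s : X → ℝ≥0∞} (hs : Measurable s)
    (hs0 : ∀ᵐ x ∂μ, s x ≠ 0 ∧ s x ≠ ∞) (h1 : IsSchurWeight μ k s p) (h2 : IsSchurWeight μ k s q) :
    ∃ C : ℝ≥0∞, C ≠ ∞ ∧ ∀ f : X → ℝ≥0∞, Measurable f →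
      ∫⁻ x, (∫⁻ y, k x y * f y ∂μ) ^ p ∂μ ≤ C * ∫⁻ x, f x ^ p ∂μ := by
  obtain ⟨C, hC, h1⟩ := h1
  obtain ⟨D, hD, h2⟩ := h2
  have hp := hpq.pos
  have hq := hpq.symm.pos
  refine ⟨D ^ (p / q) * C, ENNReal.mul_ne_top (ENNReal.rpow_ne_top_of_nonneg (by positivity) hD) hC,
    fun f hf => ?_⟩
  have hkx : ∀ x, Measurable (k x) := fun x => hk.comp measurable_prodMk_left
  have hpt : ∀ᵐ x ∂μ, (∫⁻ y, k x y * f y ∂μ) ^ p ≤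
      D ^ (p / q) * ∫⁻ y, s x ^ p * (k x y * (f y * (s y)⁻¹) ^ p) ∂μ := by
    filter_upwards [h2, hs0] with x hx hsx
    have hkxm := hkx x
    -- The splitting k f = (k^(1/q) s)(k^(1/p) f/s) for Hölder's inequality: the first factor is
    -- absorbed by the weight condition for q, the second, after Tonelli and symmetry, by the one
    -- for p.
    have e1 : ∫⁻ y, k x y * f y ∂μ =
        ∫⁻ y, ((fun y => k x y ^ (1 / q) * s y) * fun y => k x y ^ (1 / p) * (f y * (s y)⁻¹)) y
          ∂μ := by
      refine lintegral_congr_ae ?_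
      filter_upwards [hs0] with y hy
      have : k x y = k x y ^ (1 / q) * k x y ^ (1 / p) := by
        rw [← ENNReal.rpow_add_of_nonneg _ _ (by positivity) (by positivity), one_div, one_div,
          hpq.symm.inv_add_inv_eq_one, ENNReal.rpow_one]
      calc k x y * f y = k x y ^ (1 / q) * k x y ^ (1 / p) * f y * (s y * (s y)⁻¹) := by
            rw [ENNReal.mul_inv_cancel hy.1 hy.2, mul_one, ← this]
        _ = _ := by
            simp only [Pi.mul_apply]
            ring
    have e2 := ENNReal.lintegral_mul_le_Lp_mul_Lq μ hpq.symm
      (f := fun y => k x y ^ (1 / q) * s y) (g := fun y => k x y ^ (1 / p) * (f y * (s y)⁻¹))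
      (by fun_prop) (by fun_prop)
    rw [← e1] at e2
    have e3 : ∀ {r : ℝ}, 0 < r → ∀ a b : ℝ≥0∞, (a ^ (1 / r) * b) ^ r = a * b ^ r := by
      intro r hr a b
      rw [ENNReal.mul_rpow_of_nonneg _ _ hr.le, ← ENNReal.rpow_mul, one_div_mul_cancel hr.ne',
        ENNReal.rpow_one]
    simp only [e3 hp, e3 hq] at e2
    have hsp : s x ^ p ≠ ∞ := ENNReal.rpow_ne_top_of_nonneg hp.le hsx.2
    calc (∫⁻ y, k x y * f y ∂μ) ^ p
        ≤ ((D * s x ^ q) ^ (1 / q) * (∫⁻ y, k x y * (f y * (s y)⁻¹) ^ p ∂μ) ^ (1 / p)) ^ p := by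
          refine ENNReal.rpow_le_rpow (e2.trans ?_) hp.le
          gcongr
      _ = D ^ (p / q) * (s x ^ p * ∫⁻ y, k x y * (f y * (s y)⁻¹) ^ p ∂μ) := by
          rw [ENNReal.mul_rpow_of_nonneg _ _ hp.le, ← ENNReal.rpow_mul, ← ENNReal.rpow_mul,
            one_div_mul_cancel hp.ne', ENNReal.rpow_one,
            ENNReal.mul_rpow_of_nonneg _ _ (by positivity), ← ENNReal.rpow_mul, mul_assoc]
          congr 2
          · ring
          · congr 1
            field_simp
      _ = _ := by rw [← lintegral_const_mul' _ _ hsp]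
  calc ∫⁻ x, (∫⁻ y, k x y * f y ∂μ) ^ p ∂μ
      ≤ ∫⁻ x, D ^ (p / q) * ∫⁻ y, s x ^ p * (k x y * (f y * (s y)⁻¹) ^ p) ∂μ ∂μ :=
        lintegral_mono_ae hpt
    _ = D ^ (p / q) * ∫⁻ y, ∫⁻ x, s x ^ p * (k x y * (f y * (s y)⁻¹) ^ p) ∂μ ∂μ := by
        rw [lintegral_const_mul' _ _ (ENNReal.rpow_ne_top_of_nonneg (by positivity) hD),
          lintegral_lintegral_swap]
        refine Measurable.aemeasurable ?_
        exact Measurable.mul (by fun_prop) (hk.mul (by fun_prop))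
    _ ≤ D ^ (p / q) * ∫⁻ y, C * f y ^ p ∂μ := by
        refine mul_le_mul_right (lintegral_mono_ae ?_) _
        filter_upwards [h1, hs0] with y hy hsy
        have hkym := hkx y
        calc ∫⁻ x, s x ^ p * (k x y * (f y * (s y)⁻¹) ^ p) ∂μ
            = (∫⁻ x, k y x * s x ^ p ∂μ) * (f y * (s y)⁻¹) ^ p := by
              rw [← lintegral_mul_const _ (by fun_prop)]
              congr 1 with x
              rw [hsymm x y]
              ring
          _ ≤ C * s y ^ p * (f y * (s y)⁻¹) ^ p := mul_le_mul_left hy _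
          _ = C * f y ^ p := by
              rw [mul_assoc, ← ENNReal.mul_rpow_of_nonneg _ _ hp.le, mul_left_comm,
                ENNReal.mul_inv_cancel hsy.1 hsy.2, mul_one]
    _ = D ^ (p / q) * C * ∫⁻ x, f x ^ p ∂μ := by
        rw [lintegral_const_mul' _ _ hC, mul_assoc]

end Schur

/-! ### Schur weights for the kernel of the domain. -/

/-- The modulus of the kernel in the directions in which the parametrization degenerates. -/
noncomputable def weightedDiscKernel (w u : ℂ) : ℝ≥0∞ := ‖w‖ₑ⁻¹ * ‖u‖ₑ⁻¹ * ‖discKernel w u‖ₑ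

theorem enorm_discKernel_comm (w u : ℂ) : ‖discKernel w u‖ₑ = ‖discKernel u w‖ₑ := by
  have h : ‖discKernel w u‖ = ‖discKernel u w‖ := by
    have : 1 - w * (starRingEnd ℂ) u = (starRingEnd ℂ) (1 - u * (starRingEnd ℂ) w) := by
      simp [mul_comm]
    simp only [discKernel, norm_inv, norm_mul, norm_pow, this, RCLike.norm_conj]
  rw [← ofReal_norm, h, ofReal_norm]

theorem measurable_discKernel_uncurry : Measurable fun z : ℂ × ℂ => discKernel z.1 z.2 := by
  unfold discKernel
  fun_prop

theorem isSchurWeight_discMeasure {b p : ℝ} (hb : 0 < b * p) (hb1 : b * p < 1) (hp : 0 ≤ p) :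
    IsSchurWeight discMeasure (fun w u => ‖discKernel w u‖ₑ)
      (fun u => ENNReal.ofReal ((1 - ‖u‖ ^ 2) ^ (-b))) p := by
  obtain ⟨C, hC, h⟩ := exists_lintegral_discKernel_le le_rfl two_pos hb hb1
  have hpow : ∀ u : ℂ, ‖u‖ < 1 → ENNReal.ofReal ((1 - ‖u‖ ^ 2) ^ (-b)) ^ p =
      ENNReal.ofReal ((1 - ‖u‖ ^ 2) ^ (-(b * p))) := by
    intro u hu
    have h1 : 0 < 1 - ‖u‖ ^ 2 := sub_pos.2 (pow_lt_one₀ (norm_nonneg _) hu two_ne_zero)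
    rw [ENNReal.ofReal_rpow_of_nonneg (by positivity) hp, ← Real.rpow_mul h1.le, neg_mul]
  refine ⟨C, hC, ?_⟩
  filter_upwards [discMeasure_ae_norm_lt] with w hw
  rw [hpow w hw]
  refine le_trans (le_of_eq (lintegral_congr_ae ?_)) (h w hw)
  filter_upwards [discMeasure_ae_norm_lt] with u hu
  rw [hpow u hu, neg_zero, Real.rpow_zero, one_mul]

/-- The density |u|² and the factor |u|⁻¹ of the kernel turn |u|^(-ap) into |u|^(-(ap-1)), so the
Forelli–Rudin estimate applies with e = ap - 1, which lies in [0, 2). The remaining |w|⁻¹ is at most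
|w|^(-ap) since ap ≥ 1. -/
theorem isSchurWeight_discMeasureSq {a b p : ℝ} (ha : 1 ≤ a * p) (ha1 : a * p < 3)
    (hb : 0 < b * p) (hb1 : b * p < 1) (hp : 0 ≤ p) :
    IsSchurWeight discMeasureSq weightedDiscKernel
      (fun u => ENNReal.ofReal (‖u‖ ^ (-a) * (1 - ‖u‖ ^ 2) ^ (-b))) p := by
  obtain ⟨C, hC, h⟩ := exists_lintegral_discKernel_le (e := a * p - 1) (by linarith)
    (by linarith) hb hb1
  have hpow : ∀ u ∈ puncturedDisc, ENNReal.ofReal (‖u‖ ^ (-a) * (1 - ‖u‖ ^ 2) ^ (-b)) ^ p =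
      ENNReal.ofReal (‖u‖ ^ (-(a * p)) * (1 - ‖u‖ ^ 2) ^ (-(b * p))) := by
    intro u hu
    obtain ⟨hu1, -⟩ := mem_puncturedDisc.1 hu
    have h1 : 0 < 1 - ‖u‖ ^ 2 := sub_pos.2 (pow_lt_one₀ (norm_nonneg _) hu1 two_ne_zero)
    rw [ENNReal.ofReal_rpow_of_nonneg (by positivity) hp,
      Real.mul_rpow (by positivity) (by positivity), ← Real.rpow_mul h1.le,
      ← Real.rpow_mul (norm_nonneg _), neg_mul, neg_mul]
  refine ⟨C, hC, ?_⟩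
  filter_upwards [discMeasureSq_ae] with w hw
  obtain ⟨hw1, hw0⟩ := mem_puncturedDisc.1 hw
  have hwp : 0 < ‖w‖ := norm_pos_iff.2 hw0
  have hw2 : 0 < 1 - ‖w‖ ^ 2 := sub_pos.2 (pow_lt_one₀ (norm_nonneg _) hw1 two_ne_zero)
  rw [hpow w hw, lintegral_discMeasureSq]
  calc ∫⁻ u, ‖u‖ₑ ^ 2 * (weightedDiscKernel w u *
        ENNReal.ofReal (‖u‖ ^ (-a) * (1 - ‖u‖ ^ 2) ^ (-b)) ^ p) ∂discMeasure
      = ∫⁻ u, ‖w‖ₑ⁻¹ * (‖discKernel w u‖ₑ *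
          ENNReal.ofReal (‖u‖ ^ (-(a * p - 1)) * (1 - ‖u‖ ^ 2) ^ (-(b * p)))) ∂discMeasure := by
        refine lintegral_congr_ae ?_
        filter_upwards [discMeasure_ae] with u hu
        obtain ⟨-, hu0⟩ := mem_puncturedDisc.1 hu
        have hup : 0 < ‖u‖ := norm_pos_iff.2 hu0
        have e1 : ENNReal.ofReal (‖u‖ ^ (-(a * p - 1)) * (1 - ‖u‖ ^ 2) ^ (-(b * p))) =
            ‖u‖ₑ * ENNReal.ofReal (‖u‖ ^ (-(a * p)) * (1 - ‖u‖ ^ 2) ^ (-(b * p))) := by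
          rw [← ofReal_norm, ← ENNReal.ofReal_mul hup.le, neg_sub, sub_eq_add_neg,
            Real.rpow_add hup, Real.rpow_one, mul_assoc]
        have e2 : ‖u‖ₑ * ‖u‖ₑ⁻¹ = 1 := ENNReal.mul_inv_cancel (by simpa using hu0) (by simp)
        rw [hpow u hu, e1, weightedDiscKernel]
        calc _ = (‖u‖ₑ * ‖u‖ₑ⁻¹) * (‖w‖ₑ⁻¹ * (‖discKernel w u‖ₑ * (‖u‖ₑ *
              ENNReal.ofReal (‖u‖ ^ (-(a * p)) * (1 - ‖u‖ ^ 2) ^ (-(b * p)))))) := by ring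
          _ = _ := by rw [e2, one_mul]
    _ ≤ ‖w‖ₑ⁻¹ * (C * ENNReal.ofReal ((1 - ‖w‖ ^ 2) ^ (-(b * p)))) := by
        rw [lintegral_const_mul' _ _ (by simpa using hw0)]
        exact mul_le_mul_right (h w hw1) _
    _ ≤ C * ENNReal.ofReal (‖w‖ ^ (-(a * p)) * (1 - ‖w‖ ^ 2) ^ (-(b * p))) := by
        rw [mul_left_comm, ENNReal.ofReal_mul (by positivity)]
        refine mul_le_mul_right (mul_le_mul_left ?_ _) _
        rw [← ofReal_norm, ← ENNReal.ofReal_inv_of_pos hwp]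
        refine ENNReal.ofReal_le_ofReal ?_
        rw [← Real.rpow_neg_one]
        exact Real.rpow_le_rpow_of_exponent_ge hwp hw1.le (by linarith)

/-- The modulus of the Bergman kernel of `wedge`, in the coordinates given by `wedgeMap`. -/
noncomputable def sourceKernel (w u : ℂ × ℂ × ℂ) : ℝ≥0∞ :=
  weightedDiscKernel w.1 u.1 * (weightedDiscKernel w.2.1 u.2.1 * ‖discKernel w.2.2 u.2.2‖ₑ)

/-- The test function for Schur's test on `wedgeSource`. -/
noncomputable def sourceWeight (a b : ℝ) (u : ℂ × ℂ × ℂ) : ℝ≥0∞ :=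
  ENNReal.ofReal (‖u.1‖ ^ (-a) * (1 - ‖u.1‖ ^ 2) ^ (-b)) *
    (ENNReal.ofReal (‖u.2.1‖ ^ (-a) * (1 - ‖u.2.1‖ ^ 2) ^ (-b)) *
      ENNReal.ofReal ((1 - ‖u.2.2‖ ^ 2) ^ (-b)))

theorem measurable_weightedDiscKernel (w : ℂ) : Measurable (weightedDiscKernel w) := by
  have := measurable_discKernel w
  unfold weightedDiscKernel
  fun_prop

theorem isSchurWeight_sourceMeasure {a b p : ℝ} (ha : 1 ≤ a * p) (ha1 : a * p < 3)
    (hb : 0 < b * p) (hb1 : b * p < 1) (hp : 0 ≤ p) :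
    IsSchurWeight sourceMeasure sourceKernel (sourceWeight a b) p := by
  have hS := isSchurWeight_discMeasureSq ha ha1 hb hb1 hp
  have hT := isSchurWeight_discMeasure hb hb1 hp
  have hm0 : ∀ w, Measurable fun u => ‖discKernel w u‖ₑ := fun w => (measurable_discKernel w).enorm
  have hST := hS.prod hp measurable_weightedDiscKernel hm0 (by fun_prop) (by fun_prop) hT
  have hm10 : ∀ x : ℂ × ℂ, Measurable fun y : ℂ × ℂ =>
      weightedDiscKernel x.1 y.1 * ‖discKernel x.2 y.2‖ₑ := fun x =>
    ((measurable_weightedDiscKernel x.1).comp measurable_fst).mul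
      ((hm0 x.2).comp measurable_snd)
  have h := hS.prod hp measurable_weightedDiscKernel hm10 (by fun_prop) (by fun_prop) hST
  have e1 : sourceKernel = fun w u => weightedDiscKernel w.1 u.1 *
      (weightedDiscKernel w.2.1 u.2.1 * ‖discKernel w.2.2 u.2.2‖ₑ) := rfl
  have e2 : sourceWeight a b = fun u => ENNReal.ofReal (‖u.1‖ ^ (-a) * (1 - ‖u.1‖ ^ 2) ^ (-b)) *
      (ENNReal.ofReal (‖u.2.1‖ ^ (-a) * (1 - ‖u.2.1‖ ^ 2) ^ (-b)) *
      ENNReal.ofReal ((1 - ‖u.2.2‖ ^ 2) ^ (-b))) := rfl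
  rw [e1, e2, sourceMeasure]
  exact h

/-- The same a must satisfy 1 ≤ ap < 3 and 1 ≤ aq < 3. The lower bounds force a ≥ max(1/p, 1/q), and
for equality the upper bounds read p/q = p - 1 < 3 and q/p = q - 1 < 3, that is p < 4 and q < 4. The
choice b = 1/(pq) gives bp = 1/q and bq = 1/p, both in (0, 1). -/
theorem exists_lintegral_sourceKernel_le {p : ℝ} (hp : 4 / 3 < p) (hp4 : p < 4) :
    ∃ C : ℝ≥0∞, C ≠ ∞ ∧ ∀ f : ℂ × ℂ × ℂ → ℝ≥0∞, Measurable f →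
      ∫⁻ w, (∫⁻ u, sourceKernel w u * f u ∂sourceMeasure) ^ p ∂sourceMeasure ≤
        C * ∫⁻ w, f w ^ p ∂sourceMeasure := by
  have hpq : p.HolderConjugate p.conjExponent := Real.HolderConjugate.conjExponent (by linarith)
  set q := p.conjExponent with hq
  have hp0 := hpq.pos
  have hq0 := hpq.symm.pos
  have hpq1 : p * q = p + q := hpq.mul_eq_add
  -- This is where p > 4/3 enters: 4/3 and 4 are conjugate.
  have hq4 : q < 4 := by nlinarith
  have hap : max (1 / p) (1 / q) * p < 3 := by
    rw [max_mul_of_nonneg _ _ hp0.le]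
    refine max_lt ?_ ?_
    · rw [one_div_mul_cancel hp0.ne']
      norm_num
    · rw [one_div_mul_eq_div, div_lt_iff₀ hq0]
      nlinarith
  have haq : max (1 / p) (1 / q) * q < 3 := by
    rw [max_mul_of_nonneg _ _ hq0.le]
    refine max_lt ?_ ?_
    · rw [one_div_mul_eq_div, div_lt_iff₀ hp0]
      nlinarith
    · rw [one_div_mul_cancel hq0.ne']
      norm_num
  have hap1 : 1 ≤ max (1 / p) (1 / q) * p := by
    rw [max_mul_of_nonneg _ _ hp0.le, one_div_mul_cancel hp0.ne']
    exact le_max_left _ _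
  have haq1 : 1 ≤ max (1 / p) (1 / q) * q := by
    rw [max_mul_of_nonneg _ _ hq0.le, one_div_mul_cancel hq0.ne']
    exact le_max_right _ _
  set a := max (1 / p) (1 / q)
  have hbp : 1 / (p * q) * p = q⁻¹ := by field_simp
  have hbq : 1 / (p * q) * q = p⁻¹ := by field_simp
  refine exists_lintegral_rpow_le_of_isSchurWeight hpq (s := sourceWeight a (1 / (p * q))) ?_ ?_ ?_ ?_
    (isSchurWeight_sourceMeasure hap1 hap (by positivity) ?_ hp0.le)
    (isSchurWeight_sourceMeasure haq1 haq (by positivity) ?_ hq0.le)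
  · have hm := measurable_discKernel_uncurry
    have h1 : Measurable fun z : (ℂ × ℂ × ℂ) × (ℂ × ℂ × ℂ) => discKernel z.1.1 z.2.1 :=
      hm.comp (f := fun z : (ℂ × ℂ × ℂ) × (ℂ × ℂ × ℂ) => (z.1.1, z.2.1)) (by fun_prop)
    have h2 : Measurable fun z : (ℂ × ℂ × ℂ) × (ℂ × ℂ × ℂ) => discKernel z.1.2.1 z.2.2.1 :=
      hm.comp (f := fun z : (ℂ × ℂ × ℂ) × (ℂ × ℂ × ℂ) => (z.1.2.1, z.2.2.1)) (by fun_prop)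
    have h3 : Measurable fun z : (ℂ × ℂ × ℂ) × (ℂ × ℂ × ℂ) => discKernel z.1.2.2 z.2.2.2 :=
      hm.comp (f := fun z : (ℂ × ℂ × ℂ) × (ℂ × ℂ × ℂ) => (z.1.2.2, z.2.2.2)) (by fun_prop)
    unfold sourceKernel weightedDiscKernel
    fun_prop
  · intro x y
    simp only [sourceKernel, weightedDiscKernel, enorm_discKernel_comm x.1,
      enorm_discKernel_comm x.2.1, enorm_discKernel_comm x.2.2]
    ring
  · unfold sourceWeight
    fun_prop
  · filter_upwards [sourceMeasure_ae] with w hw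
    obtain ⟨h1, h2, h3⟩ := hw
    have hpos : ∀ u : ℂ, ‖u‖ < 1 → 0 < (1 - ‖u‖ ^ 2) ^ (-(1 / (p * q))) := fun u hu =>
      Real.rpow_pos_of_pos (sub_pos.2 (pow_lt_one₀ (norm_nonneg _) hu two_ne_zero)) _
    have hpos' : ∀ u ∈ puncturedDisc, 0 < ‖u‖ ^ (-a) * (1 - ‖u‖ ^ 2) ^ (-(1 / (p * q))) := by
      intro u hu
      obtain ⟨hu1, hu0⟩ := mem_puncturedDisc.1 hu
      exact mul_pos (Real.rpow_pos_of_pos (norm_pos_iff.2 hu0) _) (hpos u hu1)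
    refine ⟨?_, by unfold sourceWeight; finiteness⟩
    unfold sourceWeight
    simp only [ne_eq, mul_eq_zero, ENNReal.ofReal_eq_zero, not_or, not_le]
    exact ⟨hpos' _ h1, hpos' _ h2, hpos _ (by simpa using h3)⟩
  · rw [hbp]
    exact inv_lt_one_of_one_lt₀ hpq.symm.lt
  · rw [hbq]
    exact inv_lt_one_of_one_lt₀ hpq.lt

/-! ### The reproducing formula in several variables. -/

theorem integrable_of_lintegral_sq {X : Type*} [MeasurableSpace X] {μ : Measure X}
    [IsFiniteMeasure μ] {F : X → ℂ} (hF : AEStronglyMeasurable F μ)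
    (hF2 : ∫⁻ u, ‖F u‖ₑ ^ 2 ∂μ ≠ ∞) : Integrable F μ :=
  (memLp_two_of_lintegral_sq hF hF2).integrable (by norm_num)

/-- Fubini and the one-variable formula in each variable. Slices of an L² function are in L² only
almost everywhere, so for the slice through the given b it is a hypothesis. -/
theorem integral_discKernel_mul_two {F : ℂ × ℂ → ℂ} (hFm : Measurable F)
    (hF : DifferentiableOn ℂ F (puncturedDisc ×ˢ puncturedDisc))
    (hF2 : ∫⁻ u, ‖F u‖ₑ ^ 2 ∂discMeasure.prod discMeasure ≠ ∞) {a b : ℂ}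
    (ha : a ∈ puncturedDisc) (hb : b ∈ puncturedDisc)
    (hFb : ∫⁻ u, ‖F (u, b)‖ₑ ^ 2 ∂discMeasure ≠ ∞) :
    ∫ u, discKernel a u.1 * (discKernel b u.2 * F u) ∂discMeasure.prod discMeasure = F (a, b) := by
  have ha1 := (mem_puncturedDisc.1 ha).1
  have hb1 := (mem_puncturedDisc.1 hb).1
  have hFi := integrable_of_lintegral_sq hFm.aestronglyMeasurable hF2
  have hbound : ∀ {c : ℂ}, ‖c‖ < 1 → ∀ᵐ u ∂discMeasure,
      ‖discKernel c u‖ ≤ (Real.pi * (1 - ‖c‖) ^ 2)⁻¹ := fun hc =>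
    discMeasure_ae_norm_lt.mono fun u hu => norm_discKernel_le hc hu.le
  have hint : Integrable (fun u : ℂ × ℂ => discKernel a u.1 * (discKernel b u.2 * F u))
      (discMeasure.prod discMeasure) := by
    refine (hFi.bdd_mul (c := (Real.pi * (1 - ‖b‖) ^ 2)⁻¹) ?_ ?_).bdd_mul
      (c := (Real.pi * (1 - ‖a‖) ^ 2)⁻¹) ?_ ?_
    · exact ((measurable_discKernel b).comp measurable_snd).aestronglyMeasurable
    · exact Measure.quasiMeasurePreserving_snd.ae (hbound hb1)
    · exact ((measurable_discKernel a).comp measurable_fst).aestronglyMeasurable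
    · exact Measure.quasiMeasurePreserving_fst.ae (hbound ha1)
  rw [integral_prod _ hint]
  have hslice : ∀ᵐ x ∂discMeasure, ∫⁻ y, ‖F (x, y)‖ₑ ^ 2 ∂discMeasure ≠ ∞ := by
    rw [lintegral_prod _ (by fun_prop)] at hF2
    refine (ae_lt_top ?_ hF2).mono fun x hx => hx.ne
    exact Measurable.lintegral_prod_right' (f := fun z => ‖F z‖ₑ ^ 2) (by fun_prop)
  rw [← integral_discKernel_mul (F := fun u => F (u, b))
    (hF.comp (by fun_prop) fun u hu => ⟨hu, hb⟩) hFb ha]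
  refine integral_congr_ae ?_
  filter_upwards [hslice, discMeasure_ae] with x hx hxD
  simp only [integral_const_mul]
  rw [integral_discKernel_mul (F := fun v => F (x, v))
    (hF.comp (by fun_prop) fun u hu => ⟨hxD, hu⟩) hx hb]

/-- Lebesgue measure on the unit polydisc in `ℂ³`. -/
noncomputable def polydiscMeasure : Measure (ℂ × ℂ × ℂ) :=
  discMeasure.prod (discMeasure.prod discMeasure)

instance : IsFiniteMeasure polydiscMeasure := by
  unfold polydiscMeasure
  infer_instance

theorem sourceMeasure_eq_withDensity :
    sourceMeasure = polydiscMeasure.withDensity fun u => ‖u.1‖ₑ ^ 2 * ‖u.2.1‖ₑ ^ 2 := by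
  rw [sourceMeasure, discMeasureSq, prod_withDensity_left (ν := discMeasure) (by fun_prop),
    prod_withDensity (by fun_prop) (by fun_prop), polydiscMeasure]

theorem sourceMeasure_absolutelyContinuous : sourceMeasure ≪ polydiscMeasure := by
  rw [sourceMeasure_eq_withDensity]
  exact withDensity_absolutelyContinuous _ _

/-- Reproducing property of the Bergman kernel of the polydisc for square integrable holomorphic
functions outside the coordinate hyperplanes. -/
theorem integral_discKernel_mul_three {F : ℂ × ℂ × ℂ → ℂ} (hFm : Measurable F)
    (hF : DifferentiableOn ℂ F (puncturedDisc ×ˢ puncturedDisc ×ˢ puncturedDisc))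
    (hF2 : ∫⁻ u, ‖F u‖ₑ ^ 2 ∂polydiscMeasure ≠ ∞) :
    ∀ᵐ w ∂polydiscMeasure, ∫ u, discKernel w.1 u.1 * (discKernel w.2.1 u.2.1 *
      (discKernel w.2.2 u.2.2 * F u)) ∂polydiscMeasure = F w := by
  have hFi := integrable_of_lintegral_sq hFm.aestronglyMeasurable hF2
  have hbound : ∀ {c : ℂ}, ‖c‖ < 1 → ∀ᵐ u ∂discMeasure,
      ‖discKernel c u‖ ≤ (Real.pi * (1 - ‖c‖) ^ 2)⁻¹ := fun hc =>
    discMeasure_ae_norm_lt.mono fun u hu => norm_discKernel_le hc hu.le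
  have hslice1 : ∀ᵐ x ∂discMeasure,
      ∫⁻ y, ‖F (x, y)‖ₑ ^ 2 ∂discMeasure.prod discMeasure ≠ ∞ := by
    rw [polydiscMeasure, lintegral_prod _ (by fun_prop)] at hF2
    refine (ae_lt_top ?_ hF2).mono fun x hx => hx.ne
    exact Measurable.lintegral_prod_right' (f := fun z => ‖F z‖ₑ ^ 2) (by fun_prop)
  have hslice23 : ∀ᵐ y ∂discMeasure.prod discMeasure,
      ∫⁻ x, ‖F (x, y)‖ₑ ^ 2 ∂discMeasure ≠ ∞ := by
    rw [polydiscMeasure, lintegral_prod_symm _ (by fun_prop)] at hF2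
    refine (ae_lt_top ?_ hF2).mono fun x hx => hx.ne
    exact Measurable.lintegral_prod_left' (f := fun z => ‖F z‖ₑ ^ 2) (by fun_prop)
  -- This provides the slice hypothesis of `integral_discKernel_mul_two` for F(a, ·), uniformly
  -- enough in a to integrate over it afterwards.
  have hslice3 : ∀ᵐ c ∂discMeasure, ∀ᵐ a ∂discMeasure,
      ∫⁻ b, ‖F (a, b, c)‖ₑ ^ 2 ∂discMeasure ≠ ∞ := by
    have hF2' := hF2
    rw [polydiscMeasure, lintegral_prod_symm _ (by fun_prop), lintegral_prod_symm] at hF2'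
    · have h1 := ae_lt_top ?_ hF2'
      · filter_upwards [h1] with c hc
        rw [lintegral_lintegral_swap (by fun_prop)] at hc
        refine (ae_lt_top ?_ hc.ne).mono fun x hx => hx.ne
        exact Measurable.lintegral_prod_right' (f := fun z : ℂ × ℂ => ‖F (z.1, z.2, c)‖ₑ ^ 2)
          (by fun_prop)
      · exact Measurable.lintegral_prod_left' (f := fun z : ℂ × ℂ =>
          ∫⁻ x, ‖F (x, z)‖ₑ ^ 2 ∂discMeasure)
            (Measurable.lintegral_prod_left' (f := fun z => ‖F z‖ₑ ^ 2) (by fun_prop))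
    · exact (Measurable.lintegral_prod_left' (f := fun z => ‖F z‖ₑ ^ 2)
        (by fun_prop)).aemeasurable
  have hD : ∀ᵐ w ∂polydiscMeasure,
      w ∈ puncturedDisc ×ˢ puncturedDisc ×ˢ puncturedDisc := by
    have h4 := (Measure.quasiMeasurePreserving_snd (μ := discMeasure)).ae
      (((Measure.quasiMeasurePreserving_fst (ν := discMeasure)).ae discMeasure_ae).and
        ((Measure.quasiMeasurePreserving_snd (μ := discMeasure)).ae discMeasure_ae))
    filter_upwards [(Measure.quasiMeasurePreserving_fst
      (ν := discMeasure.prod discMeasure)).ae discMeasure_ae, h4] with w h1 h2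
    exact ⟨h1, h2.1, h2.2⟩
  have hA3 := (Measure.quasiMeasurePreserving_snd (μ := discMeasure)).ae
    ((Measure.quasiMeasurePreserving_snd (μ := discMeasure)).ae hslice3)
  filter_upwards [hD, (Measure.quasiMeasurePreserving_snd (μ := discMeasure)).ae hslice23, hA3]
    with ⟨a, b, c⟩ ⟨ha, hb, hc⟩ h23 h3
  simp only at ha hb hc h23 h3 ⊢
  have hint : Integrable (fun u : ℂ × ℂ × ℂ => discKernel a u.1 * (discKernel b u.2.1 *
      (discKernel c u.2.2 * F u))) polydiscMeasure := by
    refine ((hFi.bdd_mul (c := (Real.pi * (1 - ‖c‖) ^ 2)⁻¹) ?_ ?_).bdd_mul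
      (c := (Real.pi * (1 - ‖b‖) ^ 2)⁻¹) ?_ ?_).bdd_mul (c := (Real.pi * (1 - ‖a‖) ^ 2)⁻¹) ?_ ?_
    · exact ((measurable_discKernel c).comp (by fun_prop)).aestronglyMeasurable
    · exact Measure.quasiMeasurePreserving_snd.ae
        (Measure.quasiMeasurePreserving_snd.ae (hbound (mem_puncturedDisc.1 hc).1))
    · exact ((measurable_discKernel b).comp (by fun_prop)).aestronglyMeasurable
    · exact Measure.quasiMeasurePreserving_snd.ae
        (Measure.quasiMeasurePreserving_fst.ae (hbound (mem_puncturedDisc.1 hb).1))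
    · exact ((measurable_discKernel a).comp measurable_fst).aestronglyMeasurable
    · exact Measure.quasiMeasurePreserving_fst.ae (hbound (mem_puncturedDisc.1 ha).1)
  rw [polydiscMeasure, integral_prod _ hint]
  rw [← integral_discKernel_mul (F := fun u => F (u, b, c))
    (hF.comp (by fun_prop) fun u hu => ⟨hu, hb, hc⟩) h23 ha]
  refine integral_congr_ae ?_
  filter_upwards [hslice1, discMeasure_ae, h3] with x hx hxD hx3
  simp only [integral_const_mul]
  rw [integral_discKernel_mul_two (F := fun v => F (x, v)) (hFm.comp measurable_prodMk_left)
    (hF.comp (by fun_prop) fun u hu => ⟨hxD, hu⟩) hx hb hc hx3]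

/-! ### The Bergman kernel and the Bergman projection of the domain. -/

/-- The Bergman kernel of `wedge`, in the coordinates given by `wedgeMap`. -/
noncomputable def wedgeKernel (w u : ℂ × ℂ × ℂ) : ℂ :=
  discKernel w.1 u.1 * (discKernel w.2.1 u.2.1 * discKernel w.2.2 u.2.2) /
    (w.1 * w.2.1 * (starRingEnd ℂ) (u.1 * u.2.1))

theorem measurable_wedgeKernel (w : ℂ × ℂ × ℂ) : Measurable (wedgeKernel w) := by
  have h1 := (measurable_discKernel w.1).comp (measurable_fst : Measurable fun u : ℂ × ℂ × ℂ => u.1)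
  have h2 := (measurable_discKernel w.2.1).comp
    (measurable_fst.comp measurable_snd : Measurable fun u : ℂ × ℂ × ℂ => u.2.1)
  have h3 := (measurable_discKernel w.2.2).comp
    (measurable_snd.comp measurable_snd : Measurable fun u : ℂ × ℂ × ℂ => u.2.2)
  simp only [Function.comp_def] at h1 h2 h3
  unfold wedgeKernel
  fun_prop

theorem enorm_wedgeKernel {w u : ℂ × ℂ × ℂ} (hw : w ∈ wedgeSource) (hu : u ∈ wedgeSource) :
    ‖wedgeKernel w u‖ₑ = sourceKernel w u := by
  have h1 := (mem_puncturedDisc.1 hw.1).2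
  have h2 := (mem_puncturedDisc.1 hw.2.1).2
  have h3 := (mem_puncturedDisc.1 hu.1).2
  have h4 := (mem_puncturedDisc.1 hu.2.1).2
  have h3' : (starRingEnd ℂ) u.1 ≠ 0 := by simpa using h3
  have h4' : (starRingEnd ℂ) u.2.1 ≠ 0 := by simpa using h4
  have hconj : ∀ x : ℂ, ‖(starRingEnd ℂ) x‖ₑ = ‖x‖ₑ := fun x => by
    rw [← ofReal_norm, RCLike.norm_conj, ofReal_norm]
  have e : wedgeKernel w u = (w.1⁻¹ * ((starRingEnd ℂ) u.1)⁻¹ * discKernel w.1 u.1) *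
      ((w.2.1⁻¹ * ((starRingEnd ℂ) u.2.1)⁻¹ * discKernel w.2.1 u.2.1) *
        discKernel w.2.2 u.2.2) := by
    rw [wedgeKernel, map_mul, div_eq_mul_inv, mul_inv, mul_inv, mul_inv]
    ring
  rw [e, sourceKernel, weightedDiscKernel, weightedDiscKernel]
  simp only [enorm_mul, enorm_inv h1, enorm_inv h2, enorm_inv h3', enorm_inv h4', hconj]

/-- The density |u|² cancels the singularity |u|⁻² of the squared kernel, and the disc kernel is
bounded for fixed w. -/
theorem lintegral_weightedDiscKernel_sq_ne_top {w : ℂ} (hw : w ∈ puncturedDisc) :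
    ∫⁻ u, weightedDiscKernel w u ^ 2 ∂discMeasureSq ≠ ∞ := by
  obtain ⟨hw1, hw0⟩ := mem_puncturedDisc.1 hw
  rw [lintegral_discMeasureSq]
  refine ne_top_of_le_ne_top (b := ∫⁻ _, (‖w‖ₑ⁻¹ * ENNReal.ofReal (Real.pi * (1 - ‖w‖) ^ 2)⁻¹) ^ 2
    ∂discMeasure) ?_ (lintegral_mono_ae ?_)
  · rw [lintegral_const]
    have : ‖w‖ₑ⁻¹ ≠ ∞ := by simpa using hw0
    finiteness
  · filter_upwards [discMeasure_ae] with u hu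
    obtain ⟨hu1, hu0⟩ := mem_puncturedDisc.1 hu
    have e2 : ‖u‖ₑ * ‖u‖ₑ⁻¹ = 1 := ENNReal.mul_inv_cancel (by simpa using hu0) (by simp)
    rw [← mul_pow, weightedDiscKernel]
    refine pow_le_pow_left' ?_ 2
    calc ‖u‖ₑ * (‖w‖ₑ⁻¹ * ‖u‖ₑ⁻¹ * ‖discKernel w u‖ₑ)
        = (‖u‖ₑ * ‖u‖ₑ⁻¹) * (‖w‖ₑ⁻¹ * ‖discKernel w u‖ₑ) := by ring
      _ ≤ _ := by
        rw [e2, one_mul, ← ofReal_norm (discKernel w u)]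
        exact mul_le_mul_right (ENNReal.ofReal_le_ofReal (norm_discKernel_le hw1 hu1.le)) _

theorem lintegral_wedgeKernel_sq_ne_top {w : ℂ × ℂ × ℂ} (hw : w ∈ wedgeSource) :
    ∫⁻ u, ‖wedgeKernel w u‖ₑ ^ 2 ∂sourceMeasure ≠ ∞ := by
  have hw3 : ‖w.2.2‖ < 1 := by simpa using hw.2.2
  have hm1 := measurable_weightedDiscKernel w.1
  have hm2 := measurable_weightedDiscKernel w.2.1
  have hm3 := measurable_discKernel w.2.2
  have h3 : ∫⁻ u, ‖discKernel w.2.2 u‖ₑ ^ 2 ∂discMeasure ≠ ∞ := by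
    refine ne_top_of_le_ne_top (b := ∫⁻ _, ENNReal.ofReal (Real.pi * (1 - ‖w.2.2‖) ^ 2)⁻¹ ^ 2
      ∂discMeasure) ?_ (lintegral_mono_ae ?_)
    · rw [lintegral_const]
      finiteness
    · filter_upwards [discMeasure_ae_norm_lt] with u hu
      refine pow_le_pow_left' ?_ 2
      rw [← ofReal_norm]
      exact ENNReal.ofReal_le_ofReal (norm_discKernel_le hw3 hu.le)
  have e : ∫⁻ u, ‖wedgeKernel w u‖ₑ ^ 2 ∂sourceMeasure =
      ∫⁻ u, weightedDiscKernel w.1 u.1 ^ 2 * (fun v : ℂ × ℂ => weightedDiscKernel w.2.1 v.1 ^ 2 *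
        ‖discKernel w.2.2 v.2‖ₑ ^ 2) u.2 ∂sourceMeasure := by
    refine lintegral_congr_ae ?_
    filter_upwards [sourceMeasure_ae] with u hu
    rw [enorm_wedgeKernel hw hu, sourceKernel, mul_pow, mul_pow]
  rw [e, sourceMeasure, lintegral_prod_mul (f := fun u => weightedDiscKernel w.1 u ^ 2)
    (g := fun v : ℂ × ℂ => weightedDiscKernel w.2.1 v.1 ^ 2 * ‖discKernel w.2.2 v.2‖ₑ ^ 2)
    (by fun_prop) (by fun_prop)]
  refine ENNReal.mul_ne_top (lintegral_weightedDiscKernel_sq_ne_top hw.1) ?_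
  rw [lintegral_prod_mul (f := fun u => weightedDiscKernel w.2.1 u ^ 2)
    (g := fun u => ‖discKernel w.2.2 u‖ₑ ^ 2) (by fun_prop) (by fun_prop)]
  exact ENNReal.mul_ne_top (lintegral_weightedDiscKernel_sq_ne_top hw.2.1) h3

/-- The domain `wedge`, as an open set. -/
def wedgeOpens : TopologicalSpace.Opens (Fin 3 → ℂ) := ⟨wedge, isOpen_wedge⟩

theorem monomialOpens_wedgeMatrix : monomialOpens wedgeMatrix = wedgeOpens :=
  TopologicalSpace.Opens.ext monomialSet_wedgeMatrix

theorem integral_sourceMeasure (f : ℂ × ℂ × ℂ → ℂ) :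
    ∫ u, f u ∂sourceMeasure =
      ∫ u, ((‖u.1‖ ^ 2 * ‖u.2.1‖ ^ 2 : ℝ) : ℂ) * f u ∂polydiscMeasure := by
  rw [sourceMeasure_eq_withDensity, integral_withDensity_eq_integral_toReal_smul]
  · simp
  · fun_prop
  · exact ae_of_all _ fun u => by finiteness

theorem integral_wedge_eq {f : (Fin 3 → ℂ) → ℂ}
    (hf : AEStronglyMeasurable f (volume.restrict wedge)) :
    ∫ z in wedge, f z = ∫ u, f (wedgeMap u) ∂sourceMeasure := by
  rw [← map_wedgeMap] at hf ⊢
  exact integral_map continuous_wedgeMap.measurable.aemeasurable hf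

theorem lintegral_wedge_eq {f : (Fin 3 → ℂ) → ℝ≥0∞}
    (hf : AEMeasurable f (volume.restrict wedge)) :
    ∫⁻ z in wedge, f z = ∫⁻ u, f (wedgeMap u) ∂sourceMeasure := by
  rw [← map_wedgeMap] at hf ⊢
  exact lintegral_map' hf continuous_wedgeMap.measurable.aemeasurable

/-- Reproducing property of the Bergman kernel of `wedge`. -/
theorem integral_wedgeKernel_mul {g : (Fin 3 → ℂ) → ℂ} (hg : DifferentiableOn ℂ g wedge)
    (hg2 : MemLp g 2 (volume.restrict wedge)) :
    ∀ᵐ w ∂sourceMeasure, ∫ u, wedgeKernel w u * g (wedgeMap u) ∂sourceMeasure =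
      g (wedgeMap w) := by
  classical
  -- The third disc is punctured as well. This costs a null set and lets all three variables be
  -- treated alike.
  set P : Set (ℂ × ℂ × ℂ) := puncturedDisc ×ˢ puncturedDisc ×ˢ puncturedDisc with hP
  have hPo : IsOpen P :=
    isOpen_puncturedDisc.prod (isOpen_puncturedDisc.prod isOpen_puncturedDisc)
  have hPs : P ⊆ wedgeSource := fun u hu => ⟨hu.1, hu.2.1, hu.2.2.1⟩
  -- The factor u₁u₂ is the Jacobian determinant of `wedgeMap`; it makes g ↦ F₀ isometric from L² of
  -- the domain to L² of the polydisc.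
  set F₀ : ℂ × ℂ × ℂ → ℂ := fun u => u.1 * u.2.1 * g (wedgeMap u) with hF₀
  have hd : Differentiable ℂ wedgeMap := by
    rw [differentiable_pi]
    intro i
    fin_cases i <;> simp [wedgeMap] <;> fun_prop
  have hF₀d : DifferentiableOn ℂ F₀ P := by
    have h1 : DifferentiableOn ℂ (fun u => g (wedgeMap u)) P :=
      hg.comp hd.differentiableOn fun u hu => (wedgeMap_mem_iff u).2 (hPs hu)
    have h0 : Differentiable ℂ fun u : ℂ × ℂ × ℂ => u.1 * u.2.1 := by fun_prop
    exact h0.differentiableOn.mul h1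
  set F : ℂ × ℂ × ℂ → ℂ := P.indicator F₀ with hF
  have hFF₀ : ∀ u ∈ P, F u = F₀ u := fun u hu => Set.indicator_of_mem hu _
  have hFm : Measurable F := by
    have := hF₀d.continuousOn.measurable_piecewise (g := fun _ => (0 : ℂ)) continuousOn_const
      hPo.measurableSet
    rw [hF, ← Set.piecewise_eq_indicator]
    exact this
  have hae : ∀ᵐ u ∂polydiscMeasure, u ∈ P := by
    have h4 := (Measure.quasiMeasurePreserving_snd (μ := discMeasure)).ae
      (((Measure.quasiMeasurePreserving_fst (ν := discMeasure)).ae discMeasure_ae).and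
        ((Measure.quasiMeasurePreserving_snd (μ := discMeasure)).ae discMeasure_ae))
    filter_upwards [(Measure.quasiMeasurePreserving_fst
      (ν := discMeasure.prod discMeasure)).ae discMeasure_ae, h4] with w h1 h2
    exact ⟨h1, h2.1, h2.2⟩
  have hF2 : ∫⁻ u, ‖F u‖ₑ ^ 2 ∂polydiscMeasure ≠ ∞ := by
    have h1 : ∫⁻ z in wedge, ‖g z‖ₑ ^ 2 ≠ ∞ := by
      have := hg2.2
      rw [eLpNorm_lt_top_iff_lintegral_rpow_enorm_lt_top (by norm_num) (by norm_num)] at this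
      simpa using this.ne
    rw [lintegral_wedge_eq (hg2.1.enorm.pow_const 2), sourceMeasure_eq_withDensity,
      lintegral_withDensity_eq_lintegral_mul_non_measurable _ (by fun_prop)
        (ae_of_all _ fun u => by finiteness)] at h1
    refine ne_of_eq_of_ne (lintegral_congr_ae ?_) h1
    filter_upwards [hae] with u hu
    rw [hFF₀ u hu, hF₀, enorm_mul, enorm_mul, Pi.mul_apply, mul_pow, mul_pow]
  have hrep := sourceMeasure_absolutelyContinuous.ae_le
    (integral_discKernel_mul_three hFm (hF₀d.congr hFF₀) hF2)
  filter_upwards [hrep, sourceMeasure_absolutelyContinuous.ae_le hae] with w hw hwP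
  rw [integral_sourceMeasure]
  have hw1 := (mem_puncturedDisc.1 hwP.1).2
  have hw2 := (mem_puncturedDisc.1 hwP.2.1).2
  have e : ∫ u, ((‖u.1‖ ^ 2 * ‖u.2.1‖ ^ 2 : ℝ) : ℂ) * (wedgeKernel w u * g (wedgeMap u))
      ∂polydiscMeasure = (w.1 * w.2.1)⁻¹ * ∫ u, discKernel w.1 u.1 * (discKernel w.2.1 u.2.1 *
        (discKernel w.2.2 u.2.2 * F u)) ∂polydiscMeasure := by
    rw [← integral_const_mul]
    refine integral_congr_ae ?_
    filter_upwards [hae] with u hu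
    have hu1 := (mem_puncturedDisc.1 hu.1).2
    have hu2 := (mem_puncturedDisc.1 hu.2.1).2
    have hu1' : (starRingEnd ℂ) u.1 ≠ 0 := by simpa using hu1
    have hu2' : (starRingEnd ℂ) u.2.1 ≠ 0 := by simpa using hu2
    have hn : ∀ x : ℂ, ((‖x‖ : ℝ) : ℂ) ^ 2 = x * (starRingEnd ℂ) x := fun x => by
      rw [Complex.mul_conj, Complex.normSq_eq_norm_sq]
      push_cast
      rfl
    rw [hFF₀ u hu, hF₀, wedgeKernel, map_mul]
    push_cast
    rw [hn, hn]
    field_simp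
  rw [e, hw, hFF₀ w hwP, hF₀]
  field_simp

/-- The Bergman kernel of `wedge` as an antiholomorphic function of the first and a holomorphic
function of the second variable. -/
theorem differentiableOn_conj_wedgeKernel {w : ℂ × ℂ × ℂ} (hw : w ∈ wedgeSource) :
    DifferentiableOn ℂ (fun z => (starRingEnd ℂ) (wedgeKernel w (wedgeInv z))) wedge := by
  have e : (fun z => (starRingEnd ℂ) (wedgeKernel w (wedgeInv z))) = fun z =>
      (Real.pi * (1 - (starRingEnd ℂ) w.1 * (wedgeInv z).1) ^ 2 : ℂ)⁻¹ *
        ((Real.pi * (1 - (starRingEnd ℂ) w.2.1 * (wedgeInv z).2.1) ^ 2 : ℂ)⁻¹ *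
          (Real.pi * (1 - (starRingEnd ℂ) w.2.2 * (wedgeInv z).2.2) ^ 2 : ℂ)⁻¹) /
      ((starRingEnd ℂ) w.1 * (starRingEnd ℂ) w.2.1 * ((wedgeInv z).1 * (wedgeInv z).2.1)) := by
    ext z
    simp only [wedgeKernel, discKernel, map_div₀, map_mul, map_inv₀, map_pow, map_sub, map_one,
      Complex.conj_ofReal, Complex.conj_conj]
  simp only [div_eq_mul_inv] at e
  rw [e]
  have hpi : (Real.pi : ℂ) ≠ 0 := by exact_mod_cast Real.pi_ne_zero
  have hne : ∀ {a u : ℂ}, ‖a‖ < 1 → ‖u‖ < 1 →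
      (Real.pi * (1 - (starRingEnd ℂ) a * u) ^ 2 : ℂ) ≠ 0 := by
    intro a u ha hu
    have h1 := one_sub_mul_conj_ne_zero (u := u) ha hu.le
    rw [← map_ne_zero (starRingEnd ℂ)] at h1
    exact mul_ne_zero hpi (pow_ne_zero 2 (by simpa using h1))
  have hc0 : DifferentiableOn ℂ (fun z : Fin 3 → ℂ => z 0) wedge := by fun_prop
  have hc1 : DifferentiableOn ℂ (fun z : Fin 3 → ℂ => z 1) wedge := by fun_prop
  have hc2 : DifferentiableOn ℂ (fun z : Fin 3 → ℂ => z 2) wedge := by fun_prop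
  have hd1 : DifferentiableOn ℂ (fun z => (wedgeInv z).1) wedge := hc0
  have hd2 : DifferentiableOn ℂ (fun z => (wedgeInv z).2.1) wedge :=
    (hc1.mul (hc0.inv fun z hz => (ne_zero_of_mem_wedge hz).1)).congr fun z _ => div_eq_mul_inv _ _
  have hd3 : DifferentiableOn ℂ (fun z => (wedgeInv z).2.2) wedge :=
    ((hc0.mul hc2).mul (hc1.inv fun z hz => (ne_zero_of_mem_wedge hz).2)).congr
      fun z _ => div_eq_mul_inv _ _
  have hn3 : ∀ {u : ℂ}, u ∈ Metric.ball (0 : ℂ) 1 → ‖u‖ < 1 := by simp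
  refine DifferentiableOn.mul (DifferentiableOn.mul (DifferentiableOn.inv (by fun_prop) ?_)
    (DifferentiableOn.mul (DifferentiableOn.inv (by fun_prop) ?_)
      (DifferentiableOn.inv (by fun_prop) ?_))) (DifferentiableOn.inv (by fun_prop) ?_)
  · exact fun z hz => hne (mem_puncturedDisc.1 hw.1).1 (mem_puncturedDisc.1 (wedgeInv_mem hz).1).1
  · exact fun z hz =>
      hne (mem_puncturedDisc.1 hw.2.1).1 (mem_puncturedDisc.1 (wedgeInv_mem hz).2.1).1
  · exact fun z hz => hne (hn3 hw.2.2) (hn3 (wedgeInv_mem hz).2.2)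
  · intro z hz
    have h1 := (mem_puncturedDisc.1 hw.1).2
    have h2 := (mem_puncturedDisc.1 hw.2.1).2
    have h3 := (mem_puncturedDisc.1 (wedgeInv_mem hz).1).2
    have h4 := (mem_puncturedDisc.1 (wedgeInv_mem hz).2.1).2
    simp [h1, h2, h3, h4]

theorem memLp_conj_wedgeKernel {w : ℂ × ℂ × ℂ} (hw : w ∈ wedgeSource) :
    MemLp (fun z => (starRingEnd ℂ) (wedgeKernel w (wedgeInv z))) 2 (volume.restrict wedge) := by
  have h : MemLp (fun u => (starRingEnd ℂ) (wedgeKernel w u)) 2 sourceMeasure := by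
    have hm : Measurable fun u => (starRingEnd ℂ) (wedgeKernel w u) :=
      Complex.continuous_conj.measurable.comp (measurable_wedgeKernel w)
    refine memLp_two_of_lintegral_sq hm.aestronglyMeasurable ?_
    have hconj : ∀ x : ℂ, ‖(starRingEnd ℂ) x‖ₑ = ‖x‖ₑ := fun x => by
      rw [← ofReal_norm, RCLike.norm_conj, ofReal_norm]
    simp only [hconj]
    exact lintegral_wedgeKernel_sq_ne_top hw
  exact h.comp_measurePreserving measurePreserving_wedgeInv

/-- The Bergman projection of `wedge` is the integral operator given by the Bergman kernel. -/
theorem bergmanProjection_wedge_ae (f : Lp ℂ 2 (volume.restrict (wedgeOpens : Set (Fin 3 → ℂ)))) :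
    ∀ᵐ w ∂sourceMeasure, bergmanProjection wedgeOpens f (wedgeMap w) =
      ∫ u, wedgeKernel w u * f (wedgeMap u) ∂sourceMeasure := by
  set Pf := bergmanProjection wedgeOpens f with hPf
  have hPmem : Pf ∈ bergmanSpace wedgeOpens :=
    (bergmanSpace wedgeOpens).starProjection_apply_mem f
  have horth : f - Pf ∈ (bergmanSpace wedgeOpens)ᗮ :=
    (bergmanSpace wedgeOpens).sub_starProjection_mem_orthogonal f
  obtain ⟨g, hg, hgP⟩ := hPmem
  have hgL : MemLp g 2 (volume.restrict wedge) := (memLp_congr_ae hgP).1 (Lp.memLp Pf)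
  have hgP' : ∀ᵐ w ∂sourceMeasure, Pf (wedgeMap w) = g (wedgeMap w) :=
    measurePreserving_wedgeMap.quasiMeasurePreserving.ae hgP
  filter_upwards [integral_wedgeKernel_mul hg hgL, sourceMeasure_ae, hgP'] with w hw hwS hwg
  rw [hwg, ← hw]
  have hk := memLp_conj_wedgeKernel hwS
  set K : Lp ℂ 2 (volume.restrict (wedgeOpens : Set (Fin 3 → ℂ))) := hk.toLp _ with hK
  have hKmem : K ∈ bergmanSpace wedgeOpens :=
    ⟨_, differentiableOn_conj_wedgeKernel hwS, hk.coeFn_toLp⟩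
  -- K is the conjugate of the kernel at w and lies in the Bergman space, to which f - Pf is
  -- orthogonal. So integrating the kernel against f or against Pf gives the same, and the latter
  -- reproduces Pf(w).
  have hinner : inner ℂ K Pf = inner ℂ K f := by
    have := horth K hKmem
    rw [inner_sub_right, sub_eq_zero] at this
    exact this.symm
  have hrepr : ∀ h : Lp ℂ 2 (volume.restrict (wedgeOpens : Set (Fin 3 → ℂ))),
      inner ℂ K h = ∫ u, wedgeKernel w u * h (wedgeMap u) ∂sourceMeasure := by
    intro h
    have hKae : ∀ᵐ z ∂volume.restrict wedge,
        K z = (starRingEnd ℂ) (wedgeKernel w (wedgeInv z)) := hk.coeFn_toLp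
    have e1 : inner ℂ K h = ∫ z in wedge, wedgeKernel w (wedgeInv z) * h z := by
      rw [L2.inner_def]
      refine integral_congr_ae ?_
      filter_upwards [hKae] with z hz
      rw [hz, RCLike.inner_apply, Complex.conj_conj, mul_comm]
    rw [e1, integral_wedge_eq]
    · refine integral_congr_ae ?_
      filter_upwards [sourceMeasure_ae] with u hu
      rw [wedgeInv_wedgeMap hu]
    · exact (((measurable_wedgeKernel w).comp measurable_wedgeInv).aestronglyMeasurable).mul
        (Lp.aestronglyMeasurable h)
  rw [← hrepr f, ← hinner, hrepr Pf]
  refine integral_congr_ae ?_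
  filter_upwards [hgP'] with u hu
  rw [hu]

/-! ### Boundedness inside the interval. -/

/-- The Bergman projection of `wedge` is bounded in `L^p` for `4/3 < p < 4`. -/
theorem isStrongType_wedge {p : ℝ≥0∞} (hp : ENNReal.ofReal (4 / 3) < p)
    (hp4 : p < ENNReal.ofReal 4) : IsStrongType (bergmanProjection wedgeOpens) p := by
  have hpt : p ≠ ∞ := hp4.ne_top
  lift p to NNReal using hpt
  have hp' : (4 / 3 : ℝ) < p := by
    rw [← ENNReal.ofReal_coe_nnreal, ENNReal.ofReal_lt_ofReal_iff_of_nonneg (by norm_num)] at hp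
    exact hp
  have hp4' : (p : ℝ) < 4 := by
    rw [← ENNReal.ofReal_coe_nnreal, ENNReal.ofReal_lt_ofReal_iff (by norm_num)] at hp4
    exact hp4
  have hp0 : 0 < (p : ℝ) := by linarith
  have hpE0 : (p : ℝ≥0∞) ≠ 0 := by
    rw [ENNReal.coe_ne_zero]
    exact_mod_cast hp0.ne'
  obtain ⟨C, hC, h⟩ := exists_lintegral_sourceKernel_le hp' hp4'
  -- The summand 1 only serves to make the constant positive.
  refine ⟨(C ^ (1 / (p : ℝ))).toReal + 1, by positivity, fun f hf => ?_⟩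
  set Pf := bergmanProjection wedgeOpens f with hPf
  set f₀ := (Lp.aestronglyMeasurable f).mk f with hf₀
  have hf₀m : Measurable f₀ := (Lp.aestronglyMeasurable f).stronglyMeasurable_mk.measurable
  have hff₀ : ∀ᵐ z ∂volume.restrict wedge, f z = f₀ z := (Lp.aestronglyMeasurable f).ae_eq_mk
  have hff₀' : ∀ᵐ w ∂sourceMeasure, f (wedgeMap w) = f₀ (wedgeMap w) :=
    measurePreserving_wedgeMap.quasiMeasurePreserving.ae hff₀
  have hbound : ∫⁻ z in wedge, ‖Pf z‖ₑ ^ (p : ℝ) ≤ C * ∫⁻ z in wedge, ‖f z‖ₑ ^ (p : ℝ) := by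
    rw [lintegral_wedge_eq ((Lp.aestronglyMeasurable Pf).enorm.pow_const _),
      lintegral_wedge_eq ((Lp.aestronglyMeasurable f).enorm.pow_const _)]
    have e : ∫⁻ u, ‖f (wedgeMap u)‖ₑ ^ (p : ℝ) ∂sourceMeasure =
        ∫⁻ u, ‖f₀ (wedgeMap u)‖ₑ ^ (p : ℝ) ∂sourceMeasure :=
      lintegral_congr_ae (hff₀'.mono fun u hu => by simp only [hu])
    rw [e]
    refine le_trans (lintegral_mono_ae ?_) (h (fun u => ‖f₀ (wedgeMap u)‖ₑ)
      (hf₀m.comp continuous_wedgeMap.measurable).enorm)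
    filter_upwards [bergmanProjection_wedge_ae f, sourceMeasure_ae] with w hw hwS
    refine ENNReal.rpow_le_rpow ?_ hp0.le
    rw [hPf, hw]
    refine (enorm_integral_le_lintegral_enorm _).trans (le_of_eq (lintegral_congr_ae ?_))
    filter_upwards [sourceMeasure_ae, hff₀'] with u hu huf
    rw [enorm_mul, enorm_wedgeKernel hwS hu, huf]
  rw [eLpNorm_eq_lintegral_rpow_enorm_toReal hpE0 ENNReal.coe_ne_top,
    eLpNorm_eq_lintegral_rpow_enorm_toReal hpE0 ENNReal.coe_ne_top, ENNReal.coe_toReal]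
  calc _ ≤ (C * ∫⁻ z in wedge, ‖f z‖ₑ ^ (p : ℝ)) ^ (1 / (p : ℝ)) :=
        ENNReal.rpow_le_rpow hbound (by positivity)
    _ = C ^ (1 / (p : ℝ)) * (∫⁻ z in wedge, ‖f z‖ₑ ^ (p : ℝ)) ^ (1 / (p : ℝ)) :=
        ENNReal.mul_rpow_of_nonneg _ _ (by positivity)
    _ ≤ _ := by
        refine mul_le_mul_left ?_ _
        rw [ENNReal.le_ofReal_iff_toReal_le (ENNReal.rpow_ne_top_of_nonneg (by positivity) hC)
          (by positivity)]
        linarith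

/-! ### The projection of conj z₂. -/

theorem memLp_conj_coord : MemLp (fun z : Fin 3 → ℂ => (starRingEnd ℂ) (z 1)) ∞
    (volume.restrict wedge) := by
  have hm : Measurable fun z : Fin 3 → ℂ => (starRingEnd ℂ) (z 1) :=
    Complex.continuous_conj.measurable.comp (measurable_pi_apply 1)
  refine memLp_top_of_bound hm.aestronglyMeasurable 1 ?_
  filter_upwards [ae_restrict_mem measurableSet_wedge] with z hz
  rw [RCLike.norm_conj]
  exact (hz.2.1.trans hz.2.2).le

/-- The function `conj z₂` on `wedge`. -/
noncomputable def conjCoord : Lp ℂ 2 (volume.restrict (wedgeOpens : Set (Fin 3 → ℂ))) :=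
  (memLp_conj_coord.mono_exponent le_top).toLp _

theorem conjCoord_ae : ∀ᵐ z ∂volume.restrict wedge, conjCoord z = (starRingEnd ℂ) (z 1) :=
  (memLp_conj_coord.mono_exponent le_top).coeFn_toLp

/-- In monomial coordinates conj z₂ is conj(u₁u₂), which cancels the antiholomorphic denominator of
the kernel. The integral splits into two copies of `integral_discKernel_mul_norm_sq` and one of
`integral_discKernel`, that is 1/2 · 1/2 · 1, over w₁w₂ = z₂. -/
theorem bergmanProjection_conjCoord : ∀ᵐ z ∂volume.restrict wedge,
    bergmanProjection wedgeOpens conjCoord z = 1 / 4 * (z 1)⁻¹ := by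
  have hc : ∀ᵐ w ∂sourceMeasure, conjCoord (wedgeMap w) = (starRingEnd ℂ) (w.1 * w.2.1) :=
    measurePreserving_wedgeMap.quasiMeasurePreserving.ae conjCoord_ae
  -- `integral_discKernel` is stated off the origin, so the null set w₃ = 0 is discarded.
  have h3 : ∀ᵐ w ∂sourceMeasure, w.2.2 ∈ puncturedDisc :=
    sourceMeasure_absolutelyContinuous.ae_le
      ((Measure.quasiMeasurePreserving_snd (μ := discMeasure)).ae
        ((Measure.quasiMeasurePreserving_snd (μ := discMeasure)).ae discMeasure_ae))
  have hae : ∀ᵐ u ∂polydiscMeasure, u.1 ≠ 0 ∧ u.2.1 ≠ 0 := by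
    filter_upwards [(Measure.quasiMeasurePreserving_fst
        (ν := discMeasure.prod discMeasure)).ae discMeasure_ae,
      (Measure.quasiMeasurePreserving_snd (μ := discMeasure)).ae
        ((Measure.quasiMeasurePreserving_fst (ν := discMeasure)).ae discMeasure_ae)] with u h1 h2
    exact ⟨(mem_puncturedDisc.1 h1).2, (mem_puncturedDisc.1 h2).2⟩
  have key : ∀ᵐ w ∂sourceMeasure, bergmanProjection wedgeOpens conjCoord (wedgeMap w) =
      1 / 4 * (w.1 * w.2.1)⁻¹ := by
    filter_upwards [bergmanProjection_wedge_ae conjCoord, sourceMeasure_ae, h3] with w hw hwS hw3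
    have e1 : ∫ u, wedgeKernel w u * conjCoord (wedgeMap u) ∂sourceMeasure =
        ∫ u, wedgeKernel w u * (starRingEnd ℂ) (u.1 * u.2.1) ∂sourceMeasure :=
      integral_congr_ae (hc.mono fun u hu => by simp only [hu])
    have e2 : ∫ u, ((‖u.1‖ ^ 2 * ‖u.2.1‖ ^ 2 : ℝ) : ℂ) *
        (wedgeKernel w u * (starRingEnd ℂ) (u.1 * u.2.1)) ∂polydiscMeasure =
        (w.1 * w.2.1)⁻¹ * ∫ u, (discKernel w.1 u.1 * (‖u.1‖ ^ 2 : ℝ)) *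
          (fun v : ℂ × ℂ => (discKernel w.2.1 v.1 * (‖v.1‖ ^ 2 : ℝ)) * discKernel w.2.2 v.2) u.2
            ∂polydiscMeasure := by
      rw [← integral_const_mul]
      refine integral_congr_ae ?_
      filter_upwards [hae] with u hu
      have hu1 : (starRingEnd ℂ) u.1 ≠ 0 := by simpa using hu.1
      have hu2 : (starRingEnd ℂ) u.2.1 ≠ 0 := by simpa using hu.2
      have hw1 := (mem_puncturedDisc.1 hwS.1).2
      have hw2 := (mem_puncturedDisc.1 hwS.2.1).2
      rw [wedgeKernel, map_mul]
      push_cast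
      field_simp
    rw [hw, e1, integral_sourceMeasure, e2, polydiscMeasure,
      integral_prod_mul (fun u => discKernel w.1 u * (‖u‖ ^ 2 : ℝ))
        (fun v : ℂ × ℂ => (discKernel w.2.1 v.1 * (‖v.1‖ ^ 2 : ℝ)) * discKernel w.2.2 v.2),
      integral_prod_mul (fun u => discKernel w.2.1 u * (‖u‖ ^ 2 : ℝ)) (discKernel w.2.2),
      integral_discKernel_mul_norm_sq (mem_puncturedDisc.1 hwS.1).1,
      integral_discKernel_mul_norm_sq (mem_puncturedDisc.1 hwS.2.1).1, integral_discKernel hw3]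
    ring
  filter_upwards [measurePreserving_wedgeInv.quasiMeasurePreserving.ae key,
    ae_restrict_mem measurableSet_wedge] with z hz hzW
  have h := wedgeMap_wedgeInv hzW
  rw [h] at hz
  rw [hz, ← wedgeMap_one, h]

/-! ### The volume of the domain near z₂ = 0. -/

/-- A truncated sector in the plane. -/
def sector (ε : ℝ) : Set ℂ := {ζ | ε / 2 < ‖ζ‖ ∧ ‖ζ‖ < ε ∧ ‖ζ‖ / 2 < ζ.re}

theorem isOpen_sector (ε : ℝ) : IsOpen (sector ε) := by
  have h : sector ε = {ζ : ℂ | ε / 2 < ‖ζ‖} ∩ ({ζ : ℂ | ‖ζ‖ < ε} ∩ {ζ : ℂ | ‖ζ‖ / 2 < ζ.re}) := by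
    ext ζ
    simp [sector]
  rw [h]
  exact (isOpen_lt (by fun_prop) (by fun_prop)).inter ((isOpen_lt (by fun_prop) (by fun_prop)).inter
    (isOpen_lt (by fun_prop) Complex.continuous_re))

open scoped Pointwise in
theorem volume_sector {ε : ℝ} (hε : 0 < ε) :
    volume (sector ε) = ENNReal.ofReal (ε ^ 2) * volume (sector 1) := by
  have h : sector ε = ε • sector 1 := by
    ext ζ
    rw [Set.mem_smul_set_iff_inv_smul_mem₀ hε.ne']
    simp only [sector, Set.mem_ofPred_eq, norm_smul, norm_inv, Real.norm_of_nonneg hε.le,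
      Complex.smul_re, smul_eq_mul]
    rw [lt_inv_mul_iff₀ hε, inv_mul_lt_iff₀ hε, mul_div_assoc, mul_lt_mul_iff_right₀
      (inv_pos.2 hε), mul_one, mul_one_div]
  rw [h, Measure.addHaar_smul, Complex.finrank_real_complex, abs_of_nonneg (by positivity)]

theorem volume_sector_one_pos : 0 < volume (sector 1) := by
  refine (isOpen_sector 1).measure_pos volume ⟨((3 / 4 : ℝ) : ℂ), ?_⟩
  simp only [sector, Set.mem_ofPred_eq, Complex.norm_real, Complex.ofReal_re]
  norm_num

/-- The part of `wedge` where `z₂` lies in a truncated sector. -/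
def sectorPart (ε : ℝ) : Set (Fin 3 → ℂ) := {z | z ∈ wedge ∧ z 1 ∈ sector ε}

theorem measurableSet_sectorPart (ε : ℝ) : MeasurableSet (sectorPart ε) :=
  measurableSet_wedge.inter ((isOpen_sector ε).measurableSet.preimage (measurable_pi_apply 1))

theorem sectorPart_subset (ε : ℝ) : sectorPart ε ⊆ wedge := fun _ hz => hz.1

/-- In polar coordinates the integrand becomes 2π/r, the source of the logarithm. -/
theorem le_lintegral_annulus {ε : ℝ} (hε : 0 < ε) (hε1 : ε < 1) :
    ENNReal.ofReal (2 * Real.pi * Real.log ε⁻¹) ≤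
      ∫⁻ a in {a : ℂ | ε < ‖a‖ ∧ ‖a‖ < 1}, ENNReal.ofReal (‖a‖ ^ 2)⁻¹ := by
  have hset : {a : ℂ | ε < ‖a‖ ∧ ‖a‖ < 1} = {a : ℂ | ε < ‖a‖} ∩ Metric.ball 0 1 := by
    ext a
    simp
  have hms : MeasurableSet {a : ℂ | ε < ‖a‖} := measurableSet_lt (by fun_prop) (by fun_prop)
  rw [hset, ← Measure.restrict_restrict hms, ← discMeasure, ← lintegral_indicator hms,
    lintegral_discMeasure_polar (Measurable.indicator (by fun_prop) hms)]
  have hlog : ∫ r in ε..1, 2 * Real.pi * r⁻¹ = 2 * Real.pi * Real.log ε⁻¹ := by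
    rw [intervalIntegral.integral_const_mul, integral_inv_of_pos hε one_pos, one_div]
  have hcont : ContinuousOn (fun r : ℝ => 2 * Real.pi * r⁻¹) (Set.uIcc ε 1) := by
    refine continuousOn_const.mul (continuousOn_id.inv₀ fun r hr => ?_)
    rw [Set.uIcc_of_le hε1.le] at hr
    exact (hε.trans_le hr.1).ne'
  rw [← hlog, intervalIntegral.integral_of_le hε1.le, integral_Ioc_eq_integral_Ioo,
    ofReal_integral_eq_lintegral_ofReal
      ((hcont.intervalIntegrable.1).mono_set Set.Ioo_subset_Ioc_self)]
  · refine le_trans ?_ (lintegral_mono_set (Set.Ioo_subset_Ioo_left hε.le))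
    refine setLIntegral_mono' measurableSet_Ioo fun r hr => ?_
    have hr0 := hε.trans hr.1
    have e : ∀ θ, {a : ℂ | ε < ‖a‖}.indicator (fun a => ENNReal.ofReal (‖a‖ ^ 2)⁻¹)
        (circleMap 0 r θ) = ENNReal.ofReal (r ^ 2)⁻¹ := by
      intro θ
      have hn : ‖circleMap 0 r θ‖ = r := by simp [abs_of_pos hr0]
      rw [Set.indicator_of_mem (by rw [Set.mem_ofPred_eq, hn]; exact hr.1), hn]
    simp only [e]
    rw [setLIntegral_const, Real.volume_Ioo, ← ENNReal.ofReal_mul (by positivity),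
      ← ENNReal.ofReal_mul (by positivity)]
    refine ENNReal.ofReal_le_ofReal (le_of_eq ?_)
    field_simp
    ring
  · rw [EventuallyLE, ae_restrict_iff' measurableSet_Ioo]
    refine ae_of_all _ fun r hr => ?_
    have := hε.trans hr.1
    have := Real.pi_pos
    simp only [Pi.zero_apply]
    positivity

/-- For ε < |a| < 1 and b in the sector, the slice in z₃ is the disc of radius |b|/|a|, of area at
least π ε²/(4|a|²) because |b| > ε/2. The sector contributes ε², and integrating |a|⁻² gives 2π
log(1/ε). -/
theorem le_volume_sectorPart {ε : ℝ} (hε : 0 < ε) (hε1 : ε < 1) :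
    volume (sector 1) * ENNReal.ofReal (Real.pi ^ 2 / 2 * Real.log ε⁻¹) * ENNReal.ofReal ε ^ 4 ≤
      volume (sectorPart ε) := by
  rw [← lintegral_indicator_one (measurableSet_sectorPart ε), lintegral_fin_three _
    (measurable_one.indicator (measurableSet_sectorPart ε))]
  have hms : MeasurableSet {a : ℂ | ε < ‖a‖ ∧ ‖a‖ < 1} := by measurability
  have hpi := Real.pi_pos
  calc volume (sector 1) * ENNReal.ofReal (Real.pi ^ 2 / 2 * Real.log ε⁻¹) * ENNReal.ofReal ε ^ 4
      = ENNReal.ofReal (ε ^ 2 / 4 * Real.pi) * volume (sector ε) *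
          ENNReal.ofReal (2 * Real.pi * Real.log ε⁻¹) := by
        have hl : 0 ≤ Real.log ε⁻¹ := Real.log_nonneg (by rw [one_le_inv₀ hε]; exact hε1.le)
        rw [volume_sector hε, mul_assoc, ← ENNReal.ofReal_pow hε.le,
          ← ENNReal.ofReal_mul (by positivity), ← mul_assoc (ENNReal.ofReal _) (ENNReal.ofReal _),
          ← ENNReal.ofReal_mul (by positivity), mul_right_comm (ENNReal.ofReal _),
          ← ENNReal.ofReal_mul (by positivity), mul_comm]
        congr 2
        ring
    _ ≤ ENNReal.ofReal (ε ^ 2 / 4 * Real.pi) * volume (sector ε) *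
          ∫⁻ a in {a : ℂ | ε < ‖a‖ ∧ ‖a‖ < 1}, ENNReal.ofReal (‖a‖ ^ 2)⁻¹ :=
        mul_le_mul_right (le_lintegral_annulus hε hε1) _
    _ = ∫⁻ a in {a : ℂ | ε < ‖a‖ ∧ ‖a‖ < 1}, ∫⁻ _ in sector ε,
          ENNReal.ofReal (ε ^ 2 / 4 * Real.pi) * ENNReal.ofReal (‖a‖ ^ 2)⁻¹ := by
        simp only [setLIntegral_const]
        rw [← lintegral_const_mul _ (by fun_prop)]
        congr 1 with a
        ring
    _ ≤ ∫⁻ a in {a : ℂ | ε < ‖a‖ ∧ ‖a‖ < 1}, ∫⁻ b in sector ε, ∫⁻ c,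
          (sectorPart ε).indicator 1 ![a, b, c] := by
        refine setLIntegral_mono' hms fun a ha =>
          setLIntegral_mono' (isOpen_sector ε).measurableSet fun b hb => ?_
        have ha0 : 0 < ‖a‖ := hε.trans ha.1
        have hb0 : 0 < ‖b‖ := (half_pos hε).trans hb.1
        have hmem : ∀ c ∈ Metric.ball (0 : ℂ) (‖b‖ / ‖a‖), ![a, b, c] ∈ sectorPart ε := by
          intro c hc
          rw [mem_ball_zero_iff, lt_div_iff₀ ha0] at hc
          refine ⟨⟨?_, hb.2.1.trans ha.1, ha.2⟩, hb⟩
          simpa [mul_comm] using hc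
        calc ENNReal.ofReal (ε ^ 2 / 4 * Real.pi) * ENNReal.ofReal (‖a‖ ^ 2)⁻¹
            ≤ volume (Metric.ball (0 : ℂ) (‖b‖ / ‖a‖)) := by
              rw [Complex.volume_ball, ← ENNReal.ofReal_mul (by positivity),
                ← ENNReal.ofReal_pow (by positivity), ← ENNReal.ofReal_coe_nnreal, NNReal.coe_real_pi,
                ← ENNReal.ofReal_mul (by positivity)]
              refine ENNReal.ofReal_le_ofReal ?_
              have : (ε / 2) ^ 2 ≤ ‖b‖ ^ 2 := pow_le_pow_left₀ (by positivity) hb.1.le 2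
              rw [div_pow]
              calc ε ^ 2 / 4 * Real.pi * (‖a‖ ^ 2)⁻¹ = (ε / 2) ^ 2 / ‖a‖ ^ 2 * Real.pi := by ring
                _ ≤ _ := by gcongr
          _ = ∫⁻ c, (Metric.ball (0 : ℂ) (‖b‖ / ‖a‖)).indicator 1 c := by
              rw [lintegral_indicator_one Metric.isOpen_ball.measurableSet]
          _ ≤ _ := by
              refine lintegral_mono fun c => ?_
              by_cases hc : c ∈ Metric.ball (0 : ℂ) (‖b‖ / ‖a‖)
              · rw [Set.indicator_of_mem hc, Set.indicator_of_mem (hmem c hc)]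
                rfl
              · rw [Set.indicator_of_notMem hc]
                exact zero_le
    _ ≤ _ := by
        refine (setLIntegral_le_lintegral _ _).trans (lintegral_mono fun a => ?_)
        exact setLIntegral_le_lintegral _ _

/-- The volume of `sectorPart ε` is not `O(ε⁴)`. -/
theorem exists_lt_volume_sectorPart {C : ℝ≥0∞} (hC : C ≠ ∞) :
    ∃ ε : ℝ, 0 < ε ∧ ε < 1 ∧ C * ENNReal.ofReal ε ^ 4 < volume.restrict wedge (sectorPart ε) := by
  have hpi := Real.pi_pos
  have hV0 := volume_sector_one_pos
  have hD : C / volume (sector 1) ≠ ∞ := ENNReal.div_ne_top hC hV0.ne'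
  -- With ε = exp(-N), the factor (π²/2) log(1/ε) equals C/|sector 1| + 1.
  set N : ℝ := ((C / volume (sector 1)).toReal + 1) / (Real.pi ^ 2 / 2) with hN
  have hN0 : 0 < N := by positivity
  refine ⟨Real.exp (-N), Real.exp_pos _, Real.exp_lt_one_iff.2 (by linarith), ?_⟩
  rw [Measure.restrict_eq_self _ (sectorPart_subset _)]
  refine lt_of_lt_of_le ?_ (le_volume_sectorPart (Real.exp_pos _)
    (Real.exp_lt_one_iff.2 (by linarith)))
  have hε0 : ENNReal.ofReal (Real.exp (-N)) ^ 4 ≠ 0 := by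
    simp [Real.exp_pos]
  rw [ENNReal.mul_lt_mul_iff_left hε0 (by finiteness), Real.exp_neg, inv_inv, Real.log_exp, hN,
    mul_div_cancel₀ _ (by positivity), mul_comm]
  refine ENNReal.div_lt_iff (Or.inl hV0.ne') ?_ |>.1 ?_
  · left
    refine ne_top_of_le_ne_top (measure_ball_lt_top (x := (0 : ℂ)) (r := 1)).ne
      (measure_mono (μ := volume) fun ζ hζ => ?_)
    simpa using hζ.2.1
  · rw [ENNReal.lt_ofReal_iff_toReal_lt hD]
    linarith

/-! ### Failure at and above the upper endpoint. -/

/-- A bound `O(ε⁴)` for the distribution function of `P (conj z₂) = 1 / (4 z₂)` is impossible. -/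
theorem not_meas_bergmanProjection_conjCoord_le {C : ℝ≥0∞} (hC : C ≠ ∞) :
    ¬ ∀ ε : ℝ, 0 < ε → volume.restrict wedge
      {z | (4 * ε)⁻¹ < ‖bergmanProjection wedgeOpens conjCoord z‖} ≤
        C * ENNReal.ofReal ε ^ 4 := by
  intro h
  obtain ⟨ε, hε, -, hlt⟩ := exists_lt_volume_sectorPart hC
  refine absurd (hlt.trans_le ((measure_mono_ae ?_).trans (h ε hε))) (lt_irrefl _)
  filter_upwards [bergmanProjection_conjCoord] with z hz hzE
  have hzE : z ∈ sectorPart ε := hzE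
  have h0 : 0 < ‖z 1‖ := (half_pos hε).trans hzE.2.1
  change (4 * ε)⁻¹ < ‖bergmanProjection wedgeOpens conjCoord z‖
  rw [hz, norm_mul, norm_inv, mul_inv]
  have h1 : ε⁻¹ < ‖z 1‖⁻¹ := (inv_lt_inv₀ hε h0).2 hzE.2.2.1
  norm_num
  linarith

theorem memLp_conjCoord (p : ℝ≥0∞) : MemLp conjCoord p (volume.restrict wedge) :=
  (memLp_congr_ae conjCoord_ae).2 (memLp_conj_coord.mono_exponent le_top)

/-- The test function conj z₂ is bounded, so its L⁴ norm is a fixed constant. The weak type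
inequality at level 1/(4ε) would then be the excluded bound by ε⁴. -/
theorem not_isWeakType_wedge : ¬ IsWeakType (bergmanProjection wedgeOpens) 4 := by
  rintro ⟨C, hC, h⟩
  have hN : eLpNorm conjCoord (ENNReal.ofReal 4) (volume.restrict wedge) ≠ ∞ :=
    (memLp_conjCoord _).2.ne
  refine not_meas_bergmanProjection_conjCoord_le (C := (ENNReal.ofReal (C * 4) *
    eLpNorm conjCoord (ENNReal.ofReal 4) (volume.restrict wedge)) ^ 4) (by finiteness) ?_
  intro ε hε
  have hw : volume.restrict wedge {z | (4 * ε)⁻¹ < ‖bergmanProjection wedgeOpens conjCoord z‖} ≤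
      (ENNReal.ofReal (C / (4 * ε)⁻¹) *
        eLpNorm conjCoord (ENNReal.ofReal 4) (volume.restrict wedge)) ^ (4 : ℝ) :=
    h conjCoord (memLp_conjCoord _) (4 * ε)⁻¹ (by positivity)
  refine hw.trans (le_of_eq ?_)
  rw [show (4 : ℝ) = ((4 : ℕ) : ℝ) by norm_num, ENNReal.rpow_natCast, ← mul_pow]
  congr 1
  rw [div_inv_eq_mul, ← mul_assoc, ENNReal.ofReal_mul (by positivity)]
  push_cast
  ring

/-- The domain has finite measure, so L^p is contained in L⁴, also for p = ∞. Chebyshev's inequality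
for 1/(4 z₂) would give the excluded bound. -/
theorem not_isStrongType_wedge_of_four_le {p : ℝ≥0∞} (hp : 4 ≤ p) :
    ¬ IsStrongType (bergmanProjection wedgeOpens) p := by
  rintro ⟨C, hC, h⟩
  set Pg := bergmanProjection wedgeOpens conjCoord with hPg
  have hm : AEStronglyMeasurable Pg (volume.restrict wedge) := Lp.aestronglyMeasurable Pg
  have hLp : MemLp Pg p (volume.restrict wedge) :=
    ⟨hm, (h conjCoord (memLp_conjCoord p)).trans_lt
      (ENNReal.mul_lt_top ENNReal.ofReal_lt_top (memLp_conjCoord p).2)⟩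
  have hL4 : MemLp Pg 4 (volume.restrict wedge) := hLp.mono_exponent hp
  have hN := hL4.2.ne
  refine not_meas_bergmanProjection_conjCoord_le
    (C := (4 * eLpNorm Pg 4 (volume.restrict wedge)) ^ 4) (by finiteness) ?_
  intro ε hε
  have hcheb := meas_ge_le_mul_pow_eLpNorm_enorm (volume.restrict wedge) (p := 4) (by norm_num)
    (by norm_num) hm (ε := ENNReal.ofReal (4 * ε)⁻¹) (by simpa using hε) (by simp)
  refine (measure_mono fun z hz => ?_).trans (hcheb.trans (le_of_eq ?_))
  · have hz : (4 * ε)⁻¹ < ‖Pg z‖ := hz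
    change ENNReal.ofReal (4 * ε)⁻¹ ≤ ‖Pg z‖ₑ
    rw [← ofReal_norm]
    exact ENNReal.ofReal_le_ofReal hz.le
  · rw [show (4 : ℝ≥0∞).toReal = ((4 : ℕ) : ℝ) by norm_num, ENNReal.rpow_natCast,
      ENNReal.rpow_natCast, ← mul_pow, ← mul_pow, ENNReal.ofReal_inv_of_pos (by positivity),
      inv_inv, ENNReal.ofReal_mul (by norm_num)]
    congr 1
    rw [ENNReal.ofReal_ofNat]
    ring

/-! ### Failure at and below the lower endpoint. -/

/-- The Bergman projection of an indicator function is not controlled in `L¹` by the norm of the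
indicator function in `L^{4/3}`. -/
theorem not_lintegral_bergmanProjection_indicator_le {D : ℝ≥0∞} (hD : D ≠ ∞) :
    ¬ ∀ (E : Set (Fin 3 → ℂ)) (hE : MeasurableSet E)
      (hμE : volume.restrict (wedgeOpens : Set (Fin 3 → ℂ)) E ≠ ∞),
      ∫⁻ z in wedge, ‖bergmanProjection wedgeOpens (indicatorConstLp 2 hE hμE (1 : ℂ)) z‖ₑ ≤
        D * volume.restrict wedge E ^ (3 / 4 : ℝ) := by
  intro h
  obtain ⟨ε, hε, hε1, hlt⟩ := exists_lt_volume_sectorPart (C := (8 * D) ^ 4) (by finiteness)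
  set μ := volume.restrict wedge with hμ
  set E := sectorPart ε with hEdef
  have hE : MeasurableSet E := measurableSet_sectorPart ε
  have hμE : μ E ≠ ∞ := measure_ne_top μ E
  set e : Lp ℂ 2 (volume.restrict (wedgeOpens : Set (Fin 3 → ℂ))) :=
    indicatorConstLp 2 hE hμE (1 : ℂ) with he
  -- Pairing with conj z₂ is bounded by the L¹ norm, since |z₂| ≤ 1 on the domain.
  have hupper : ‖inner ℂ (bergmanProjection wedgeOpens e) conjCoord‖ₑ ≤
      D * μ E ^ (3 / 4 : ℝ) := by
    refine le_trans ?_ (h E hE hμE)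
    rw [L2.inner_def]
    refine (enorm_integral_le_lintegral_enorm _).trans (lintegral_mono_ae ?_)
    filter_upwards [conjCoord_ae, ae_restrict_mem measurableSet_wedge] with z hz hzW
    have h1 : ‖z 1‖ₑ ≤ 1 := by
      rw [← ofReal_norm, ENNReal.ofReal_le_one]
      exact (hzW.2.1.trans hzW.2.2).le
    rw [RCLike.inner_apply, enorm_mul, hz]
    have hconj : ∀ x : ℂ, ‖(starRingEnd ℂ) x‖ₑ = ‖x‖ₑ := fun x => by
      rw [← ofReal_norm, RCLike.norm_conj, ofReal_norm]
    rw [hconj, hconj]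
    exact mul_le_of_le_one_left' h1
  have hinner : inner ℂ (bergmanProjection wedgeOpens e) conjCoord =
      ∫ z in E, (bergmanProjection wedgeOpens conjCoord) z ∂μ :=
    ((bergmanSpace wedgeOpens).inner_starProjection_left_eq_right _ _).trans
      (L2.inner_indicatorConstLp_one hE hμE _)
  have hint : IntegrableOn (bergmanProjection wedgeOpens conjCoord) E μ := by
    have hL : MemLp (bergmanProjection wedgeOpens conjCoord) 2 μ := Lp.memLp _
    exact (hL.integrable (by norm_num)).integrableOn
  -- On the sector Re(1/z₂) = Re z₂/|z₂|² exceeds 1/(2|z₂|), hence 1/(2ε); with the factor 1/4 this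
  -- is 1/(8ε).
  have hre : μ.real E * (8 * ε)⁻¹ ≤ ‖inner ℂ (bergmanProjection wedgeOpens e) conjCoord‖ := by
    rw [hinner]
    refine le_trans ?_ (RCLike.re_le_norm _)
    rw [← integral_re hint]
    calc μ.real E * (8 * ε)⁻¹ = ∫ _ in E, (8 * ε)⁻¹ ∂μ := by rw [setIntegral_const, smul_eq_mul]
      _ ≤ _ := by
        refine setIntegral_mono_on_ae (integrableOn_const hμE) hint.re hE ?_
        filter_upwards [bergmanProjection_conjCoord] with z hz hzE
        have h0 : 0 < ‖z 1‖ := (half_pos hε).trans hzE.2.1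
        have h2 : ‖z 1‖ / 2 < (z 1).re := hzE.2.2.2
        have h3 : ‖z 1‖ < ε := hzE.2.2.1
        have e1 : RCLike.re (bergmanProjection wedgeOpens conjCoord z) =
            1 / 4 * ((z 1).re / ‖z 1‖ ^ 2) := by
          rw [hz, show (1 / 4 : ℂ) = ((1 / 4 : ℝ) : ℂ) by norm_num]
          change (((1 / 4 : ℝ) : ℂ) * (z 1)⁻¹).re = _
          rw [Complex.re_ofReal_mul, Complex.inv_re, Complex.normSq_eq_norm_sq]
        rw [e1]
        calc (8 * ε)⁻¹ ≤ (8 * ‖z 1‖)⁻¹ := by gcongr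
          _ = 1 / 4 * (‖z 1‖ / 2 / ‖z 1‖ ^ 2) := by
            field_simp
            norm_num
          _ ≤ _ := by gcongr
  -- Cancelling |E|^(3/4) and taking fourth powers yields |E| ≤ (8Dε)⁴, against the choice of ε.
  have hmul : μ E ≤ 8 * D * ENNReal.ofReal ε * μ E ^ (3 / 4 : ℝ) := by
    have h1 : μ E * ENNReal.ofReal (8 * ε)⁻¹ ≤ D * μ E ^ (3 / 4 : ℝ) := by
      refine le_trans ?_ hupper
      rw [← ofReal_norm, ← ofReal_measureReal hμE, ← ENNReal.ofReal_mul (by positivity)]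
      exact ENNReal.ofReal_le_ofReal hre
    have h2 : ENNReal.ofReal (8 * ε) * ENNReal.ofReal (8 * ε)⁻¹ = 1 := by
      rw [← ENNReal.ofReal_mul (by positivity), mul_inv_cancel₀ (by positivity),
        ENNReal.ofReal_one]
    calc μ E = ENNReal.ofReal (8 * ε) * (μ E * ENNReal.ofReal (8 * ε)⁻¹) := by
          rw [mul_left_comm, h2, mul_one]
      _ ≤ ENNReal.ofReal (8 * ε) * (D * μ E ^ (3 / 4 : ℝ)) := mul_le_mul_right h1 _
      _ = _ := by
          rw [ENNReal.ofReal_mul (by norm_num), ENNReal.ofReal_ofNat]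
          ring
  have hμE0 : μ E ≠ 0 := (zero_le.trans_lt hlt).ne'
  have hsplit : μ E = μ E ^ (1 / 4 : ℝ) * μ E ^ (3 / 4 : ℝ) := by
    rw [← ENNReal.rpow_add _ _ hμE0 hμE]
    norm_num
  have h34 : μ E ^ (3 / 4 : ℝ) ≠ 0 := by simp [hμE0, hμE]
  have h34' : μ E ^ (3 / 4 : ℝ) ≠ ∞ := ENNReal.rpow_ne_top_of_nonneg (by norm_num) hμE
  have hquarter : μ E ^ (1 / 4 : ℝ) ≤ 8 * D * ENNReal.ofReal ε := by
    rw [← ENNReal.mul_le_mul_iff_left h34 h34', ← hsplit]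
    exact hmul
  have hfinal : μ E ≤ (8 * D) ^ 4 * ENNReal.ofReal ε ^ 4 := by
    rw [← mul_pow]
    calc μ E = (μ E ^ (1 / 4 : ℝ)) ^ 4 := by
          rw [← ENNReal.rpow_natCast, ← ENNReal.rpow_mul]
          norm_num
      _ ≤ _ := pow_le_pow_left' hquarter 4
  exact absurd (hlt.trans_le hfinal) (lt_irrefl _)

/-- On a domain of finite measure the L¹ norm is controlled by the L^p norm, and |E|^(1/p) by
|E|^(3/4) since 1/p ≥ 3/4. Boundedness would thus give the excluded L¹ bound. -/
theorem not_isStrongType_wedge_of_le {p : ℝ≥0∞} (hp1 : 1 ≤ p) (hp : p ≤ ENNReal.ofReal (4 / 3)) :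
    ¬ IsStrongType (bergmanProjection wedgeOpens) p := by
  rintro ⟨C, hC, h⟩
  have hpt : p ≠ ∞ := ne_top_of_le_ne_top ENNReal.ofReal_ne_top hp
  have hp0 : p ≠ 0 := (zero_lt_one.trans_le hp1).ne'
  have hpr1 : 1 ≤ p.toReal := by simpa using ENNReal.toReal_mono hpt hp1
  have hpr : p.toReal ≤ 4 / 3 := ENNReal.toReal_le_of_le_ofReal (by norm_num) hp
  have hs : 0 ≤ 1 / p.toReal - 3 / 4 := by
    rw [sub_nonneg, div_le_div_iff₀ (by norm_num) (by linarith)]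
    linarith
  have hs1 : 0 ≤ 1 / (1 : ℝ≥0∞).toReal - 1 / p.toReal := by
    rw [ENNReal.toReal_one, sub_nonneg]
    exact one_div_le_one_div_of_le one_pos hpr1
  set μ := volume.restrict wedge with hμ
  set M := μ Set.univ with hM
  have hMt : M ≠ ∞ := measure_ne_top μ _
  refine not_lintegral_bergmanProjection_indicator_le (D := ENNReal.ofReal C *
    M ^ (1 / p.toReal - 3 / 4) * M ^ (1 / (1 : ℝ≥0∞).toReal - 1 / p.toReal)) (by finiteness) ?_
  intro E hE hμE
  set e := indicatorConstLp 2 hE hμE (1 : ℂ) with he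
  have hnorm : eLpNorm e p μ = μ E ^ (1 / p.toReal) := by
    refine (eLpNorm_congr_ae (indicatorConstLp_coeFn (hs := hE) (hμs := hμE) (c := (1 : ℂ)))).trans
      ((eLpNorm_indicator_const hE hp0 hpt).trans ?_)
    rw [enorm_one, one_mul]
    rfl
  have hμE' : μ E ≠ ∞ := hμE
  have hmem : MemLp e p μ := by
    refine ⟨Lp.aestronglyMeasurable e, ?_⟩
    rw [hnorm]
    exact (ENNReal.rpow_ne_top_of_nonneg (by positivity) hμE').lt_top
  have h1 : eLpNorm (bergmanProjection wedgeOpens e) 1 μ ≤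
      eLpNorm (bergmanProjection wedgeOpens e) p μ *
        M ^ (1 / (1 : ℝ≥0∞).toReal - 1 / p.toReal) :=
    eLpNorm_le_eLpNorm_mul_rpow_measure_univ hp1 (Lp.aestronglyMeasurable _)
  have h2 : eLpNorm (bergmanProjection wedgeOpens e) p μ ≤ ENNReal.ofReal C * eLpNorm e p μ :=
    h e hmem
  rw [hnorm] at h2
  have h3 : μ E ^ (1 / p.toReal) ≤ M ^ (1 / p.toReal - 3 / 4) * μ E ^ (3 / 4 : ℝ) := by
    calc μ E ^ (1 / p.toReal) = μ E ^ (1 / p.toReal - 3 / 4) * μ E ^ (3 / 4 : ℝ) := by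
          rw [← ENNReal.rpow_add_of_nonneg _ _ hs (by norm_num), sub_add_cancel]
      _ ≤ _ := mul_le_mul_left (ENNReal.rpow_le_rpow (measure_mono (Set.subset_univ E)) hs) _
  rw [← eLpNorm_one_eq_lintegral_enorm]
  calc _ ≤ ENNReal.ofReal C * (M ^ (1 / p.toReal - 3 / 4) * μ E ^ (3 / 4 : ℝ)) *
        M ^ (1 / (1 : ℝ≥0∞).toReal - 1 / p.toReal) :=
        h1.trans (mul_le_mul_left (h2.trans (mul_le_mul_right h3 _)) _)
    _ = _ := by ring

/-- Weak L^(4/3) embeds in L¹ on a set of finite measure. The layer cake integral of |P 1_E| is cut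
at a height where the trivial bound and the weak type bound are both of size |E|^(3/4). -/
theorem not_isRestrictedWeakType_wedge :
    ¬ IsRestrictedWeakType (bergmanProjection wedgeOpens) (4 / 3) := by
  rintro ⟨C, hC, h⟩
  set μ := volume.restrict wedge with hμ
  refine not_lintegral_bergmanProjection_indicator_le (D := μ Set.univ +
    ENNReal.ofReal (C ^ (4 / 3 : ℝ) * 3)) (by finiteness) ?_
  intro E hE hμE
  set e := indicatorConstLp 2 hE hμE (1 : ℂ) with he
  have hw : ∀ y : ℝ, 0 < y → μ {z | y < ‖bergmanProjection wedgeOpens e z‖} ≤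
      ENNReal.ofReal (C ^ (4 / 3 : ℝ) / y ^ (4 / 3 : ℝ)) * μ E := h E hE hμE
  have hμE' : μ E ≠ ∞ := hμE
  have hlayer : ∫⁻ z, ‖bergmanProjection wedgeOpens e z‖ₑ ∂μ =
      ∫⁻ t in Set.Ioi (0 : ℝ), μ {z | t < ‖bergmanProjection wedgeOpens e z‖} := by
    rw [← lintegral_eq_lintegral_meas_lt μ (ae_of_all _ fun z => norm_nonneg _)
      (Lp.aestronglyMeasurable (bergmanProjection wedgeOpens e)).norm.aemeasurable]
    simp only [ofReal_norm]
  rw [hlayer]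
  rcases eq_or_ne (μ E) 0 with h0 | h0
  · refine le_of_eq_of_le ?_ zero_le
    refine setLIntegral_eq_zero measurableSet_Ioi fun t ht => ?_
    have := hw t ht
    rw [h0, mul_zero] at this
    exact le_antisymm this zero_le
  · set m := μ.real E with hm
    have hm0 : 0 < m := ENNReal.toReal_pos h0 hμE'
    have hmE : μ E = ENNReal.ofReal m := (ofReal_measureReal hμE').symm
    -- Below y the measure of the domain bounds the distribution function. Above y, integrating
    -- t^(-4/3) gives 3 y^(-1/3), and m y^(-1/3) = y because m = y^(4/3).
    set y := m ^ (3 / 4 : ℝ) with hy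
    have hy0 : 0 < y := Real.rpow_pos_of_pos hm0 _
    have hyE : μ E ^ (3 / 4 : ℝ) = ENNReal.ofReal y := by
      rw [hmE, ENNReal.ofReal_rpow_of_pos hm0]
    rw [hyE, ← Set.Ioc_union_Ioi_eq_Ioi hy0.le]
    refine (lintegral_union_le _ _ _).trans ?_
    rw [add_mul]
    refine add_le_add ?_ ?_
    · refine (lintegral_mono (g := fun _ => μ Set.univ) fun t =>
        measure_mono (Set.subset_univ _)).trans (le_of_eq ?_)
      rw [setLIntegral_const, Real.volume_Ioc, sub_zero]
    · have hstep : ∀ t ∈ Set.Ioi y, μ {z | t < ‖bergmanProjection wedgeOpens e z‖} ≤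
          ENNReal.ofReal (C ^ (4 / 3 : ℝ) * m) * ENNReal.ofReal (t ^ (-(4 / 3) : ℝ)) := by
        intro t ht
        have ht0 : 0 < t := hy0.trans ht
        refine (hw t ht0).trans (le_of_eq ?_)
        rw [hmE, ← ENNReal.ofReal_mul (by positivity), ← ENNReal.ofReal_mul (by positivity),
          Real.rpow_neg ht0.le]
        congr 1
        ring
      refine (setLIntegral_mono' measurableSet_Ioi hstep).trans (le_of_eq ?_)
      rw [lintegral_const_mul' _ _ ENNReal.ofReal_ne_top, lintegral_Ioi_rpow (by norm_num) hy0,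
        ← ENNReal.ofReal_mul (by positivity), ← ENNReal.ofReal_mul (by positivity)]
      congr 1
      have hmy : m = y ^ (4 / 3 : ℝ) := by
        rw [hy, ← Real.rpow_mul hm0.le]
        norm_num
      have e1 : m * y ^ (-(4 / 3) + 1 : ℝ) = y := by
        rw [hmy, ← Real.rpow_add hy0]
        norm_num
      calc C ^ (4 / 3 : ℝ) * m * (-y ^ (-(4 / 3) + 1 : ℝ) / (-(4 / 3) + 1))
          = C ^ (4 / 3 : ℝ) * 3 * (m * y ^ (-(4 / 3) + 1 : ℝ)) := by ring
        _ = _ := by rw [e1]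

/-! ### The exact range of boundedness and the main theorem. -/

theorem setOf_isStrongType_wedge :
    {p : ℝ≥0∞ | 1 ≤ p ∧ IsStrongType (bergmanProjection wedgeOpens) p} =
      Set.Ioo (ENNReal.ofReal (4 / 3)) (ENNReal.ofReal 4) := by
  ext p
  rw [Set.mem_ofPred_eq, Set.mem_Ioo]
  constructor
  · rintro ⟨h1, h⟩
    constructor
    · by_contra! hp
      exact not_isStrongType_wedge_of_le h1 hp h
    · by_contra! hp
      exact not_isStrongType_wedge_of_four_le (by simpa using hp) h
  · rintro ⟨h1, h2⟩
    refine ⟨le_trans ?_ h1.le, isStrongType_wedge h1 h2⟩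
    rw [ENNReal.one_le_ofReal]
    norm_num

theorem mainTheorem2 :
    -- there are monomial polyhedra with irregular behaviour at the endpoints `p_*` and `q_*`
    (∃ (n : ℕ) (B : Matrix (Fin n) (Fin n) ℤ), IsMonomialPolyhedron B ∧
      {p : ℝ≥0∞ | 1 ≤ p ∧ IsStrongType (bergmanProjection (monomialOpens B)) p} =
        Set.Ioo (ENNReal.ofReal (pStar B)) (ENNReal.ofReal (qStar B)) ∧
      ¬ IsRestrictedWeakType (bergmanProjection (monomialOpens B)) (pStar B) ∧
      ¬ IsWeakType (bergmanProjection (monomialOpens B)) (qStar B)) ∧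
    -- the domain `{|z₁ z₃| < |z₂| < |z₁| < 1}` in `ℂ³` is an example, with `p_* = 4/3`, `q_* = 4`
    (∃ B : Matrix (Fin 3) (Fin 3) ℤ, IsMonomialPolyhedron B ∧
      (monomialOpens B : Set (Fin 3 → ℂ)) =
        {z | ‖z 0 * z 2‖ < ‖z 1‖ ∧ ‖z 1‖ < ‖z 0‖ ∧ ‖z 0‖ < 1} ∧
      pStar B = 4 / 3 ∧ qStar B = 4 ∧
      {p : ℝ≥0∞ | 1 ≤ p ∧ IsStrongType (bergmanProjection (monomialOpens B)) p} =
        Set.Ioo (ENNReal.ofReal (4 / 3)) (ENNReal.ofReal 4) ∧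
      ¬ IsRestrictedWeakType (bergmanProjection (monomialOpens B)) (4 / 3) ∧
      ¬ IsWeakType (bergmanProjection (monomialOpens B)) 4) := by
  refine ⟨⟨3, wedgeMatrix, isMonomialPolyhedron_wedgeMatrix, ?_⟩,
    ⟨wedgeMatrix, isMonomialPolyhedron_wedgeMatrix, monomialSet_wedgeMatrix, pStar_wedgeMatrix,
      qStar_wedgeMatrix, ?_⟩⟩
  · rw [pStar_wedgeMatrix, qStar_wedgeMatrix, monomialOpens_wedgeMatrix]
    exact ⟨setOf_isStrongType_wedge, not_isRestrictedWeakType_wedge, not_isWeakType_wedge⟩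
  · rw [monomialOpens_wedgeMatrix]
    exact ⟨setOf_isStrongType_wedge, not_isRestrictedWeakType_wedge, not_isWeakType_wedge⟩
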